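/- Let $N\ge 3$ and $0<s<1$. Let $\mathcal C=\mathbb R\times\mathbb S^{N-1}$ carry the measure $dt\,dw$ ($dw$ the surface measure). For $\alpha\in\mathbb R$ put $L^2_\alpha=L^2(\mathbb R^N;|x|^{-2\alpha}dx)$ and $(\Phi_\alpha u)(t,w)=e^{\frac{N-2\alpha}{2}t}u(e^tw)$. Let $\mu_\ell=\ell(\ell+N-2)$, let $(Y_{\ell,m})_m$ be an orthonormal basis of the spherical harmonics of degree $\ell$, and for $v\in L^2(\mathcal C)$ let $\widehat v(\xi,\ell,m)$ be the unitary Fourier transform (kernel $(2\pi)^{-1/2}e^{-i\xi t}$) of $t\mapsto\int_{\mathbb S^{N-1}}v(t,w)\overline{Y_{\ell,m}(w)}\,dw$. Put $$P_s(\xi,\ell)=2^{2s}\left|\frac{\Gamma\left(\frac{N+2s+2\ell+2i\xi}{4}\right)}{\Gamma\left(\frac{N-2s+2\ell+2i\xi}{4}\right)}\right|^2-2^{2s}\frac{\Gamma\left(\frac{N+2s}{4}\right)^2}{\Gamma\left(\frac{N-2s}{4}\right)^2},\qquad \bar m(\xi,\ell)=\sqrt{\frac{P_s(\xi,\ell)}{\xi^2+\mu_\ell}}$$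 for $(\xi,\ell)\in\mathbb R\times\mathbb N_0$, $(\xi,\ell)\ne(0,0)$. Here $P_s\ge 0$, and for every $v\in L^2(\mathcal C)$ there is exactly one $M_sv\in L^2(\mathcal C)$ with $\widehat{M_sv}(\xi,\ell,m)=\bar m(\xi,\ell)\,\widehat v(\xi,\ell,m)$ for all $\ell,m$ and almost every $\xi$. Define $$T[u](x)=|x|^{-\frac{N-2}{2}}\Big(M_s\big[|\cdot|^{\frac{N-2s}{2}}u\big]\Big)\Big(\ln|x|,\tfrac{x}{|x|}\Big),$$ where $|\cdot|^{\frac{N-2s}{2}}u$ is read as a function of $(t,w)$ through $x=e^tw$; in particular $T[u]$ is defined for every Schwartz function $u\in\mathcal S(\mathbb R^N)\subset L^2_s$. Then: (i) For every $\alpha\in\mathbb R$, in particular for $\alpha=s$, $\Phi_\alpha$ is an isometric isomorphism from $L^2_\alpha$ onto $L^2(\mathcal C)$, and $T=\Phi_1^{-1}M_s\Phi_s$. (ii) $\bar m\in L^\infty(\mathbb R\times\mathbb N_0)$, and $\bar m(\xi,\ell)\sim(\xi^2+\ell^2)^{\frac{s-1}{2}}$ (the quotient tends to $1$) as $\xi^2+\ell^2\to\infty$.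 In particular $M_s$ is a pseudo-differential operator on $\mathcal C$ of negative order $s-1$: with a suitable value at $(0,0)$, its symbol $\bar m$ is smooth in $\xi$ and satisfies $|\partial_\xi^j\Delta_\ell^k\bar m(\xi,\ell)|\le C_{j,k}(1+|\xi|+\ell)^{s-1-j-k}$ for all $j,k\ge 0$, where $\Delta_\ell$ is the forward difference in $\ell$. (iii) $T$ extends uniquely from $\mathcal S(\mathbb R^N)$ to a bounded linear map $T:L^2_s\to L^2_1$, and this extension (given by the same formula) is injective. (iv) With $(D_\lambda u)(x)=u(\lambda x)$, one has $T\circ D_\lambda=\lambda^{s-1}D_\lambda\circ T$ on $L^2_s$ for every $\lambda>0$. (v) With $\|v\|_{H^{r}(\mathcal C)}^2=\sum_{\ell}\sum_m\int_{\mathbb R}(1+\xi^2+\mu_\ell)^{r}|\widehat v(\xi,\ell,m)|^2\,d\xi$ for $r\ge 0$, there is a constant $C=C(N,s)>0$ with $\|M_sv\|_{H^{1-s}(\mathcal C)}\le C\|v\|_{L^2(\mathcal C)}$ for all $v\in L^2(\mathcal C)$; and $T(L^2_s)\subset\Phi_1^{-1}(H^{1-s}(\mathcal C))$. -/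

import Mathlib

open MeasureTheory Filter Topology
open scoped ENNReal FourierTransform SchwartzMap

noncomputable section

namespace HardyTransport

/-! ### The spaces -/

/-- Euclidean space `ℝ^N`. -/
abbrev Eu (N : ℕ) : Type := EuclideanSpace ℝ (Fin N)

/-- The unit sphere `S^{N-1}` of `ℝ^N`. -/
abbrev Sph (N : ℕ) : Type := Metric.sphere (0 : Eu N) 1

/-- Surface measure on `S^{N-1}`. -/
def surf (N : ℕ) : Measure (Sph N) := (volume : Measure (Eu N)).toSphere

instance (N : ℕ) : IsFiniteMeasure (surf N) :=
  inferInstanceAs (IsFiniteMeasure (volume : Measure (Eu N)).toSphere)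

/-- The measure `dt dw` on the cylinder `ℝ × S^{N-1}`. -/
def cylMeas (N : ℕ) : Measure (ℝ × Sph N) := (volume : Measure ℝ).prod (surf N)

/-- The measure `|x|^{-2α} dx` on `ℝ^N`. -/
def wMeas (N : ℕ) (α : ℝ) : Measure (Eu N) :=
  (volume : Measure (Eu N)).withDensity fun x => ENNReal.ofReal (‖x‖ ^ (-2 * α))

/-- `L²(S^{N-1})`. -/
abbrev L2Sph (N : ℕ) : Type := Lp ℂ 2 (surf N)

/-- `L²(ℝ × S^{N-1})`. -/
abbrev L2Cyl (N : ℕ) : Type := Lp ℂ 2 (cylMeas N)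

/-- `L²(ℝ^N; |x|^{-2α} dx)`. -/
abbrev L2w (N : ℕ) (α : ℝ) : Type := Lp ℂ 2 (wMeas N α)

open Classical in
/-- The class in `L²(μ)` of a square integrable function (and `0` for any other function). -/
def toL2 {X : Type} [MeasurableSpace X] (μ : Measure X) (f : X → ℂ) : Lp ℂ 2 μ :=
  if h : MemLp f 2 μ then h.toLp f else 0

/-! ### Logarithmic polar coordinates `x = e^t w` -/

/-- A function on `ℝ^N`, read on the cylinder: `(t, w) ↦ g (e^t w)`. -/
def toCyl {N : ℕ} (g : Eu N → ℂ) : ℝ × Sph N → ℂ :=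
  fun p => g (Real.exp p.1 • (p.2 : Eu N))

/-- A function on the cylinder, read on `ℝ^N ∖ {0}`: `x ↦ g (ln |x|, x / |x|)`
(with value `0` at the origin, a null set). -/
def fromCyl {N : ℕ} (g : ℝ × Sph N → ℂ) : Eu N → ℂ :=
  fun x => if h : x = 0 then 0 else
    g (Real.log ‖x‖, ⟨‖x‖⁻¹ • x, by
      simp [norm_smul, inv_mul_cancel₀ (norm_ne_zero_iff.mpr h)]⟩)

/-- The conformal transform `(Φ_α u)(t, w) = e^{(N-2α)t/2} u (e^t w)`. -/
def lift {N : ℕ} (α : ℝ) (u : Eu N → ℂ) : ℝ × Sph N → ℂ :=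
  fun p => (Real.exp (((N : ℝ) - 2 * α) / 2 * p.1) : ℂ) * u (Real.exp p.1 • (p.2 : Eu N))

/-! ### Spherical harmonics -/

/-- The Laplacian on polynomials in `N` variables. -/
def polyLaplacian (N : ℕ) : MvPolynomial (Fin N) ℂ →ₗ[ℂ] MvPolynomial (Fin N) ℂ :=
  ∑ i : Fin N, (MvPolynomial.pderiv i).toLinearMap ∘ₗ (MvPolynomial.pderiv i).toLinearMap

/-- Harmonic homogeneous polynomials of degree `ℓ`. -/
def harmonicPoly (N ℓ : ℕ) : Submodule ℂ (MvPolynomial (Fin N) ℂ) :=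
  MvPolynomial.homogeneousSubmodule (Fin N) ℂ ℓ ⊓ LinearMap.ker (polyLaplacian N)

/-- Restriction of a polynomial to the sphere. -/
def polyRestrict (N : ℕ) : MvPolynomial (Fin N) ℂ →ₐ[ℂ] C(Sph N, ℂ) :=
  MvPolynomial.aeval fun i => (⟨fun w => (((w : Eu N) i : ℝ) : ℂ), by fun_prop⟩ : C(Sph N, ℂ))

/-- The space of spherical harmonics of degree `ℓ`, inside `L²(S^{N-1})`. -/
def sphHarm (N ℓ : ℕ) : Submodule ℂ (L2Sph N) :=
  (harmonicPoly N ℓ).map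
    ((ContinuousMap.toLp 2 (surf N) ℂ : C(Sph N, ℂ) →L[ℂ] L2Sph N).toLinearMap ∘ₗ
      (polyRestrict N).toLinearMap)

instance (N ℓ : ℕ) : FiniteDimensional ℂ (sphHarm N ℓ) := by
  have h1 : FiniteDimensional ℂ (MvPolynomial.homogeneousSubmodule (Fin N) ℂ ℓ) :=
    Module.Finite.iff_fg.mpr (MvPolynomial.homogeneousSubmodule_fg (Fin N) ℂ ℓ)
  have h2 : FiniteDimensional ℂ (harmonicPoly N ℓ) :=
    Submodule.finiteDimensional_of_le inf_le_left
  unfold sphHarm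
  infer_instance

/-- The multiplicity `d_ℓ`: the dimension of the space of spherical harmonics of degree `ℓ`. -/
def mult (N ℓ : ℕ) : ℕ := Module.finrank ℂ (sphHarm N ℓ)

/-- An orthonormal basis `Y_{ℓ,m}` of the spherical harmonics of degree `ℓ`. -/
def sphBasis (N ℓ : ℕ) : OrthonormalBasis (Fin (mult N ℓ)) ℂ (sphHarm N ℓ) :=
  stdOrthonormalBasis ℂ (sphHarm N ℓ)

/-! ### Fourier transform on the cylinder -/

/-- The coefficient `t ↦ ∫ v(t, w) conj (Y_{ℓ,m}(w)) dw`. -/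
def sphCoef {N : ℕ} (v : L2Cyl N) (ℓ : ℕ) (m : Fin (mult N ℓ)) : ℝ → ℂ :=
  fun t => ∫ w, v (t, w) * star (((sphBasis N ℓ m : sphHarm N ℓ) : L2Sph N) w) ∂(surf N)

/-- The Fourier transform `v̂(ξ, ℓ, m)` on the cylinder: the unitary `L²` Fourier transform
`(2π)^{-1/2} ∫ e^{-iξt} (…) dt` of the spherical harmonic coefficients.
The factor and the rescaling pass from the kernel `e^{-2πiξt}` of `𝓕` to `e^{-iξt}`. -/
def cylFourier {N : ℕ} (v : L2Cyl N) (ℓ : ℕ) (m : Fin (mult N ℓ)) : ℝ → ℂ :=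
  fun ξ => ((Real.sqrt (2 * Real.pi))⁻¹ : ℂ) *
    (𝓕 (toL2 volume (sphCoef v ℓ m)) : Lp ℂ 2 (volume : Measure ℝ)) (ξ / (2 * Real.pi))

/-- `w = Op(a) v`, for a symbol `a` on `ℝ × ℕ`: `ŵ(ξ, ℓ, m) = a(ξ, ℓ) v̂(ξ, ℓ, m)`. -/
def IsMultiplierImage {N : ℕ} (a : ℝ → ℕ → ℝ) (v w : L2Cyl N) : Prop :=
  ∀ (ℓ : ℕ) (m : Fin (mult N ℓ)),
    cylFourier w ℓ m =ᵐ[volume] fun ξ => (a ξ ℓ : ℂ) * cylFourier v ℓ m ξ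

/-- Symbols of order `r` (type `(1, 0)`) on the dual `ℝ × ℕ` of the cylinder: smooth in `ξ`, with
`|∂_ξ^j Δ_ℓ^k a(ξ, ℓ)| ≤ C_{j,k} (1 + |ξ| + ℓ)^{r - j - k}`, where the forward difference `Δ_ℓ`
plays the role of the derivative in the discrete variable. -/
def IsSymbol (r : ℝ) (a : ℝ → ℕ → ℝ) : Prop :=
  (∀ ℓ : ℕ, ContDiff ℝ ((⊤ : ℕ∞) : WithTop ℕ∞) fun ξ => a ξ ℓ) ∧
  ∀ j k : ℕ, ∃ C : ℝ, ∀ (ξ : ℝ) (ℓ : ℕ),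
    |iteratedDeriv j (fun η => (fwdDiff 1)^[k] (a η) ℓ) ξ|
      ≤ C * (1 + |ξ| + (ℓ : ℝ)) ^ (r - (j : ℝ) - (k : ℝ))

/-- `A` is the translation and rotation invariant pseudo-differential operator of order `r` with
symbol `a` on the cylinder, acting on `L²`: `a` is a symbol of order `r`, and `A = Op(a)`. -/
def IsPseudoDiff {N : ℕ} (r : ℝ) (a : ℝ → ℕ → ℝ) (A : L2Cyl N → L2Cyl N) : Prop :=
  IsSymbol r a ∧ ∀ v, IsMultiplierImage a v (A v)

/-- The eigenvalues `μ_ℓ = ℓ (ℓ + N - 2)` of the Laplace–Beltrami operator on `S^{N-1}`. -/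
def eigval (N ℓ : ℕ) : ℝ := (ℓ : ℝ) * ((ℓ : ℝ) + (N : ℝ) - 2)

/-- The norm of the Sobolev space `H^r` of the cylinder, with value `∞` outside that space:
`‖v‖² = ∑_ℓ ∑_m ∫ (1 + ξ² + μ_ℓ)^r |v̂(ξ, ℓ, m)|² dξ`. -/
def sobolevNorm {N : ℕ} (r : ℝ) (v : L2Cyl N) : ℝ≥0∞ :=
  (∑' ℓ : ℕ, ∑ m : Fin (mult N ℓ),
    ∫⁻ ξ : ℝ, ENNReal.ofReal ((1 + ξ ^ 2 + eigval N ℓ) ^ r * ‖cylFourier v ℓ m ξ‖ ^ 2)) ^ (1 / 2 : ℝ)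

/-- The Sobolev space `H^r` of the cylinder, for `r ≥ 0`. -/
def sobolevCyl (N : ℕ) (r : ℝ) : Set (L2Cyl N) := {v | sobolevNorm r v < ∞}

/-! ### The multiplier and the transformation -/

/-- `C_{N,s} = 2^{2s} Γ((N+2s)/4)² / Γ((N-2s)/4)²`. -/
def hardyConst (N : ℕ) (s : ℝ) : ℝ :=
  (2 : ℝ) ^ (2 * s) *
    (Real.Gamma (((N : ℝ) + 2 * s) / 4) ^ 2 / Real.Gamma (((N : ℝ) - 2 * s) / 4) ^ 2)

/-- `P_s(ξ, ℓ) = 2^{2s} |Γ((N+2s+2ℓ+2iξ)/4) / Γ((N-2s+2ℓ+2iξ)/4)|² - C_{N,s}`. -/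
def hardySymbol (N : ℕ) (s ξ : ℝ) (ℓ : ℕ) : ℝ :=
  (2 : ℝ) ^ (2 * s) *
    ‖Complex.Gamma (((N : ℂ) + 2 * (s : ℂ) + 2 * (ℓ : ℂ) + 2 * Complex.I * (ξ : ℂ)) / 4) /
      Complex.Gamma (((N : ℂ) - 2 * (s : ℂ) + 2 * (ℓ : ℂ) + 2 * Complex.I * (ξ : ℂ)) / 4)‖ ^ 2
    - hardyConst N s

/-- The multiplier `m̄(ξ, ℓ) = √(P_s(ξ, ℓ) / (ξ² + μ_ℓ))`. The quotient is `0/0` at the single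
point `(0, 0)`, where the value is immaterial to the operator. -/
def mbar (N : ℕ) (s ξ : ℝ) (ℓ : ℕ) : ℝ :=
  Real.sqrt (hardySymbol N s ξ ℓ / (ξ ^ 2 + eigval N ℓ))

open Classical in
/-- The operator `M_s`: `M_s v` is the element of `L²` of the cylinder with
`(M_s v)^(ξ, ℓ, m) = m̄(ξ, ℓ) v̂(ξ, ℓ, m)`. -/
def Ms (N : ℕ) (s : ℝ) (v : L2Cyl N) : L2Cyl N :=
  if h : ∃ w : L2Cyl N, IsMultiplierImage (mbar N s) v w then h.choose else 0

/-- The transformation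
`T[u](x) = |x|^{-(N-2)/2} (M_s [|·|^{(N-2s)/2} u(·)]) (ln |x|, x / |x|)`, defined for almost
every `x`. -/
def T {N : ℕ} (s : ℝ) (u : Eu N → ℂ) : Eu N → ℂ :=
  fun x => ((‖x‖ ^ (-(((N : ℝ) - 2) / 2)) : ℝ) : ℂ) *
    fromCyl (Ms N s (toL2 (cylMeas N)
      (toCyl fun y => ((‖y‖ ^ (((N : ℝ) - 2 * s) / 2) : ℝ) : ℂ) * u y))) x

/-- The dilation `(D_λ u)(x) = u(λ x)`. -/
def dilate {N : ℕ} (lam : ℝ) (u : Eu N → ℂ) : Eu N → ℂ := fun x => u (lam • x)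

end HardyTransport

end

noncomputable section

namespace HardyTransport

/-! ### Quotients of Gamma functions -/

/-! In logarithmic polar coordinates `x = e^t w` Lebesgue measure becomes `e^{Nt} dt dw`, so the
weight `|x|^{-2α}` is absorbed exactly by the factor `e^{(N-2α)t/2}` and every conformal transform
is an isometry (`eLpNorm_lift`, `conformal`). On the cylinder, expansion in spherical harmonics
followed by the Fourier transform in `t` turns `L²` into a Hilbert sum of copies of `L²(ℝ)`
(`isHilbertSum_harmEmbedding`, `harmExpansion`), on which `M_s` is multiplication by `m̄`. The
operator statements are then read off from the multiplier. Boundedness of `m̄` gives existence and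
continuity. Its positivity away from `(0, 0)` gives injectivity. Characters commute with the
multiplier, so `M_s` commutes with translations in `t`, which correspond to dilations of `x`. The
decay `m̄ ≤ C (1 + |ξ| + ℓ)^{s-1}` gives the Sobolev gain. Uniqueness of the extension is density of
Schwartz functions in the weighted space.

The analytic work lies in the symbol, that is, in the quotient `Γ(z + σ) / Γ(z - σ)` with `σ = s /
2` and `z = (N/2 + ℓ + iξ) / 2`. Gauss's limit writes the quotient as a limit of `n^{2σ}` times a
product of factors `(z - σ + j) / (z + σ + j)`. Comparing moduli factor by factor gives
monotonicity, hence `P_s ≥ 0`, with strictness and quadratic growth at `ξ = 0` from the first factor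
alone (`norm_gammaRatio_sq_lower`, `hardySymbol_pos`). Taking logarithms and telescoping gives
`z^{2σ} e^{-R(z)}` with `R(z) = O(|z|^{-1/2})` in a sector (`gammaRatio_eq_exp`), hence the
asymptotics of `m̄`.

The symbol estimates need no differentiation of Gamma functions. For large `ρ = 1 + |ξ| + ℓ` the
function `m̄` extends holomorphically in both variables to a polydisc of radius `c ρ` with a bound
`K ρ^{s-1}` (`exists_holomorphic_extension`). Cauchy's estimate then gains `ρ^{-1}` for each
derivative, and likewise for each unit difference, which is controlled by a derivative along a unit
segment. At `(0, 0)` the singularity is removable, because `P_s(ξ, 0)` is even and vanishes there to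
order exactly two (`reducedSymbol_pos`).

Completeness of the spherical harmonics comes from decomposing polynomials into powers of `|x|²`
times harmonic ones together with Stone–Weierstrass. Orthogonality is algebraic: a multiple of `p q`
is a sum of images of rotation generators, and these integrate to zero by rotation invariance
(`sum_rotGen_harmonic`, `integral_rotGen`). -/

/-- The quotient `Γ(z + σ) / Γ(z - σ)`. -/
def gammaRatio (σ : ℝ) (z : ℂ) : ℂ :=
  Complex.Gamma (z + σ) / Complex.Gamma (z - σ)

theorem gammaRatio_ne_zero {σ : ℝ} (hσ : 0 ≤ σ) {z : ℂ} (hz : σ < z.re) :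
    gammaRatio σ z ≠ 0 := by
  refine div_ne_zero ?_ ?_ <;> apply Complex.Gamma_ne_zero_of_re_pos <;> simp <;> linarith

theorem ne_neg_nat_of_mem_slitPlane {z : ℂ} (hz : z ∈ Complex.slitPlane) (m : ℕ) : z ≠ -m := by
  rintro rfl
  rcases hz with h | h
  · simp at h
    linarith [(Nat.cast_nonneg m : (0 : ℝ) ≤ m)]
  · simp at h

/-- The reciprocal of `Γ` is entire, so only poles of the numerator can obstruct; hence a condition
on `z + σ` alone. -/
theorem differentiableAt_gammaRatio {σ : ℝ} {z : ℂ} (hz : z + σ ∈ Complex.slitPlane) :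
    DifferentiableAt ℂ (gammaRatio σ) z := by
  have h1 : DifferentiableAt ℂ (fun z : ℂ => Complex.Gamma (z + σ)) z :=
    (Complex.differentiableAt_Gamma _ (ne_neg_nat_of_mem_slitPlane hz)).comp z
      (differentiableAt_id.add_const _)
  have h2 : DifferentiableAt ℂ (fun z : ℂ => (Complex.Gamma (z - σ))⁻¹) z :=
    (Complex.differentiable_one_div_Gamma _).comp z (differentiableAt_id.sub_const _)
  exact (h1.mul h2).congr_of_eventuallyEq (Eventually.of_forall fun w => by
    simp [gammaRatio, div_eq_mul_inv])

theorem gammaRatio_conj (σ : ℝ) (z : ℂ) :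
    gammaRatio σ (starRingEnd ℂ z) = starRingEnd ℂ (gammaRatio σ z) := by
  unfold gammaRatio
  rw [map_div₀, ← Complex.Gamma_conj, ← Complex.Gamma_conj]
  simp

/-- The partial products of Gauss's limit for `gammaRatio`. -/
def gammaRatioSeq (σ : ℝ) (z : ℂ) (n : ℕ) : ℂ :=
  Complex.exp (2 * σ * Real.log n) * ∏ j ∈ Finset.range (n + 1), (z - σ + j) / (z + σ + j)

theorem gammaRatioSeq_tendsto {σ : ℝ} {z : ℂ} (hz : z - σ ∈ Complex.slitPlane) :
    Tendsto (gammaRatioSeq σ z) atTop (𝓝 (gammaRatio σ z)) := by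
  have h := (Complex.GammaSeq_tendsto_Gamma (z + σ)).div (Complex.GammaSeq_tendsto_Gamma (z - σ))
    (Complex.Gamma_ne_zero (ne_neg_nat_of_mem_slitPlane hz))
  refine h.congr' ?_
  filter_upwards [eventually_ne_atTop 0] with n hn
  have hn' : (n : ℂ) ≠ 0 := by exact_mod_cast hn
  have hfac : ((n.factorial : ℕ) : ℂ) ≠ 0 := by exact_mod_cast n.factorial_ne_zero
  simp only [Pi.div_apply, Complex.GammaSeq, gammaRatioSeq]
  rw [Finset.prod_div_distrib, Complex.cpow_def_of_ne_zero hn', Complex.cpow_def_of_ne_zero hn',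
    Complex.natCast_log]
  have : Complex.exp (Complex.log n * (z + σ)) =
      Complex.exp (2 * σ * Complex.log n) * Complex.exp (Complex.log n * (z - σ)) := by
    rw [← Complex.exp_add]; ring_nf
  rw [this]
  have h1 := Complex.exp_ne_zero (Complex.log n * (z - σ))
  field_simp

/-- The prefactor `n^{2σ}` in the partial products does not depend on the point, so factorwise
comparison survives in the limit. -/
theorem norm_gammaRatio_le_of_factors {σ : ℝ} {z w : ℂ} (hz : z - σ ∈ Complex.slitPlane)
    (hw : w - σ ∈ Complex.slitPlane)
    (h : ∀ j : ℕ, ‖(w - σ + j) / (w + σ + j)‖ ≤ ‖(z - σ + j) / (z + σ + j)‖) :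
    ‖gammaRatio σ w‖ ≤ ‖gammaRatio σ z‖ := by
  refine le_of_tendsto_of_tendsto' (gammaRatioSeq_tendsto hw).norm
    (gammaRatioSeq_tendsto hz).norm fun n => ?_
  simp only [gammaRatioSeq, norm_mul, norm_prod]
  gcongr with j
  exact h j

/-- After squaring and clearing denominators the two sides differ by `4 x σ y²`. -/
theorem norm_factor_ofReal_le {σ x y : ℝ} (hσ : 0 ≤ σ) (hx : σ < x) :
    ‖((x : ℂ) - σ) / (x + σ)‖ ≤ ‖((x : ℂ) + y * Complex.I - σ) / (x + y * Complex.I + σ)‖ := by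
  have e1 : ((x : ℂ) - σ) / (x + σ) = ((x - σ) / (x + σ) : ℝ) := by push_cast; rfl
  rw [e1, Complex.norm_real, Real.norm_of_nonneg (by apply div_nonneg <;> linarith), norm_div,
    div_le_div_iff₀ (by linarith)]
  · have e2 : ‖(x : ℂ) + y * Complex.I + σ‖ = Real.sqrt ((x + σ) ^ 2 + y ^ 2) := by
      rw [Complex.norm_def, Complex.normSq_apply]; simp; ring_nf
    have e3 : ‖(x : ℂ) + y * Complex.I - σ‖ = Real.sqrt ((x - σ) ^ 2 + y ^ 2) := by
      rw [Complex.norm_def, Complex.normSq_apply]; simp; ring_nf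
    rw [e2, e3]
    refine (sq_le_sq₀ (mul_nonneg (by linarith) (Real.sqrt_nonneg _))
      (mul_nonneg (Real.sqrt_nonneg _) (by linarith))).1 ?_
    rw [mul_pow, mul_pow, Real.sq_sqrt (by positivity), Real.sq_sqrt (by positivity)]
    nlinarith [mul_nonneg (mul_nonneg hσ (by linarith : (0:ℝ) ≤ x)) (sq_nonneg y)]
  · rw [norm_pos_iff]
    intro h
    have := congrArg Complex.re h
    simp at this
    linarith

theorem mem_slitPlane_of_re {z : ℂ} {σ : ℝ} (h : σ < z.re) : z - σ ∈ Complex.slitPlane := by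
  left; simp; linarith

theorem norm_gammaRatio_re_le {σ : ℝ} (hσ : 0 ≤ σ) {z : ℂ} (hz : σ < z.re) :
    ‖gammaRatio σ z.re‖ ≤ ‖gammaRatio σ z‖ := by
  refine norm_gammaRatio_le_of_factors (mem_slitPlane_of_re hz)
    (mem_slitPlane_of_re (by simpa using hz)) fun j => ?_
  have h := norm_factor_ofReal_le (σ := σ) (x := z.re + j) (y := z.im) hσ
    (by linarith [(Nat.cast_nonneg j : (0 : ℝ) ≤ j)])
  have e : z = (z.re : ℂ) + z.im * Complex.I := (Complex.re_add_im z).symm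
  conv_rhs => rw [e]
  convert h using 3 <;> push_cast <;> ring

theorem norm_gammaRatio_mono {σ : ℝ} (hσ : 0 ≤ σ) {x y : ℝ} (hx : σ < x) (hxy : x ≤ y) :
    ‖gammaRatio σ x‖ ≤ ‖gammaRatio σ y‖ := by
  refine norm_gammaRatio_le_of_factors (mem_slitPlane_of_re (by simp; linarith))
    (mem_slitPlane_of_re (by simpa using hx)) fun j => ?_
  have hj : (0 : ℝ) ≤ j := Nat.cast_nonneg j
  have e (x : ℝ) : ((x : ℂ) - σ + j) / (x + σ + j) = ((x - σ + j) / (x + σ + j) : ℝ) := by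
    push_cast; rfl
  rw [e, e, Complex.norm_real, Complex.norm_real,
    Real.norm_of_nonneg (by apply div_nonneg <;> linarith),
    Real.norm_of_nonneg (by apply div_nonneg <;> linarith),
    div_le_div_iff₀ (by linarith) (by linarith)]
  nlinarith

theorem gammaRatio_eq_add_one {σ : ℝ} {z : ℂ} (h1 : z + σ ≠ 0) (h2 : z - σ ≠ 0) :
    gammaRatio σ z = gammaRatio σ (z + 1) * ((z - σ) / (z + σ)) := by
  have e1 := Complex.Gamma_add_one _ h1
  have e2 := Complex.Gamma_add_one _ h2
  unfold gammaRatio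
  rw [show z + 1 + σ = z + σ + 1 by ring, show z + 1 - σ = z - σ + 1 by ring, e1, e2]
  field_simp

theorem ne_zero_of_re_pos {z : ℂ} (h : 0 < z.re) : z ≠ 0 := by
  rintro rfl; simp at h

/-- Quantitative form of the monotonicity of `|Γ(z + σ) / Γ(z - σ)|` in the imaginary part. -/
theorem norm_gammaRatio_sq_lower {σ : ℝ} (hσ : 0 ≤ σ) {z : ℂ} (hz : σ < z.re) :
    ‖gammaRatio σ z.re‖ ^ 2 * (1 + 4 * z.re * σ / (z.re - σ) ^ 2 * z.im ^ 2 /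
      ((z.re + σ) ^ 2 + z.im ^ 2)) ≤ ‖gammaRatio σ z‖ ^ 2 := by
  have e1 := gammaRatio_eq_add_one (σ := σ) (z := z) (ne_zero_of_re_pos (by simp; linarith))
    (ne_zero_of_re_pos (by simp; linarith))
  have e2 := gammaRatio_eq_add_one (σ := σ) (z := (z.re : ℂ))
    (ne_zero_of_re_pos (by simp; linarith)) (ne_zero_of_re_pos (by simp; linarith))
  -- Only the first factor is computed exactly; the remaining ones are compared through monotonicity
  -- at `z + 1`.
  have h := norm_gammaRatio_re_le hσ (z := z + 1) (by simp; linarith)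
  have e3 : (((z + 1).re : ℝ) : ℂ) = z.re + 1 := by simp
  rw [e3] at h
  rw [e1, e2, norm_mul, norm_mul, mul_pow, mul_pow]
  have hx : 0 < z.re - σ := by linarith
  have hx' : 0 < z.re + σ := by linarith
  have f1 : ‖(z - σ) / (z + σ)‖ ^ 2 =
      ((z.re - σ) ^ 2 + z.im ^ 2) / ((z.re + σ) ^ 2 + z.im ^ 2) := by
    rw [norm_div, div_pow, Complex.sq_norm, Complex.sq_norm, Complex.normSq_apply,
      Complex.normSq_apply]
    simp; ring_nf
  have f2 : ‖((z.re : ℂ) - σ) / (z.re + σ)‖ ^ 2 = (z.re - σ) ^ 2 / (z.re + σ) ^ 2 := by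
    rw [norm_div, div_pow, Complex.sq_norm, Complex.sq_norm, Complex.normSq_apply,
      Complex.normSq_apply]
    simp; ring_nf
  rw [f1, f2]
  have key : (z.re - σ) ^ 2 / (z.re + σ) ^ 2 * (1 + 4 * z.re * σ / (z.re - σ) ^ 2 * z.im ^ 2 /
      ((z.re + σ) ^ 2 + z.im ^ 2)) =
      ((z.re - σ) ^ 2 + z.im ^ 2) / ((z.re + σ) ^ 2 + z.im ^ 2) := by
    have : 0 < (z.re + σ) ^ 2 + z.im ^ 2 := by positivity
    field_simp
    ring
  rw [mul_assoc, key]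
  gcongr

/-! ### Asymptotics of the quotient in a sector -/

/-- A sector of opening larger than a half plane. -/
def sector : Set ℂ := {z | -‖z‖ / 2 < z.re}

/-- In the sector `|z + t|² ≥ |z|² - t|z| + t²`, and this exceeds `(|z| + t)² / 4` by `3 (|z| - t)²
/ 4`. Translates of `z` therefore move away linearly, which makes the remainder series converge. -/
theorem norm_add_ofReal_lower {z : ℂ} (hz : z ∈ sector) {t : ℝ} (ht : 0 ≤ t) :
    (‖z‖ + t) / 2 ≤ ‖z + t‖ := by
  refine (sq_le_sq₀ (by positivity) (norm_nonneg _)).1 ?_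
  have h1 : ‖z + t‖ ^ 2 = ‖z‖ ^ 2 + 2 * t * z.re + t ^ 2 := by
    rw [Complex.sq_norm, Complex.sq_norm, Complex.normSq_apply, Complex.normSq_apply]
    simp; ring
  rw [h1]
  have h2 : -‖z‖ / 2 < z.re := hz
  nlinarith [sq_nonneg (‖z‖ - t), mul_nonneg ht (by linarith : 0 ≤ z.re + ‖z‖ / 2)]

theorem add_natCast_mem_sector {z : ℂ} (hz : z ∈ sector) (n : ℕ) : z + n ∈ sector := by
  have h : -‖z‖ / 2 < z.re := hz
  have hn : (0 : ℝ) ≤ n := Nat.cast_nonneg n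
  have h1 : ‖z‖ ≤ ‖z + n‖ + n := by
    have := norm_sub_le (z + n) n
    simpa using this
  change -‖z + n‖ / 2 < (z + n).re
  rw [Complex.add_re, Complex.natCast_re]
  have h3 := norm_nonneg (z + n)
  linarith

theorem mem_slitPlane_of_mem_sector {z : ℂ} (hz : z ∈ sector) (hz2 : 2 ≤ ‖z‖) {t : ℝ}
    (ht : |t| ≤ 1) : z + t ∈ Complex.slitPlane := by
  rw [Complex.mem_slitPlane_iff]
  by_cases h : z.im = 0
  · left
    have e : z = (z.re : ℂ) := by apply Complex.ext <;> simp [h]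
    have h2 : -‖z‖ / 2 < z.re := hz
    have h1 : ‖z‖ = |z.re| := by rw [e, Complex.norm_real]; simp
    rw [h1] at h2 hz2
    rw [Complex.add_re, Complex.ofReal_re]
    rcases abs_cases z.re with h3 | h3 <;> rcases abs_cases t with h4 | h4 <;> linarith
  · right; simpa using h

/-- Mean value inequality for `r ↦ log (z + r) - r / z`, whose derivative `-r / (z (z + r))` is
bounded by `2 / |z|²` because `|z + r| ≥ |z| / 2`. -/
theorem norm_log_add_sub_le {z : ℂ} (hz : z ∈ sector) (hz2 : 2 ≤ ‖z‖) {t : ℝ} (ht : |t| ≤ 1) :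
    ‖Complex.log (z + t) - Complex.log z - t / z‖ ≤ 2 / ‖z‖ ^ 2 := by
  have hz0 : z ≠ 0 := by rintro rfl; simp at hz2; linarith
  have hpos : 0 < ‖z‖ := norm_pos_iff.2 hz0
  have hd : ∀ r ∈ Set.Icc (-1 : ℝ) 1, HasDerivWithinAt
      (fun r : ℝ => Complex.log (z + r) - r / z) (1 / (z + r) - 1 / z) (Set.Icc (-1) 1) r := by
    intro r hr
    have hs := mem_slitPlane_of_mem_sector hz hz2 (abs_le.2 hr)
    have h1 : HasDerivAt (fun r : ℝ => z + (r : ℂ)) 1 r := by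
      simpa using (Complex.ofRealCLM.hasDerivAt (x := r)).const_add z
    have h2 : HasDerivAt (fun r : ℝ => (r : ℂ) / z) (1 / z) r := by
      simpa using (Complex.ofRealCLM.hasDerivAt (x := r)).div_const z
    exact ((h1.clog_real hs).sub h2).hasDerivWithinAt
  have hb : ∀ r ∈ Set.Icc (-1 : ℝ) 1, ‖1 / (z + r) - 1 / z‖ ≤ 2 / ‖z‖ ^ 2 := by
    intro r hr
    have hr' := abs_le.2 hr
    have hs := Complex.slitPlane_ne_zero (mem_slitPlane_of_mem_sector hz hz2 hr')
    have h3 : ‖z‖ / 2 ≤ ‖z + r‖ := by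
      have := norm_sub_le (z + r) r
      simp at this
      linarith
    rw [div_sub_div _ _ hs hz0, norm_div, norm_mul]
    have h4 : ‖1 * z - (z + r) * 1‖ ≤ 1 := by
      rw [show 1 * z - (z + r) * 1 = -(r : ℂ) by ring, norm_neg, Complex.norm_real]
      simpa using hr'
    rw [div_le_div_iff₀ (by positivity) (by positivity)]
    nlinarith [norm_nonneg (1 * z - (z + r) * 1)]
  have := (convex_Icc (-1 : ℝ) 1).norm_image_sub_le_of_norm_hasDerivWithin_le hd hb
    (x := 0) (y := t) (by simp) (abs_le.1 ht)
  have h0 : (0 : ℝ) ≤ 2 / ‖z‖ ^ 2 := by positivity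
  calc _ = ‖Complex.log (z + t) - t / z - (Complex.log (z + (0 : ℝ)) - (0 : ℝ) / z)‖ := by
        simp; ring_nf
    _ ≤ 2 / ‖z‖ ^ 2 * ‖t - 0‖ := this
    _ ≤ _ := by
      have : ‖t - 0‖ ≤ 1 := by simpa using ht
      nlinarith

/-- The increment `log (z + σ) - log (z - σ) - 2σ (log (z + 1) - log z)`. -/
def logIncr (σ : ℝ) (z : ℂ) : ℂ :=
  Complex.log (z + σ) - Complex.log (z - σ) - 2 * σ * (Complex.log (z + 1) - Complex.log z)

/-- The first-order terms `σ/z`, `σ/z` and `-2σ/z` cancel, leaving second-order remainders weighted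
`1`, `1` and `2σ ≤ 2`. -/
theorem norm_logIncr_le {σ : ℝ} (h0 : 0 ≤ σ) (h1 : σ ≤ 1) {z : ℂ} (hz : z ∈ sector)
    (hz2 : 2 ≤ ‖z‖) : ‖logIncr σ z‖ ≤ 8 / ‖z‖ ^ 2 := by
  have a1 := norm_log_add_sub_le hz hz2 (t := σ) (by rw [abs_le]; constructor <;> linarith)
  have a2 := norm_log_add_sub_le hz hz2 (t := -σ) (by rw [abs_le]; constructor <;> linarith)
  have a3 := norm_log_add_sub_le hz hz2 (t := 1) (by simp)
  push_cast at a2 a3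
  have e : logIncr σ z = (Complex.log (z + σ) - Complex.log z - σ / z)
      - (Complex.log (z + -σ) - Complex.log z - -σ / z)
      - (2 * σ) * (Complex.log (z + 1) - Complex.log z - 1 / z) := by
    unfold logIncr
    rw [← sub_eq_add_neg]
    ring
  have a4 : ‖(2 * σ : ℂ)‖ ≤ 2 := by
    simp [abs_of_nonneg h0]; linarith
  rw [e]
  refine (norm_sub_le _ _).trans ?_
  rw [norm_mul]
  have a5 := norm_sub_le (Complex.log (z + σ) - Complex.log z - σ / z)
    (Complex.log (z + -σ) - Complex.log z - -σ / z)
  have a6 : ‖(2 * σ : ℂ)‖ * ‖Complex.log (z + 1) - Complex.log z - 1 / z‖ ≤ 2 * (2 / ‖z‖ ^ 2) := by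
    gcongr
  have : (8 : ℝ) / ‖z‖ ^ 2 = 2 / ‖z‖ ^ 2 + 2 / ‖z‖ ^ 2 + 2 * (2 / ‖z‖ ^ 2) := by ring
  linarith

/-- The quadratic decay in `|z| + n` is split as `1/2 + 3/2`: the first exponent is kept as decay in
`z`, the second makes the sum over `n` converge. -/
theorem norm_logIncr_add_natCast_le {σ : ℝ} (h0 : 0 ≤ σ) (h1 : σ ≤ 1) {z : ℂ} (hz : z ∈ sector)
    (hz4 : 4 ≤ ‖z‖) (n : ℕ) :
    ‖logIncr σ (z + n)‖ ≤ 32 * ‖z‖ ^ (-(1 / 2) : ℝ) * ((n : ℝ) + 1) ^ (-(3 / 2) : ℝ) := by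
  have hn : (0 : ℝ) ≤ n := Nat.cast_nonneg n
  have b := norm_add_ofReal_lower hz hn
  rw [Complex.ofReal_natCast] at b
  refine (norm_logIncr_le h0 h1 (add_natCast_mem_sector hz n) (by linarith)).trans ?_
  have c1 : ‖z‖ ^ (1 / 2 : ℝ) * ((n : ℝ) + 1) ^ (3 / 2 : ℝ) ≤ (‖z‖ + n) ^ 2 := by
    calc _ ≤ (‖z‖ + n) ^ (1 / 2 : ℝ) * (‖z‖ + n) ^ (3 / 2 : ℝ) := by
          have i1 : ‖z‖ ≤ ‖z‖ + n := by linarith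
          have i2 : (n : ℝ) + 1 ≤ ‖z‖ + n := by linarith
          gcongr
      _ = _ := by
          rw [← Real.rpow_add (by linarith)]
          norm_num
  have c2 : (‖z‖ + n) ^ 2 / 4 ≤ ‖z + n‖ ^ 2 := by
    nlinarith
  have c3 : 0 < ‖z‖ ^ (1 / 2 : ℝ) * ((n : ℝ) + 1) ^ (3 / 2 : ℝ) := by
    have : 0 < ‖z‖ := by linarith
    positivity
  rw [Real.rpow_neg (by linarith), Real.rpow_neg (by linarith), mul_assoc, ← mul_inv,
    ← div_eq_mul_inv, div_le_div_iff₀ (by linarith) c3]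
  linarith

theorem summable_three_halves : Summable fun n : ℕ => ((n : ℝ) + 1) ^ (-(3 / 2) : ℝ) := by
  have := (summable_nat_add_iff 1).2 (Real.summable_nat_rpow.2 (by norm_num : (-(3/2) : ℝ) < -1))
  simpa using this

/-- The constant in the remainder estimate of `gammaRatio_eq_exp`. -/
def remConst : ℝ := 32 * ∑' n : ℕ, ((n : ℝ) + 1) ^ (-(3 / 2) : ℝ)

theorem remConst_nonneg : 0 ≤ remConst := by
  unfold remConst
  have : 0 ≤ ∑' n : ℕ, ((n : ℝ) + 1) ^ (-(3 / 2) : ℝ) := tsum_nonneg fun n => by positivity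
  positivity

/-- The remainder in `gammaRatio_eq_exp`. -/
def logRem (σ : ℝ) (z : ℂ) : ℂ := ∑' n : ℕ, logIncr σ (z + n)

theorem summable_logIncr {σ : ℝ} (h0 : 0 ≤ σ) (h1 : σ ≤ 1) {z : ℂ} (hz : z ∈ sector)
    (hz4 : 4 ≤ ‖z‖) : Summable fun n : ℕ => logIncr σ (z + n) :=
  Summable.of_norm_bounded (summable_three_halves.mul_left (32 * ‖z‖ ^ (-(1 / 2) : ℝ)))
    fun n => norm_logIncr_add_natCast_le h0 h1 hz hz4 n

theorem norm_logRem_le {σ : ℝ} (h0 : 0 ≤ σ) (h1 : σ ≤ 1) {z : ℂ} (hz : z ∈ sector)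
    (hz4 : 4 ≤ ‖z‖) : ‖logRem σ z‖ ≤ remConst * ‖z‖ ^ (-(1 / 2) : ℝ) := by
  have := tsum_of_norm_bounded
    (summable_three_halves.mul_left (32 * ‖z‖ ^ (-(1 / 2) : ℝ))).hasSum
    fun n => norm_logIncr_add_natCast_le h0 h1 hz hz4 n
  rw [tsum_mul_left] at this
  unfold logRem remConst
  linarith

/-- The terms `log (z + j + 1) - log (z + j)` telescope, and the others exponentiate to the factors
of the Gauss product. Working with exponentials avoids any choice of branch. -/
theorem exp_neg_sum_logIncr {σ : ℝ} (h0 : 0 ≤ σ) (h1 : σ ≤ 1) {z : ℂ} (hz : z ∈ sector)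
    (hz4 : 4 ≤ ‖z‖) (n : ℕ) :
    Complex.exp (-∑ j ∈ Finset.range n, logIncr σ (z + j)) =
      Complex.exp (2 * σ * (Complex.log (z + n) - Complex.log z)) *
        ∏ j ∈ Finset.range n, (z - σ + j) / (z + σ + j) := by
  induction n with
  | zero => simp
  | succ n ih =>
    have hn : (0 : ℝ) ≤ n := Nat.cast_nonneg n
    have hm := add_natCast_mem_sector hz n
    have b := norm_add_ofReal_lower hz hn
    rw [Complex.ofReal_natCast] at b
    have m1 := Complex.slitPlane_ne_zero (mem_slitPlane_of_mem_sector hm (by linarith) (t := σ)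
      (by rw [abs_le]; constructor <;> linarith))
    have m2 := Complex.slitPlane_ne_zero (mem_slitPlane_of_mem_sector hm (by linarith) (t := -σ)
      (by rw [abs_le]; constructor <;> linarith))
    have e1 : z + n + (-σ : ℝ) = z - σ + n := by push_cast; ring
    have e2 : z + n + (σ : ℝ) = z + σ + n := by ring
    rw [e1] at m2
    rw [e2] at m1
    rw [Finset.sum_range_succ, neg_add, Complex.exp_add, ih, Finset.prod_range_succ, logIncr,
      e2, show z + n - (σ : ℂ) = z - σ + n by ring]
    have : -(Complex.log (z + σ + n) - Complex.log (z - σ + n) -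
        2 * σ * (Complex.log (z + n + 1) - Complex.log (z + n))) =
        Complex.log (z - σ + n) - Complex.log (z + σ + n)
          + 2 * σ * (Complex.log (z + n + 1) - Complex.log (z + n)) := by ring
    rw [this, Complex.exp_add, Complex.exp_sub, Complex.exp_log m1, Complex.exp_log m2]
    have : Complex.exp (2 * σ * (Complex.log (z + (n + 1 : ℕ)) - Complex.log z)) =
        Complex.exp (2 * σ * (Complex.log (z + n) - Complex.log z)) *
        Complex.exp (2 * σ * (Complex.log (z + n + 1) - Complex.log (z + n))) := by
      rw [← Complex.exp_add]
      push_cast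
      ring_nf
    rw [this]
    ring

/-- Reconciles the power `n^{2σ}` of Gauss's product with the power `(z + n + 1)^{2σ}` left by
telescoping. -/
theorem tendsto_log_add_natCast (z : ℂ) :
    Tendsto (fun n : ℕ => (Real.log n : ℂ) - Complex.log (z + (n + 1 : ℕ))) atTop (𝓝 0) := by
  have h1 : Tendsto (fun n : ℕ => (z + 1) * ((n : ℂ))⁻¹ + 1) atTop (𝓝 1) := by
    have : Tendsto (fun n : ℕ => ((n : ℂ))⁻¹) atTop (𝓝 0) := tendsto_inv_atTop_nhds_zero_nat
    simpa using (this.const_mul (z + 1)).add_const 1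
  have h2 := ((continuousAt_clog (x := 1) (by simp)).tendsto.comp h1).neg
  simp only [Complex.log_one, neg_zero] at h2
  refine h2.congr' ?_
  have h3 : ∀ᶠ n : ℕ in atTop, (z + 1) * ((n : ℂ))⁻¹ + 1 ≠ 0 :=
    h1.eventually_ne one_ne_zero
  filter_upwards [h3, eventually_gt_atTop 0] with n hn hn0
  have hn1 : (n : ℂ) ≠ 0 := by exact_mod_cast hn0.ne'
  have e : z + (n + 1 : ℕ) = ((n : ℝ) : ℂ) * ((z + 1) * ((n : ℂ))⁻¹ + 1) := by
    push_cast
    field_simp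
    ring
  rw [e, Complex.log_ofReal_mul (by exact_mod_cast hn0) hn]
  simp

/-- Both sides are limits of the same partial products; with `norm_logRem_le` this replaces
Stirling's formula. -/
theorem gammaRatio_eq_exp {σ : ℝ} (h0 : 0 ≤ σ) (h1 : σ ≤ 1) {z : ℂ} (hz : z ∈ sector)
    (hz4 : 4 ≤ ‖z‖) :
    gammaRatio σ z = Complex.exp (2 * σ * Complex.log z - logRem σ z) := by
  have hs : z - σ ∈ Complex.slitPlane := by
    have := mem_slitPlane_of_mem_sector hz (by linarith) (t := -σ)
      (by rw [abs_le]; constructor <;> linarith)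
    simpa [sub_eq_add_neg] using this
  refine tendsto_nhds_unique (gammaRatioSeq_tendsto hs) ?_
  -- The shift by one matches the `n + 1` factors in `gammaRatioSeq`.
  have t1 := ((summable_logIncr h0 h1 hz hz4).hasSum.tendsto_sum_nat).comp (tendsto_add_atTop_nat 1)
  have t2 := (((tendsto_log_add_natCast z).const_mul (2 * σ : ℂ)).add
    (t1.const_sub (2 * σ * Complex.log z))).cexp
  simp only [mul_zero, zero_add] at t2
  refine t2.congr fun n => ?_
  simp only [Function.comp]
  rw [sub_eq_add_neg (2 * σ * Complex.log z), ← add_assoc, Complex.exp_add,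
    exp_neg_sum_logIncr h0 h1 hz hz4, ← mul_assoc, ← Complex.exp_add, gammaRatioSeq]
  congr 2
  ring

/-! ### Cauchy estimates for derivatives and differences -/

/-- A unit difference is bounded by the derivative along a unit segment, hence by `M / r` through
Cauchy's estimate. Each difference uses up `1 + r` of the radius: `1` for the segment and `r` for
the Cauchy circle. -/
theorem norm_fwdDiff_iterate_le {r r' : ℝ} (hr : 0 < r) (c : ℂ) (k : ℕ) :
    ∀ {g : ℂ → ℂ} {M : ℝ}, DifferentiableOn ℂ g (Metric.ball c (k * (1 + r) + r')) → 0 < r' →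
      (∀ y ∈ Metric.ball c (k * (1 + r) + r'), ‖g y‖ ≤ M) →
      ‖(fwdDiff 1)^[k] g c‖ ≤ M / r ^ k := by
  induction k with
  | zero =>
    intro g M _ hr' hb
    simpa using hb c (by simpa using hr')
  | succ k ih =>
    intro g M hg hr' hb
    rw [Function.iterate_succ_apply, pow_succ', ← div_div]
    push_cast at hg hb
    have hsub : ∀ y ∈ Metric.ball c (k * (1 + r) + r'), ∀ t ∈ Set.Icc (0 : ℝ) 1,
        Metric.closedBall (y + t) r ⊆ Metric.ball c ((k + 1) * (1 + r) + r') := by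
      intro y hy t ht w hw
      rw [Metric.mem_ball, dist_eq_norm] at hy ⊢
      rw [Metric.mem_closedBall, dist_eq_norm] at hw
      have h1 : ‖w - c‖ ≤ ‖w - (y + t)‖ + ‖y - c‖ + ‖(t : ℂ)‖ := by
        calc ‖w - c‖ = ‖(w - (y + t)) + (y - c) + t‖ := by ring_nf
          _ ≤ _ := norm_add₃_le
      have h2 : ‖(t : ℂ)‖ ≤ 1 := by
        rw [Complex.norm_real, Real.norm_of_nonneg ht.1]; exact ht.2
      linarith
    have hsub0 : ∀ y ∈ Metric.ball c (k * (1 + r) + r'), ∀ t ∈ Set.Icc (0 : ℝ) 1,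
        y + t ∈ Metric.ball c ((k + 1) * (1 + r) + r') := fun y hy t ht =>
      hsub y hy t ht (Metric.mem_closedBall_self hr.le)
    refine ih (g := fwdDiff 1 g) ?_ hr' ?_
    · intro y hy
      have h0 := hsub0 y hy 0 (by simp)
      have h1 := hsub0 y hy 1 (by simp)
      simp only [Complex.ofReal_zero, add_zero, Complex.ofReal_one] at h0 h1
      have d0 := hg.differentiableAt (Metric.isOpen_ball.mem_nhds h0)
      have d1 := hg.differentiableAt (Metric.isOpen_ball.mem_nhds h1)
      have d2 : DifferentiableAt ℂ (fun y => g (y + 1)) y :=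
        DifferentiableAt.comp (f := fun y => y + 1) y d1 (by fun_prop)
      exact (d2.sub d0).differentiableWithinAt
    · intro y hy
      have hder : ∀ t ∈ Set.Icc (0 : ℝ) 1, HasDerivWithinAt (fun t : ℝ => g (y + t))
          (deriv g (y + t)) (Set.Icc 0 1) t := by
        intro t ht
        have d := (hg.differentiableAt (Metric.isOpen_ball.mem_nhds (hsub0 y hy t ht))).hasDerivAt
        have e : HasDerivAt (fun z : ℂ => g (y + z)) (deriv g (y + t)) t := by
          simpa using d.comp_const_add y (t : ℂ)
        exact e.comp_ofReal.hasDerivWithinAt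
      have hbd : ∀ t ∈ Set.Icc (0 : ℝ) 1, ‖deriv g (y + t)‖ ≤ M / r := by
        intro t ht
        refine Complex.norm_deriv_le_of_forall_mem_sphere_norm_le hr ?_ fun z hz =>
          hb z (hsub y hy t ht (Metric.sphere_subset_closedBall hz))
        refine (hg.mono ?_).diffContOnCl
        exact Metric.closure_ball_subset_closedBall.trans (hsub y hy t ht)
      have := (convex_Icc (0 : ℝ) 1).norm_image_sub_le_of_norm_hasDerivWithin_le hder hbd
        (x := 0) (y := 1) (by simp) (by simp)
      simpa [fwdDiff] using this

/-- Differentiating the real part of `h` along the axis shows that the derivatives of `g` exist;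
uniqueness of derivatives then shows that those of `h` stay real. -/
theorem ofReal_iteratedDeriv {h : ℂ → ℂ} {U : Set ℂ} (hU : IsOpen U)
    (hh : DifferentiableOn ℂ h U) {g : ℝ → ℝ} (hg : ∀ η : ℝ, (η : ℂ) ∈ U → h η = g η) (j : ℕ) :
    ∀ η : ℝ, (η : ℂ) ∈ U → iteratedDeriv j h η = (iteratedDeriv j g η : ℝ) := by
  induction j with
  | zero => simpa using hg
  | succ j ih =>
    intro η hη
    have hd : DifferentiableAt ℂ (iteratedDeriv j h) η := by
      have ha : AnalyticOnNhd ℂ h U := hh.analyticOnNhd hU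
      rw [iteratedDeriv_eq_iterate]
      exact (ha.iterated_deriv j η hη).differentiableAt
    have hev : ∀ᶠ η' : ℝ in 𝓝 η, (η' : ℂ) ∈ U :=
      Complex.continuous_ofReal.continuousAt.preimage_mem_nhds (hU.mem_nhds hη)
    have h1 : HasDerivAt (fun x : ℝ => (iteratedDeriv j h x).re)
        (deriv (iteratedDeriv j h) η).re η := hd.hasDerivAt.real_of_complex
    have h2 : HasDerivAt (iteratedDeriv j g) (deriv (iteratedDeriv j h) η).re η := by
      refine h1.congr_of_eventuallyEq ?_
      filter_upwards [hev] with x hx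
      rw [ih x hx, Complex.ofReal_re]
    have h3 : HasDerivAt (fun x : ℝ => iteratedDeriv j h x)
        (deriv (iteratedDeriv j h) η) η := hd.hasDerivAt.comp_ofReal
    have h4 : HasDerivAt (fun x : ℝ => iteratedDeriv j h x)
        (((deriv (iteratedDeriv j h) η).re : ℝ) : ℂ) η := by
      refine h2.ofReal_comp.congr_of_eventuallyEq ?_
      filter_upwards [hev] with x hx
      rw [ih x hx]
    rw [iteratedDeriv_succ, iteratedDeriv_succ, h2.deriv]
    exact h3.unique h4

theorem contDiff_re_of_differentiableOn {h : ℂ → ℂ} {U : Set ℂ} (hU : IsOpen U)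
    (hh : DifferentiableOn ℂ h U) (hr : ∀ η : ℝ, (η : ℂ) ∈ U) :
    ContDiff ℝ ((⊤ : ℕ∞) : WithTop ℕ∞) fun η : ℝ => (h η).re := by
  rw [contDiff_iff_contDiffAt]
  intro η
  have h1 : ContDiffAt ℂ ((⊤ : ℕ∞) : WithTop ℕ∞) h η :=
    (hh.analyticAt (hU.mem_nhds (hr η))).contDiffAt
  exact (Complex.reCLM.contDiff.contDiffAt).comp η
    ((h1.restrict_scalars ℝ).comp η Complex.ofRealCLM.contDiff.contDiffAt)

theorem fwdDiff_iterate_ofReal {F : ℂ → ℂ} {b : ℕ → ℝ} {l k : ℕ}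
    (h : ∀ i ≤ k, F (l + i : ℕ) = b (l + i)) :
    (fwdDiff 1)^[k] F l = ((fwdDiff 1)^[k] b l : ℝ) := by
  rw [fwdDiff_iter_eq_sum_shift, fwdDiff_iter_eq_sum_shift]
  push_cast
  refine Finset.sum_congr rfl fun i hi => ?_
  have := h i (by simpa [Nat.lt_succ_iff] using hi)
  push_cast at this
  simp [this]

/-- Symbol estimate from a holomorphic extension to a polydisc. -/
theorem abs_iteratedDeriv_fwdDiff_le {f : ℂ → ℂ → ℂ} {a : ℝ → ℕ → ℝ} {ξ R M : ℝ} {l : ℕ} {j k : ℕ}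
    (hR : 0 < R) (hk : (k : ℝ) ≤ R / 4)
    (hx : ∀ y ∈ Metric.ball (l : ℂ) R, DifferentiableOn ℂ (fun x => f x y) (Metric.ball (ξ : ℂ) R))
    (hy : ∀ x ∈ Metric.ball (ξ : ℂ) R, DifferentiableOn ℂ (f x) (Metric.ball (l : ℂ) R))
    (hb : ∀ x ∈ Metric.ball (ξ : ℂ) R, ∀ y ∈ Metric.ball (l : ℂ) R, ‖f x y‖ ≤ M)
    (ha : ∀ η : ℝ, (η : ℂ) ∈ Metric.ball (ξ : ℂ) R → ∀ n : ℕ, (n : ℂ) ∈ Metric.ball (l : ℂ) R →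
      f η n = a η n) :
    |iteratedDeriv j (fun η => (fwdDiff 1)^[k] (a η) l) ξ| ≤
      j.factorial * (M / (R / (4 * (k + 1))) ^ k) / (R / 2) ^ j := by
  have hball : ∀ i ≤ k, ((l + i : ℕ) : ℂ) ∈ Metric.ball (l : ℂ) R := by
    intro i hi
    have hi' : (i : ℝ) ≤ k := by exact_mod_cast hi
    rw [Metric.mem_ball, dist_eq_norm]
    push_cast
    rw [add_sub_cancel_left, Complex.norm_natCast]
    linarith
  set h : ℂ → ℂ := fun x => (fwdDiff 1)^[k] (f x) l with hh
  have hd : DifferentiableOn ℂ h (Metric.ball (ξ : ℂ) R) := by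
    have : h = fun x => ∑ i ∈ Finset.range (k + 1),
        ((-1 : ℤ) ^ (k - i) * k.choose i) • f x (l + i • 1) := by
      funext x; exact fwdDiff_iter_eq_sum_shift ..
    rw [this]
    refine DifferentiableOn.fun_sum fun i hi => ?_
    have := hx _ (hball i (by simpa [Nat.lt_succ_iff] using hi))
    push_cast at this
    simp only [nsmul_eq_mul, mul_one, zsmul_eq_mul]
    exact this.const_mul _
  have hreal := ofReal_iteratedDeriv Metric.isOpen_ball hd (g := fun η => (fwdDiff 1)^[k] (a η) l)
    (fun η hη => fwdDiff_iterate_ofReal fun i hi => ha η hη _ (hball i hi)) j ξ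
    (Metric.mem_ball_self hR)
  rw [← Real.norm_eq_abs, ← Complex.norm_real, ← hreal]
  have hr : 0 < R / (4 * (k + 1)) := by positivity
  -- The unit shifts cost `k ≤ R / 4` and the `k + 1` small radii add up to `R / 4`.
  have hrad : k * (1 + R / (4 * (k + 1))) + R / (4 * (k + 1)) ≤ R := by
    have : (k + 1) * (R / (4 * (k + 1))) = R / 4 := by field_simp
    linarith
  have hsub : Metric.ball (l : ℂ) (k * (1 + R / (4 * (k + 1))) + R / (4 * (k + 1))) ⊆
    Metric.ball (l : ℂ) R := Metric.ball_subset_ball hrad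
  have hR2 : Metric.closedBall (ξ : ℂ) (R / 2) ⊆ Metric.ball (ξ : ℂ) R :=
    Metric.closedBall_subset_ball (by linarith)
  refine Complex.norm_iteratedDeriv_le_of_forall_mem_sphere_norm_le j (half_pos hR) ?_ ?_
  · exact (hd.mono (Metric.closure_ball_subset_closedBall.trans hR2)).diffContOnCl
  · intro z hz
    have hz' := hR2 (Metric.sphere_subset_closedBall hz)
    exact norm_fwdDiff_iterate_le hr l k ((hy z hz').mono hsub) hr
      fun y hy' => hb z hz' y (hsub hy')

/-! ### The complexified symbol -/

theorem norm_gammaRatio_eq {σ : ℝ} (h0 : 0 ≤ σ) (h1 : σ ≤ 1) {z : ℂ} (hz : z ∈ sector)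
    (hz4 : 4 ≤ ‖z‖) :
    ‖gammaRatio σ z‖ = ‖z‖ ^ (2 * σ) * Real.exp (-(logRem σ z).re) := by
  rw [gammaRatio_eq_exp h0 h1 hz hz4, Complex.norm_exp, sub_eq_add_neg, Complex.add_re,
    Real.exp_add, Real.rpow_def_of_pos (by linarith)]
  have : ((2 : ℂ) * σ * Complex.log z).re = Real.log ‖z‖ * (2 * σ) := by
    rw [show (2 : ℂ) * σ = ((2 * σ : ℝ) : ℂ) by push_cast; ring, Complex.re_ofReal_mul,
      Complex.log_re]
    ring
  rw [this, Complex.neg_re]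

/-- This is why the sector is wider than a half plane: a relative perturbation by a quarter may
leave the half plane, but not the sector. -/
theorem mem_sector_of_near {ε : ℝ} (hε : ε ≤ 1 / 4) {z₀ z : ℂ} (h0 : 0 < z₀.re)
    (hz : ‖z - z₀‖ ≤ ε * ‖z₀‖) : z ∈ sector ∧ 3 / 4 * ‖z₀‖ ≤ ‖z‖ := by
  have hp : 0 < ‖z₀‖ := norm_pos_iff.2 (ne_zero_of_re_pos h0)
  have h1 : ‖z - z₀‖ ≤ ‖z₀‖ / 4 := by nlinarith
  have h2 : ‖z₀‖ ≤ ‖z‖ + ‖z - z₀‖ := by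
    have := norm_sub_le z (z - z₀)
    rwa [sub_sub_cancel] at this
  have h3 : -‖z - z₀‖ ≤ (z - z₀).re := by
    have := Complex.abs_re_le_norm (z - z₀)
    linarith [neg_abs_le (z - z₀).re]
  rw [Complex.sub_re] at h3
  refine ⟨?_, by linarith⟩
  change -‖z‖ / 2 < z.re
  linarith

theorem norm_log_sub_log_le {ε : ℝ} (h0' : 0 ≤ ε) (hε : ε ≤ 1 / 4) {z₀ z : ℂ} (h0 : 0 < z₀.re)
    (hz0 : 8 ≤ ‖z₀‖) (hz : ‖z - z₀‖ ≤ ε * ‖z₀‖) : ‖Complex.log z - Complex.log z₀‖ ≤ 2 * ε := by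
  have hp : 0 < ‖z₀‖ := by linarith
  have hm : ∀ w ∈ Metric.closedBall z₀ (ε * ‖z₀‖), w ∈ Complex.slitPlane ∧ 3 / 4 * ‖z₀‖ ≤ ‖w‖ := by
    intro w hw
    rw [Metric.mem_closedBall, dist_eq_norm] at hw
    obtain ⟨h1, h2⟩ := mem_sector_of_near hε h0 hw
    refine ⟨?_, h2⟩
    simpa using mem_slitPlane_of_mem_sector h1 (by linarith) (t := 0) (by simp)
  have := (convex_closedBall z₀ (ε * ‖z₀‖)).norm_image_sub_le_of_norm_hasDerivWithin_le
    (f := Complex.log) (f' := fun w => w⁻¹) (C := 4 / 3 * ‖z₀‖⁻¹) (x := z₀) (y := z)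
    (fun w hw => (Complex.hasDerivAt_log (hm w hw).1).hasDerivWithinAt)
    (fun w hw => by
      have := (hm w hw).2
      rw [norm_inv, show 4 / 3 * ‖z₀‖⁻¹ = (3 / 4 * ‖z₀‖)⁻¹ by field_simp]
      gcongr)
    (Metric.mem_closedBall_self (by positivity)) (by rwa [Metric.mem_closedBall, dist_eq_norm])
  calc _ ≤ 4 / 3 * ‖z₀‖⁻¹ * ‖z - z₀‖ := this
    _ ≤ 4 / 3 * ‖z₀‖⁻¹ * (ε * ‖z₀‖) := by gcongr
    _ = 4 / 3 * ε := by field_simp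
    _ ≤ 2 * ε := by linarith

/-- By `gammaRatio_eq_exp` the exponent changes by `2σ` times a difference of logarithms, at most
`4ε ≤ η/2`, plus two remainders, each at most `η/4` once the modulus is large. -/
theorem exists_gammaRatio_perturb {σ : ℝ} (h0 : 0 ≤ σ) (h1 : σ ≤ 1) {η : ℝ} (hη : 0 < η) :
    ∃ ε > 0, ∃ M ≥ 8, ε ≤ 1 / 4 ∧ ∀ z₀ z : ℂ, 0 < z₀.re → M ≤ ‖z₀‖ → ‖z - z₀‖ ≤ ε * ‖z₀‖ →
      ∃ u : ℂ, ‖u‖ ≤ η ∧ gammaRatio σ z = gammaRatio σ z₀ * Complex.exp u := by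
  have ht : Tendsto (fun r : ℝ => remConst * (r / 2) ^ (-(1 / 2) : ℝ)) atTop (𝓝 0) := by
    have : Tendsto (fun r : ℝ => (r / 2) ^ (-(1 / 2) : ℝ)) atTop (𝓝 0) :=
      (tendsto_rpow_neg_atTop (by norm_num)).comp (tendsto_id.atTop_div_const (by norm_num))
    simpa using this.const_mul remConst
  obtain ⟨M, hM⟩ := ((ht.eventually (gt_mem_nhds (show (0 : ℝ) < η / 4 by positivity))).and
    (eventually_ge_atTop 8)).exists
  refine ⟨min (1 / 4) (η / 8), by positivity, M, hM.2, min_le_left _ _, ?_⟩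
  intro z₀ z hre hz0 hz
  set ε := min (1 / 4) (η / 8)
  have hε : ε ≤ 1 / 4 := min_le_left _ _
  have hε' : ε ≤ η / 8 := min_le_right _ _
  have hε0 : 0 < ε := by positivity
  obtain ⟨hs, hn⟩ := mem_sector_of_near hε hre hz
  have hs0 : z₀ ∈ sector := by
    change -‖z₀‖ / 2 < z₀.re
    linarith [norm_nonneg z₀]
  have h8 := hM.2
  have hrem : ∀ w ∈ sector, M / 2 ≤ ‖w‖ → ‖logRem σ w‖ ≤ η / 4 := by
    intro w hw hwM
    refine (norm_logRem_le h0 h1 hw (by linarith)).trans (le_trans ?_ hM.1.le)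
    refine mul_le_mul_of_nonneg_left ?_ remConst_nonneg
    exact Real.rpow_le_rpow_of_nonpos (by linarith) hwM (by norm_num)
  refine ⟨2 * σ * (Complex.log z - Complex.log z₀) - (logRem σ z - logRem σ z₀), ?_, ?_⟩
  · have l1 := norm_log_sub_log_le hε0.le hε hre (by linarith) hz
    have l2 := hrem z hs (by linarith)
    have l3 := hrem z₀ hs0 (by linarith)
    have l4 : ‖(2 * σ : ℂ)‖ ≤ 2 := by
      simp [abs_of_nonneg h0]; linarith
    have l5 : ‖2 * σ * (Complex.log z - Complex.log z₀)‖ ≤ 2 * (2 * ε) := by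
      rw [norm_mul]; gcongr
    have l6 := norm_sub_le (2 * σ * (Complex.log z - Complex.log z₀)) (logRem σ z - logRem σ z₀)
    have l7 := norm_sub_le (logRem σ z) (logRem σ z₀)
    linarith
  · rw [gammaRatio_eq_exp h0 h1 hs (by linarith), gammaRatio_eq_exp h0 h1 hs0 (by linarith),
      ← Complex.exp_add]
    congr 1
    ring

/-- The argument of the Gamma functions, for complex `ξ = x` and `ℓ = y`. -/
def gammaArg (N : ℕ) (x y : ℂ) : ℂ := ((N : ℂ) / 2 + y + Complex.I * x) / 2

/-- The symbol `P_s` for complex `ξ = x` and `ℓ = y`. -/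
def cSymbol (N : ℕ) (s : ℝ) (x y : ℂ) : ℂ :=
  ((2 : ℝ) ^ (2 * s) : ℝ) * (gammaRatio (s / 2) (gammaArg N x y) *
    gammaRatio (s / 2) (gammaArg N (-x) y)) - hardyConst N s

/-- The denominator `ξ² + μ_ℓ` for complex `ξ = x` and `ℓ = y`. -/
def cDenom (N : ℕ) (x y : ℂ) : ℂ := x ^ 2 + y * (y + N - 2)

/-- Conjugation at real points is `ξ ↦ -ξ`, so the squared modulus in `P_s` is a product of the
values at `ξ` and `-ξ`. That product, unlike the modulus, continues holomorphically. -/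
theorem gammaArg_conj (N : ℕ) (ξ l : ℝ) :
    gammaArg N (-ξ) l = starRingEnd ℂ (gammaArg N ξ l) := by
  simp [gammaArg, map_ofNat]

theorem hardySymbol_eq (N : ℕ) (s ξ : ℝ) (l : ℕ) :
    hardySymbol N s ξ l =
      2 ^ (2 * s) * ‖gammaRatio (s / 2) (gammaArg N ξ l)‖ ^ 2 - hardyConst N s := by
  unfold hardySymbol gammaRatio gammaArg
  congr 6 <;> · push_cast; ring_nf

theorem hardyConst_eq (N : ℕ) (s : ℝ) :
    hardyConst N s = 2 ^ (2 * s) * ‖gammaRatio (s / 2) (((N : ℝ) / 4 : ℝ) : ℂ)‖ ^ 2 := by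
  unfold hardyConst gammaRatio
  rw [← Complex.ofReal_add, ← Complex.ofReal_sub, Complex.Gamma_ofReal, Complex.Gamma_ofReal,
    ← Complex.ofReal_div, Complex.norm_real, Real.norm_eq_abs, sq_abs, div_pow]
  congr 5 <;> ring_nf

theorem cSymbol_ofReal (N : ℕ) (s ξ : ℝ) (l : ℕ) :
    cSymbol N s ξ l = hardySymbol N s ξ l := by
  have h := gammaArg_conj N ξ l
  push_cast at h
  rw [cSymbol, h, gammaRatio_conj, Complex.mul_conj, hardySymbol_eq, Complex.normSq_eq_norm_sq]
  push_cast
  ring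

theorem cDenom_ofReal (N : ℕ) (ξ : ℝ) (l : ℕ) :
    cDenom N ξ l = (ξ ^ 2 + eigval N l : ℝ) := by
  simp [cDenom, eigval]

theorem hardyConst_nonneg (N : ℕ) (s : ℝ) : 0 ≤ hardyConst N s := by
  rw [hardyConst_eq]; positivity

/-- Basic geometry of `gammaArg`. -/
theorem gammaArg_bounds {N : ℕ} (hN : 3 ≤ N) (ξ : ℝ) (l : ℕ) :
    3 / 4 ≤ (gammaArg N ξ l).re ∧ (1 + |ξ| + l) / 4 ≤ ‖gammaArg N ξ l‖ ∧
      ‖gammaArg N ξ l‖ ≤ N * (1 + |ξ| + l) := by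
  have hN' : (3 : ℝ) ≤ N := by exact_mod_cast hN
  have hl : (0 : ℝ) ≤ l := Nat.cast_nonneg l
  have e : gammaArg N ξ l = (((N / 2 + l) / 2 : ℝ) : ℂ) + ((ξ / 2 : ℝ) : ℂ) * Complex.I := by
    simp [gammaArg]; ring
  have re : (gammaArg N ξ l).re = (N / 2 + l) / 2 := by rw [e]; simp
  have im : (gammaArg N ξ l).im = ξ / 2 := by rw [e]; simp
  have h1 := Complex.abs_re_le_norm (gammaArg N ξ l)
  have h2 := Complex.abs_im_le_norm (gammaArg N ξ l)
  have h3 := Complex.norm_le_abs_re_add_abs_im (gammaArg N ξ l)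
  rw [re, abs_of_nonneg (by positivity)] at h1 h3
  rw [im, abs_div, abs_two] at h2 h3
  have h4 := abs_nonneg ξ
  refine ⟨by rw [re]; linarith, by linarith, h3.trans ?_⟩
  nlinarith

theorem gammaArg_sub (N : ℕ) (x y x' y' : ℂ) :
    gammaArg N x y - gammaArg N x' y' = ((y - y') + Complex.I * (x - x')) / 2 := by
  unfold gammaArg; ring

theorem norm_gammaArg_sub_lt {N : ℕ} {x y x' y' : ℂ} {R : ℝ} (hx : ‖x - x'‖ < R)
    (hy : ‖y - y'‖ < R) : ‖gammaArg N x y - gammaArg N x' y'‖ < R := by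
  rw [gammaArg_sub, norm_div]
  have := norm_add_le (y - y') (Complex.I * (x - x'))
  rw [norm_mul, Complex.norm_I, one_mul] at this
  rw [Complex.norm_ofNat]
  linarith

theorem norm_cDenom_sub_le {N : ℕ} {ξ c : ℝ} {l : ℕ} (hc0 : 0 ≤ c) (hc : c ≤ 1) {x y : ℂ}
    (hx : ‖x - ξ‖ < c * (1 + |ξ| + l)) (hy : ‖y - l‖ < c * (1 + |ξ| + l)) :
    ‖cDenom N x y - cDenom N ξ l‖ ≤ (8 + N) * c * (1 + |ξ| + l) ^ 2 := by
  set ρ := 1 + |ξ| + l with hρ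
  have hl : (0 : ℝ) ≤ l := Nat.cast_nonneg l
  have hN : (0 : ℝ) ≤ N := Nat.cast_nonneg N
  have hξ := abs_nonneg ξ
  have hρ1 : 1 ≤ ρ := by linarith
  have e : cDenom N x y - cDenom N ξ l =
      (x - ξ) * (2 * ξ + (x - ξ)) + (y - l) * (2 * l + (y - l) + N - 2) := by
    unfold cDenom; ring
  have b1 : ‖2 * (ξ : ℂ) + (x - ξ)‖ ≤ 3 * ρ := by
    refine (norm_add_le _ _).trans ?_
    rw [norm_mul, Complex.norm_real, Complex.norm_ofNat, Real.norm_eq_abs]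
    nlinarith
  have b2 : ‖2 * (l : ℂ) + (y - l) + N - 2‖ ≤ (5 + N) * ρ := by
    refine (norm_sub_le _ _).trans ?_
    have := norm_add₃_le (a := 2 * (l : ℂ)) (b := y - l) (c := (N : ℂ))
    rw [norm_mul, Complex.norm_natCast, Complex.norm_natCast, Complex.norm_ofNat] at this
    rw [Complex.norm_ofNat]
    nlinarith
  rw [e]
  refine (norm_add_le _ _).trans ?_
  rw [norm_mul, norm_mul]
  have c1 : ‖x - ξ‖ * ‖2 * (ξ : ℂ) + (x - ξ)‖ ≤ c * ρ * (3 * ρ) := by gcongr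
  have c2 : ‖y - l‖ * ‖2 * (l : ℂ) + (y - l) + N - 2‖ ≤ c * ρ * ((5 + N) * ρ) := by gcongr
  nlinarith

/-- Since `μ_ℓ ≥ ℓ²` and `|ξ| + ℓ ≥ 1`, one has `ρ² ≤ 4 (|ξ| + ℓ)² ≤ 8 (ξ² + ℓ²)` with `ρ = 1 + |ξ|
+ ℓ`. -/
theorem denom_lower {N : ℕ} (hN : 2 ≤ N) (ξ : ℝ) (l : ℕ) (h : 2 ≤ 1 + |ξ| + l) :
    (1 + |ξ| + l) ^ 2 / 8 ≤ ξ ^ 2 + eigval N l := by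
  have hN' : (2 : ℝ) ≤ N := by exact_mod_cast hN
  have hl : (0 : ℝ) ≤ l := Nat.cast_nonneg l
  unfold eigval
  have hξ := abs_nonneg ξ
  rw [← sq_abs ξ]
  nlinarith [sq_nonneg (|ξ| - l), mul_nonneg hl (by linarith : (0 : ℝ) ≤ N - 2)]

theorem mem_slitPlane_of_norm_sub_one_lt {z : ℂ} (h : ‖z - 1‖ < 1) : z ∈ Complex.slitPlane := by
  have := Complex.mem_slitPlane_of_norm_lt_one h
  simpa using this

theorem norm_cpow_half_le {z : ℂ} (h : ‖z - 1‖ ≤ 1) : ‖z ^ (1 / 2 : ℂ)‖ ≤ 2 := by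
  have h1 : (z ^ (1 / 2 : ℂ)) ^ 2 = z := by
    simp
  have h2 : ‖z‖ ≤ 2 := by
    have := norm_add_le (z - 1) 1
    simp at this
    linarith
  have h3 : ‖z ^ (1 / 2 : ℂ)‖ ^ 2 ≤ 2 := by rw [← norm_pow, h1]; exact h2
  nlinarith [norm_nonneg (z ^ (1 / 2 : ℂ))]

set_option maxHeartbeats 1600000 in
/-- Existence of a holomorphic extension of `m̄` to a polydisc around each point at which
`|ξ| + ℓ` is large. -/
theorem exists_holomorphic_extension {N : ℕ} (hN : 3 ≤ N) {s : ℝ} (hs0 : 0 < s) (hs1 : s < 1) :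
    ∃ c > 0, ∃ ρ₀ : ℝ, ∃ K : ℝ, ∀ (ξ : ℝ) (l : ℕ), ρ₀ ≤ 1 + |ξ| + l → ∃ f : ℂ → ℂ → ℂ,
      (∀ y ∈ Metric.ball (l : ℂ) (c * (1 + |ξ| + l)),
        DifferentiableOn ℂ (fun x => f x y) (Metric.ball (ξ : ℂ) (c * (1 + |ξ| + l)))) ∧
      (∀ x ∈ Metric.ball (ξ : ℂ) (c * (1 + |ξ| + l)),
        DifferentiableOn ℂ (f x) (Metric.ball (l : ℂ) (c * (1 + |ξ| + l)))) ∧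
      (∀ x ∈ Metric.ball (ξ : ℂ) (c * (1 + |ξ| + l)),
        ∀ y ∈ Metric.ball (l : ℂ) (c * (1 + |ξ| + l)), ‖f x y‖ ≤ K * (1 + |ξ| + l) ^ (s - 1)) ∧
      ∀ η : ℝ, (η : ℂ) ∈ Metric.ball (ξ : ℂ) (c * (1 + |ξ| + l)) → ∀ n : ℕ,
        (n : ℂ) ∈ Metric.ball (l : ℂ) (c * (1 + |ξ| + l)) →
        (η, n) ≠ (0, 0) ∧ f η n = mbar N s η n := by
  have hN' : (3 : ℝ) ≤ N := by exact_mod_cast hN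
  have hσ0 : 0 ≤ s / 2 := by linarith
  have hσ1 : s / 2 ≤ 1 := by linarith
  -- Two perturbations of size `1/64` give `|e^{u+v} - 1| ≤ 1/16`, hence relative error `1/8` in the
  -- numerator after the factor `G / A₀ ≤ 2`.
  obtain ⟨ε, hε, M, hM, hε4, hpert⟩ := exists_gammaRatio_perturb hσ0 hσ1
    (show (0 : ℝ) < 1 / 64 by norm_num)
  set σ := s / 2 with hσ
  set p : ℝ := 2 ^ (2 * s) with hp
  have hp0 : 0 < p := by positivity
  set C := hardyConst N s with hC
  have hCn : 0 ≤ C := hardyConst_nonneg N s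
  -- lower and upper bounds of the Gamma quotient
  have hup : ∀ z ∈ sector, 4 ≤ ‖z‖ → ‖z‖ ^ (2 * σ) * Real.exp (-remConst) ≤ ‖gammaRatio σ z‖ ∧
      ‖gammaRatio σ z‖ ≤ ‖z‖ ^ (2 * σ) * Real.exp remConst := by
    intro z hz hz4
    have h1 := norm_logRem_le hσ0 hσ1 hz hz4
    have h2 : ‖logRem σ z‖ ≤ remConst := by
      refine h1.trans ?_
      have : ‖z‖ ^ (-(1 / 2) : ℝ) ≤ 1 :=
        Real.rpow_le_one_of_one_le_of_nonpos (by linarith) (by norm_num)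
      nlinarith [remConst_nonneg]
    have h3 := abs_le.1 ((Complex.abs_re_le_norm (logRem σ z)).trans h2)
    rw [norm_gammaRatio_eq hσ0 hσ1 hz hz4]
    constructor <;> gcongr <;> linarith
  have hlim : Tendsto (fun r : ℝ => p * ((r / 4) ^ (2 * σ) * Real.exp (-remConst)) ^ 2)
      atTop atTop := by
    refine Tendsto.const_mul_atTop hp0 ((tendsto_pow_atTop two_ne_zero).comp ?_)
    refine Tendsto.atTop_mul_const (Real.exp_pos _) ?_
    exact (tendsto_rpow_atTop (by positivity)).comp (tendsto_id.atTop_div_const (by norm_num))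
  -- Beyond this threshold the Gamma term is at least twice the Hardy constant, so subtracting the
  -- constant at most halves it.
  obtain ⟨ρ₀, hρ₀⟩ := (hlim.eventually_ge_atTop (2 * C + 1)).exists_forall_of_atTop
  -- The first bound keeps the Gamma arguments within `ε |z₀|`, as `|z₀| ≥ ρ / 4`; the second makes
  -- the denominator vary by at most `ρ² / 64 ≤ D₀ / 8`.
  set c : ℝ := min (ε / 4) (1 / (64 * (8 + N))) with hc
  have hc0 : 0 < c := by positivity
  have hcε : c ≤ ε / 4 := min_le_left _ _
  have hcN : c ≤ 1 / (64 * (8 + N)) := min_le_right _ _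
  have hcN' : (8 + N) * c ≤ 1 / 64 := by
    have : (8 + N) * (1 / (64 * (8 + N)) : ℝ) = 1 / 64 := by field_simp
    nlinarith
  refine ⟨c, hc0, max (4 * M) (max ρ₀ 32),
    2 * Real.sqrt (8 * (p * ((N : ℝ) ^ (2 * σ) * Real.exp remConst) ^ 2)), ?_⟩
  intro ξ l hρ
  set ρ := 1 + |ξ| + l with hρdef
  have hl : (0 : ℝ) ≤ l := Nat.cast_nonneg l
  have hξ := abs_nonneg ξ
  have hρM : 4 * M ≤ ρ := (le_max_left _ _).trans hρ
  have hρρ : ρ₀ ≤ ρ := (le_max_left _ _).trans ((le_max_right _ _).trans hρ)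
  have hρ32 : 32 ≤ ρ := (le_max_right _ _).trans ((le_max_right _ _).trans hρ)
  obtain ⟨g1, g2, g3⟩ := gammaArg_bounds hN ξ l
  set z₀ := gammaArg N ξ l with hz₀
  rw [← hρdef] at g2 g3
  have hz₀s : z₀ ∈ sector := by
    change -‖z₀‖ / 2 < z₀.re
    linarith
  have hA1 := (hup z₀ hz₀s (by linarith)).1
  have hA2 := (hup z₀ hz₀s (by linarith)).2
  set G := p * ‖gammaRatio σ z₀‖ ^ 2 with hG
  have hGlow : 2 * C + 1 ≤ G := by
    refine (hρ₀ ρ hρρ).trans ?_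
    rw [hG]
    gcongr
    refine le_trans ?_ hA1
    gcongr
  have hGpos : 0 < G := by linarith
  have hA0 : hardySymbol N s ξ l = G - C := hardySymbol_eq N s ξ l
  set A₀ := hardySymbol N s ξ l with hA₀
  have hA0half : G / 2 ≤ A₀ := by rw [hA0]; linarith
  have hA0pos : 0 < A₀ := by linarith
  set D₀ := ξ ^ 2 + eigval N l with hD₀
  have hD0 : ρ ^ 2 / 8 ≤ D₀ := denom_lower (by omega) ξ l (by linarith)
  have hD0pos : 0 < D₀ := by nlinarith
  -- the polydisc
  have near : ∀ x ∈ Metric.ball (ξ : ℂ) (c * ρ), ∀ y ∈ Metric.ball (l : ℂ) (c * ρ),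
      ‖gammaArg N x y - z₀‖ ≤ ε * ‖z₀‖ ∧
        ‖gammaArg N (-x) y - starRingEnd ℂ z₀‖ ≤ ε * ‖starRingEnd ℂ z₀‖ := by
    intro x hx y hy
    rw [Metric.mem_ball, dist_eq_norm] at hx hy
    have hcρ : c * ρ ≤ ε * ‖z₀‖ := by nlinarith
    constructor
    · exact (norm_gammaArg_sub_lt hx hy).le.trans hcρ
    · rw [hz₀]
      have := gammaArg_conj N ξ l
      push_cast at this
      rw [← this, this, Complex.norm_conj, ← this]
      refine (norm_gammaArg_sub_lt (R := c * ρ) ?_ hy).le.trans hcρ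
      rwa [neg_sub_neg, norm_sub_rev]
  have hcz : (starRingEnd ℂ z₀).re = z₀.re := Complex.conj_re _
  have hnum : ∀ x ∈ Metric.ball (ξ : ℂ) (c * ρ), ∀ y ∈ Metric.ball (l : ℂ) (c * ρ),
      ‖cSymbol N s x y / A₀ - 1‖ ≤ 1 / 8 := by
    intro x hx y hy
    obtain ⟨n1, n2⟩ := near x hx y hy
    obtain ⟨u, hu, hu'⟩ := hpert z₀ _ (by linarith) (by linarith) n1
    obtain ⟨v, hv, hv'⟩ := hpert (starRingEnd ℂ z₀) _ (by rw [hcz]; linarith)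
      (by rw [Complex.norm_conj]; linarith) n2
    have e1 : cSymbol N s x y = G * Complex.exp (u + v) - C := by
      rw [cSymbol, ← hσ, hu', hv', gammaRatio_conj, Complex.exp_add, hG]
      have := Complex.mul_conj (gammaRatio σ z₀)
      rw [Complex.normSq_eq_norm_sq] at this
      push_cast at this ⊢
      rw [← this]
      ring
    have hA0c : (A₀ : ℂ) ≠ 0 := by exact_mod_cast hA0pos.ne'
    have e2 : cSymbol N s x y / A₀ - 1 = (G : ℂ) / A₀ * (Complex.exp (u + v) - 1) := by
      rw [e1]
      field_simp
      rw [hA0]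
      push_cast
      ring
    have huv : ‖u + v‖ ≤ 1 / 32 := (norm_add_le _ _).trans (by linarith)
    rw [e2, norm_mul, ← Complex.ofReal_div, Complex.norm_real, Real.norm_of_nonneg (by positivity)]
    have e3 : G / A₀ ≤ 2 := by rw [div_le_iff₀ hA0pos]; linarith
    have e4 := Complex.norm_exp_sub_one_le (x := u + v) (by linarith)
    calc G / A₀ * ‖Complex.exp (u + v) - 1‖ ≤ 2 * (2 * (1 / 32)) := by
          gcongr
          linarith
      _ ≤ _ := by norm_num
  have hden : ∀ x ∈ Metric.ball (ξ : ℂ) (c * ρ), ∀ y ∈ Metric.ball (l : ℂ) (c * ρ),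
      ‖cDenom N x y / D₀ - 1‖ ≤ 1 / 8 := by
    intro x hx y hy
    rw [Metric.mem_ball, dist_eq_norm] at hx hy
    have h := norm_cDenom_sub_le (N := N) hc0.le (by linarith) hx hy
    rw [cDenom_ofReal, ← hρdef, ← hD₀] at h
    have hDc : (D₀ : ℂ) ≠ 0 := by exact_mod_cast hD0pos.ne'
    rw [show cDenom N x y / D₀ - 1 = (cDenom N x y - D₀) / D₀ by field_simp, norm_div,
      Complex.norm_real, Real.norm_of_nonneg hD0pos.le, div_le_iff₀ hD0pos]
    nlinarith
  have hdenne : ∀ x ∈ Metric.ball (ξ : ℂ) (c * ρ), ∀ y ∈ Metric.ball (l : ℂ) (c * ρ),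
      cDenom N x y ≠ 0 := by
    intro x hx y hy h0
    have := hden x hx y hy
    rw [h0] at this
    norm_num at this
  -- Normalised by its value at the centre, the quotient stays within `1/2` of `1`, so its principal
  -- square root is holomorphic on the whole polydisc.
  set W : ℂ → ℂ → ℂ := fun x y => (cSymbol N s x y / A₀) / (cDenom N x y / D₀) with hW
  have hWb : ∀ x ∈ Metric.ball (ξ : ℂ) (c * ρ), ∀ y ∈ Metric.ball (l : ℂ) (c * ρ),
      ‖W x y - 1‖ ≤ 1 / 2 := by
    intro x hx y hy
    have n1 := hnum x hx y hy
    have n2 := hden x hx y hy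
    have hDc : (D₀ : ℂ) ≠ 0 := by exact_mod_cast hD0pos.ne'
    have hne : cDenom N x y / D₀ ≠ 0 := div_ne_zero (hdenne x hx y hy) hDc
    simp only [hW]
    generalize cSymbol N s x y / A₀ = a at n1 ⊢
    generalize cDenom N x y / D₀ = d at n2 hne ⊢
    have hd : 7 / 8 ≤ ‖d‖ := by
      have := norm_sub_le d (d - 1)
      rw [sub_sub_cancel, norm_one] at this
      linarith
    rw [show a / d - 1 = ((a - 1) - (d - 1)) / d by field_simp; ring, norm_div,
      div_le_iff₀ (by linarith)]
    have := norm_sub_le (a - 1) (d - 1)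
    linarith
  have hdiffA : ∀ x ∈ Metric.ball (ξ : ℂ) (c * ρ), ∀ y ∈ Metric.ball (l : ℂ) (c * ρ),
      DifferentiableAt ℂ (gammaRatio σ) (gammaArg N x y) ∧
      DifferentiableAt ℂ (gammaRatio σ) (gammaArg N (-x) y) := by
    intro x hx y hy
    obtain ⟨n1, n2⟩ := near x hx y hy
    have m1 := mem_sector_of_near hε4 (by linarith) n1
    have m2 := mem_sector_of_near hε4 (by rw [hcz]; linarith) n2
    rw [Complex.norm_conj] at m2
    have hσa : |σ| ≤ 1 := by rw [abs_of_nonneg hσ0]; exact hσ1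
    exact ⟨differentiableAt_gammaRatio
        (mem_slitPlane_of_mem_sector m1.1 (by linarith [m1.2]) hσa),
      differentiableAt_gammaRatio
        (mem_slitPlane_of_mem_sector m2.1 (by linarith [m2.2]) hσa)⟩
  have hWx : ∀ x ∈ Metric.ball (ξ : ℂ) (c * ρ), ∀ y ∈ Metric.ball (l : ℂ) (c * ρ),
      DifferentiableAt ℂ (fun x => W x y) x ∧ DifferentiableAt ℂ (W x) y := by
    intro x hx y hy
    obtain ⟨d1, d2⟩ := hdiffA x hx y hy
    have hDc : (D₀ : ℂ) ≠ 0 := by exact_mod_cast hD0pos.ne'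
    have hne : cDenom N x y / D₀ ≠ 0 := div_ne_zero (hdenne x hx y hy) hDc
    constructor
    · refine DifferentiableAt.div ?_ ?_ hne
      · refine DifferentiableAt.div_const (DifferentiableAt.sub_const (DifferentiableAt.const_mul
          (DifferentiableAt.mul ?_ ?_) _) _) _
        · exact DifferentiableAt.comp (f := fun x => gammaArg N x y) x d1
            (by unfold gammaArg; fun_prop)
        · exact DifferentiableAt.comp (f := fun x => gammaArg N (-x) y) x d2
            (by unfold gammaArg; fun_prop)
      · unfold cDenom; fun_prop
    · refine DifferentiableAt.div ?_ ?_ hne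
      · refine DifferentiableAt.div_const (DifferentiableAt.sub_const (DifferentiableAt.const_mul
          (DifferentiableAt.mul ?_ ?_) _) _) _
        · exact DifferentiableAt.comp (f := fun y => gammaArg N x y) y d1
            (by unfold gammaArg; fun_prop)
        · exact DifferentiableAt.comp (f := fun y => gammaArg N (-x) y) y d2
            (by unfold gammaArg; fun_prop)
      · unfold cDenom; fun_prop
  refine ⟨fun x y => Real.sqrt (A₀ / D₀) * W x y ^ (1 / 2 : ℂ), ?_, ?_, ?_, ?_⟩
  · intro y hy x hx
    exact (((hWx x hx y hy).1.cpow_const (mem_slitPlane_of_norm_sub_one_lt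
      ((hWb x hx y hy).trans_lt (by norm_num)))).const_mul _).differentiableWithinAt
  · intro x hx y hy
    exact (((hWx x hx y hy).2.cpow_const (mem_slitPlane_of_norm_sub_one_lt
      ((hWb x hx y hy).trans_lt (by norm_num)))).const_mul _).differentiableWithinAt
  · intro x hx y hy
    have h1 := norm_cpow_half_le ((hWb x hx y hy).trans (by norm_num))
    rw [norm_mul, Complex.norm_real, Real.norm_of_nonneg (Real.sqrt_nonneg _)]
    have h2 : A₀ / D₀ ≤ 8 * (p * ((N : ℝ) ^ (2 * σ) * Real.exp remConst) ^ 2) *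
        (ρ ^ (s - 1)) ^ 2 := by
      rw [div_le_iff₀ hD0pos]
      have h3 : A₀ ≤ p * ((N : ℝ) ^ (2 * σ) * Real.exp remConst) ^ 2 * (ρ ^ s) ^ 2 := by
        have : ‖z₀‖ ^ (2 * σ) ≤ (N : ℝ) ^ (2 * σ) * ρ ^ s := by
          calc ‖z₀‖ ^ (2 * σ) ≤ (N * ρ) ^ (2 * σ) := by gcongr
            _ = _ := by
              rw [Real.mul_rpow (by linarith) (by linarith)]
              congr 2
              rw [hσ]; ring
        calc A₀ ≤ G := by rw [hA0]; linarith
          _ ≤ p * (‖z₀‖ ^ (2 * σ) * Real.exp remConst) ^ 2 := by rw [hG]; gcongr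
          _ ≤ p * ((N : ℝ) ^ (2 * σ) * ρ ^ s * Real.exp remConst) ^ 2 := by gcongr
          _ = _ := by ring
      have h4 : ρ ^ s = ρ ^ (s - 1) * ρ := by
        rw [← Real.rpow_add_one (by linarith)]; ring_nf
      rw [h4] at h3
      have h5 : 0 ≤ p * ((N : ℝ) ^ (2 * σ) * Real.exp remConst) ^ 2 * (ρ ^ (s - 1)) ^ 2 := by
        positivity
      nlinarith
    have h6 : Real.sqrt (A₀ / D₀) ≤
        Real.sqrt (8 * (p * ((N : ℝ) ^ (2 * σ) * Real.exp remConst) ^ 2)) * ρ ^ (s - 1) := by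
      refine (Real.sqrt_le_sqrt h2).trans_eq ?_
      rw [Real.sqrt_mul (by positivity), Real.sqrt_sq (by positivity)]
    calc Real.sqrt (A₀ / D₀) * ‖W x y ^ (1 / 2 : ℂ)‖ ≤
        Real.sqrt (8 * (p * ((N : ℝ) ^ (2 * σ) * Real.exp remConst) ^ 2)) * ρ ^ (s - 1) * 2 := by
          gcongr
      _ = _ := by ring
  · intro η hη n hn
    have hne := hdenne η hη n hn
    have hw := hWb η hη n hn
    refine ⟨?_, ?_⟩
    -- The denominator vanishes at the origin but nowhere on the polydisc, so the polydisc avoids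
    -- the origin.
    · rintro ⟨⟩
      simp [cDenom] at hne
    set b := hardySymbol N s η n / (η ^ 2 + eigval N n) with hb
    have hWe : W η n = ((b / (A₀ / D₀) : ℝ) : ℂ) := by
      simp only [hW]
      rw [cSymbol_ofReal, cDenom_ofReal, hb]
      push_cast
      rw [div_div_div_comm]
    have hpos : 0 ≤ b / (A₀ / D₀) := by
      rw [hWe] at hw
      have h1 := Complex.abs_re_le_norm (((b / (A₀ / D₀) : ℝ) : ℂ) - 1)
      rw [Complex.sub_re, Complex.ofReal_re, Complex.one_re] at h1
      linarith [neg_abs_le (b / (A₀ / D₀) - 1)]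
    have hAD : 0 < A₀ / D₀ := by positivity
    change (Real.sqrt (A₀ / D₀) : ℂ) * W η n ^ (1 / 2 : ℂ) = _
    rw [hWe, show (1 / 2 : ℂ) = ((1 / 2 : ℝ) : ℂ) by push_cast; rfl, ← Complex.ofReal_cpow hpos,
      ← Real.sqrt_eq_rpow, ← Complex.ofReal_mul, ← Real.sqrt_mul hAD.le, mul_div_cancel₀ _ hAD.ne']
    rfl

/-! ### Positivity and global regularity of the symbol -/

theorem eigval_nonneg {N : ℕ} (hN : 2 ≤ N) (l : ℕ) : 0 ≤ eigval N l := by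
  have hN' : (2 : ℝ) ≤ N := by exact_mod_cast hN
  have hl : (0 : ℝ) ≤ l := Nat.cast_nonneg l
  exact mul_nonneg hl (by linarith)

theorem eigval_pos {N : ℕ} (hN : 2 ≤ N) {l : ℕ} (hl : l ≠ 0) : 0 < eigval N l := by
  have hN' : (2 : ℝ) ≤ N := by exact_mod_cast hN
  have hl : (0 : ℝ) < l := by exact_mod_cast Nat.pos_of_ne_zero hl
  exact mul_pos hl (by linarith)

theorem gammaArg_re (N : ℕ) (ξ : ℝ) (l : ℕ) : (gammaArg N ξ l).re = N / 4 + l / 2 := by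
  simp [gammaArg]; ring

theorem gammaArg_im (N : ℕ) (ξ : ℝ) (l : ℕ) : (gammaArg N ξ l).im = ξ / 2 := by
  simp [gammaArg]

/-- Strict inequalities are lost in the limit of the products, so the first factor is split off by
the recurrence and compared strictly. -/
theorem norm_gammaRatio_lt {σ : ℝ} (hσ : 0 < σ) {x y : ℝ} (hx : σ < x) (hxy : x < y) :
    ‖gammaRatio σ x‖ < ‖gammaRatio σ y‖ := by
  have e1 := gammaRatio_eq_add_one (σ := σ) (z := (x : ℂ))
    (ne_zero_of_re_pos (by simp; linarith)) (ne_zero_of_re_pos (by simp; linarith))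
  have e2 := gammaRatio_eq_add_one (σ := σ) (z := (y : ℂ))
    (ne_zero_of_re_pos (by simp; linarith)) (ne_zero_of_re_pos (by simp; linarith))
  have h := norm_gammaRatio_mono hσ.le (x := x + 1) (y := y + 1) (by linarith) (by linarith)
  have hpos : 0 < ‖gammaRatio σ (x + 1 : ℝ)‖ :=
    norm_pos_iff.2 (gammaRatio_ne_zero hσ.le (by simp; linarith))
  push_cast at h hpos
  have e (x : ℝ) : ((x : ℂ) - σ) / (x + σ) = ((x - σ) / (x + σ) : ℝ) := by push_cast; rfl
  rw [e1, e2, norm_mul, norm_mul, e, e, Complex.norm_real, Complex.norm_real,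
    Real.norm_of_nonneg (by apply div_nonneg <;> linarith),
    Real.norm_of_nonneg (by apply div_nonneg <;> linarith)]
  have hlt : (x - σ) / (x + σ) < (y - σ) / (y + σ) := by
    rw [div_lt_div_iff₀ (by linarith) (by linarith)]
    nlinarith
  have : 0 ≤ (x - σ) / (x + σ) := by apply div_nonneg <;> linarith
  nlinarith

section

variable {N : ℕ} {s : ℝ}

theorem half_lt_quarter (hN : 3 ≤ N) (hs1 : s < 1) : s / 2 < (N : ℝ) / 4 := by
  have hN' : (3 : ℝ) ≤ N := by exact_mod_cast hN
  linarith

theorem norm_gammaRatio_quarter_le (hN : 3 ≤ N) (hs0 : 0 < s) (hs1 : s < 1) (l : ℕ) :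
    ‖gammaRatio (s / 2) (((N : ℝ) / 4 : ℝ) : ℂ)‖ ≤
      ‖gammaRatio (s / 2) (((N : ℝ) / 4 + l / 2 : ℝ) : ℂ)‖ :=
  norm_gammaRatio_mono (by linarith) (half_lt_quarter hN hs1)
    (by linarith [(Nat.cast_nonneg l : (0 : ℝ) ≤ l)])

/-- The quadratic rate at `ξ = 0` is what keeps the continued value of `m̄` at `(0, 0)` strictly
positive, so that its square root is smooth. -/
theorem hardySymbol_lower (hN : 3 ≤ N) (hs0 : 0 < s) (hs1 : s < 1) :
    ∃ c > 0, ∃ d > 0, ∀ (ξ : ℝ), c * ξ ^ 2 / (d + ξ ^ 2) ≤ hardySymbol N s ξ 0 := by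
  have hN' : (3 : ℝ) ≤ N := by exact_mod_cast hN
  have hq := half_lt_quarter hN hs1
  set x : ℝ := N / 4 with hx
  have hg : 0 < ‖gammaRatio (s / 2) (x : ℂ)‖ :=
    norm_pos_iff.2 (gammaRatio_ne_zero (by linarith) (by simpa using hq))
  refine ⟨2 ^ (2 * s) * ‖gammaRatio (s / 2) (x : ℂ)‖ ^ 2 *
    (4 * x * (s / 2) / (x - s / 2) ^ 2), ?_, 4 * (x + s / 2) ^ 2, by positivity, fun ξ => ?_⟩
  · have : 0 < x - s / 2 := by linarith
    positivity
  · have h := norm_gammaRatio_sq_lower (σ := s / 2) (by linarith) (z := gammaArg N ξ (0 : ℕ))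
      (by rw [gammaArg_re]; simpa using hq)
    rw [gammaArg_re, gammaArg_im] at h
    simp only [Nat.cast_zero, zero_div, add_zero] at h
    rw [← hx] at h
    rw [hardySymbol_eq, hardyConst_eq, ← hx, Nat.cast_zero]
    have h2 : (0 : ℝ) < 2 ^ (2 * s) := by positivity
    have h3 := mul_le_mul_of_nonneg_left h h2.le
    have : 0 < x + s / 2 := by linarith
    have e : 4 * x * (s / 2) / (x - s / 2) ^ 2 * (ξ / 2) ^ 2 / ((x + s / 2) ^ 2 + (ξ / 2) ^ 2) =
      4 * x * (s / 2) / (x - s / 2) ^ 2 * ξ ^ 2 / (4 * (x + s / 2) ^ 2 + ξ ^ 2) := by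
      generalize 4 * x * (s / 2) / (x - s / 2) ^ 2 = a
      rw [div_eq_div_iff (by positivity) (by positivity)]
      ring
    rw [e] at h3
    have e' : 2 ^ (2 * s) * ‖gammaRatio (s / 2) (x : ℂ)‖ ^ 2 *
        (4 * x * (s / 2) / (x - s / 2) ^ 2) * ξ ^ 2 / (4 * (x + s / 2) ^ 2 + ξ ^ 2) =
        2 ^ (2 * s) * (‖gammaRatio (s / 2) (x : ℂ)‖ ^ 2 * (1 + 4 * x * (s / 2) /
          (x - s / 2) ^ 2 * ξ ^ 2 / (4 * (x + s / 2) ^ 2 + ξ ^ 2))) -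
        2 ^ (2 * s) * ‖gammaRatio (s / 2) (x : ℂ)‖ ^ 2 := by ring
    rw [e']
    linarith

/-- The Hardy constant is the Gamma term at `(0, 0)`: dropping the imaginary part and then lowering
the real part to `N / 4` can only decrease the modulus. -/
theorem hardySymbol_nonneg (hN : 3 ≤ N) (hs0 : 0 < s) (hs1 : s < 1) (ξ : ℝ) (l : ℕ) :
    0 ≤ hardySymbol N s ξ l := by
  have hq := half_lt_quarter hN hs1
  have hl : (0 : ℝ) ≤ l := Nat.cast_nonneg l
  rw [hardySymbol_eq, hardyConst_eq, sub_nonneg]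
  have h1 := norm_gammaRatio_re_le (σ := s / 2) (by linarith) (z := gammaArg N ξ l)
    (by rw [gammaArg_re]; linarith)
  rw [gammaArg_re] at h1
  have h2 := (norm_gammaRatio_quarter_le hN hs0 hs1 l).trans h1
  gcongr

theorem hardySymbol_pos (hN : 3 ≤ N) (hs0 : 0 < s) (hs1 : s < 1) {ξ : ℝ} {l : ℕ}
    (h : (ξ, l) ≠ (0, 0)) : 0 < hardySymbol N s ξ l := by
  have hq := half_lt_quarter hN hs1
  by_cases hl : l = 0
  · subst hl
    have hξ : ξ ≠ 0 := by rintro rfl; exact h rfl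
    obtain ⟨c, hc, d, hd, hb⟩ := hardySymbol_lower hN hs0 hs1
    refine lt_of_lt_of_le ?_ (hb ξ)
    positivity
  · have hl' : (0 : ℝ) < l := by exact_mod_cast Nat.pos_of_ne_zero hl
    rw [hardySymbol_eq, hardyConst_eq, sub_pos]
    have h1 := norm_gammaRatio_re_le (σ := s / 2) (by linarith) (z := gammaArg N ξ l)
      (by rw [gammaArg_re]; linarith)
    rw [gammaArg_re] at h1
    have h2 := (norm_gammaRatio_lt (by linarith) hq
      (show (N : ℝ) / 4 < N / 4 + l / 2 by linarith)).trans_le h1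
    gcongr

/-- A horizontal strip on which the symbol is holomorphic in `ξ`. -/
def strip : Set ℂ := {x | |x.im| < 1 / 2}

theorem isOpen_strip : IsOpen strip :=
  isOpen_lt (Complex.continuous_im.abs) continuous_const

theorem ofReal_mem_strip (η : ℝ) : (η : ℂ) ∈ strip := by simp [strip]

theorem differentiableOn_cSymbol (hN : 3 ≤ N) (hs0 : 0 < s) (hs1 : s < 1) (l : ℕ) :
    DifferentiableOn ℂ (fun x => cSymbol N s x l) strip := by
  have hN' : (3 : ℝ) ≤ N := by exact_mod_cast hN
  have hl : (0 : ℝ) ≤ l := Nat.cast_nonneg l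
  intro x hx
  have hx' : |x.im| < 1 / 2 := hx
  have key : ∀ x : ℂ, |x.im| < 1 / 2 →
      DifferentiableAt ℂ (gammaRatio (s / 2)) (gammaArg N x l) := by
    intro x hx
    refine differentiableAt_gammaRatio (Or.inl ?_)
    simp [gammaArg]
    linarith [(abs_lt.1 hx).2]
  have d1 := key x hx'
  have d2 := key (-x) (by simpa using hx')
  refine DifferentiableAt.differentiableWithinAt ?_
  refine DifferentiableAt.sub_const (DifferentiableAt.const_mul (DifferentiableAt.mul ?_ ?_) _) _
  · exact DifferentiableAt.comp (f := fun x => gammaArg N x l) x d1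
      (by unfold gammaArg; fun_prop)
  · exact DifferentiableAt.comp (f := fun x => gammaArg N (-x) l) x d2
      (by unfold gammaArg; fun_prop)

theorem contDiff_hardySymbol (hN : 3 ≤ N) (hs0 : 0 < s) (hs1 : s < 1) (l : ℕ) :
    ContDiff ℝ ((⊤ : ℕ∞) : WithTop ℕ∞) fun ξ => hardySymbol N s ξ l := by
  have := contDiff_re_of_differentiableOn isOpen_strip (differentiableOn_cSymbol hN hs0 hs1 l)
    ofReal_mem_strip
  simpa only [cSymbol_ofReal, Complex.ofReal_re] using this

/-- `P_s(ξ, 0) / ξ²`, continued to `ξ = 0`. -/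
def reducedSymbol (N : ℕ) (s : ℝ) : ℂ → ℂ :=
  dslope (dslope (fun x => cSymbol N s x 0) 0) 0

theorem differentiableOn_reducedSymbol (hN : 3 ≤ N) (hs0 : 0 < s) (hs1 : s < 1) :
    DifferentiableOn ℂ (reducedSymbol N s) strip := by
  have h := differentiableOn_cSymbol hN hs0 hs1 0
  have h0 : strip ∈ 𝓝 (0 : ℂ) := isOpen_strip.mem_nhds (by simpa using ofReal_mem_strip 0)
  simp only [Nat.cast_zero] at h
  exact (Complex.differentiableOn_dslope h0).2 ((Complex.differentiableOn_dslope h0).2 h)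

theorem cSymbol_zero : cSymbol N s 0 0 = 0 := by
  have h := cSymbol_ofReal N s 0 0
  simp only [Complex.ofReal_zero, Nat.cast_zero] at h
  rw [h, hardySymbol_eq, hardyConst_eq]
  have : gammaArg N ((0 : ℝ) : ℂ) ((0 : ℕ) : ℂ) = (((N : ℝ) / 4 : ℝ) : ℂ) := by
    simp [gammaArg]; ring
  rw [this]
  simp

/-- The symbol is even, since `x ↦ -x` exchanges its two Gamma quotients. -/
theorem deriv_cSymbol_zero (hN : 3 ≤ N) (hs0 : 0 < s) (hs1 : s < 1) :
    deriv (fun x => cSymbol N s x 0) 0 = 0 := by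
  have h0 : strip ∈ 𝓝 (0 : ℂ) := isOpen_strip.mem_nhds (by simpa using ofReal_mem_strip 0)
  have h := differentiableOn_cSymbol hN hs0 hs1 0
  simp only [Nat.cast_zero] at h
  have e : (fun x => cSymbol N s x 0) = fun x => (fun x => cSymbol N s x 0) (-x) := by
    funext x
    simp only [cSymbol, neg_neg, mul_comm]
  have h3 : deriv (fun x => cSymbol N s x 0) 0 = -deriv (fun x => cSymbol N s x 0) 0 := by
    conv_lhs => rw [e]
    exact (deriv_comp_neg (fun x => cSymbol N s x 0) 0).trans (by simp)
  exact self_eq_neg.1 h3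

theorem reducedSymbol_ofReal (hN : 3 ≤ N) (hs0 : 0 < s) (hs1 : s < 1) {ξ : ℝ} (hξ : ξ ≠ 0) :
    (reducedSymbol N s ξ).re = hardySymbol N s ξ 0 / ξ ^ 2 := by
  have hξ' : (ξ : ℂ) ≠ 0 := by exact_mod_cast hξ
  have h := cSymbol_ofReal N s ξ 0
  simp only [Nat.cast_zero] at h
  have : reducedSymbol N s ξ = ((hardySymbol N s ξ 0 / ξ ^ 2 : ℝ) : ℂ) := by
    rw [reducedSymbol, dslope_of_ne _ hξ', slope_def_field, dslope_of_ne _ hξ', dslope_same,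
      deriv_cSymbol_zero hN hs0 hs1, slope_def_field, cSymbol_zero, h]
    push_cast
    field_simp
    ring
  rw [this, Complex.ofReal_re]

/-- At `ξ = 0` the value is a limit of quotients bounded below by `c / (d + η²)`, hence it is at
least `c / d`. -/
theorem reducedSymbol_pos (hN : 3 ≤ N) (hs0 : 0 < s) (hs1 : s < 1) (ξ : ℝ) :
    0 < (reducedSymbol N s ξ).re := by
  by_cases hξ : ξ = 0
  · subst hξ
    obtain ⟨c, hc, d, hd, hb⟩ := hardySymbol_lower hN hs0 hs1
    have hcont : Continuous fun η : ℝ => (reducedSymbol N s η).re :=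
      (contDiff_re_of_differentiableOn isOpen_strip (differentiableOn_reducedSymbol hN hs0 hs1)
        ofReal_mem_strip).continuous
    have hcont2 : Continuous fun η : ℝ => c / (d + η ^ 2) :=
      continuous_const.div (by fun_prop) fun η => by positivity
    have t1 := (hcont.tendsto 0).mono_left (nhdsWithin_le_nhds (s := {0}ᶜ))
    have t2 := (hcont2.tendsto 0).mono_left (nhdsWithin_le_nhds (s := {0}ᶜ))
    have := le_of_tendsto_of_tendsto t2 t1 (by
      filter_upwards [self_mem_nhdsWithin] with η hη
      have hη' : η ≠ 0 := hη
      rw [reducedSymbol_ofReal hN hs0 hs1 hη', le_div_iff₀ (by positivity)]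
      refine le_trans (le_of_eq ?_) (hb η)
      ring)
    refine lt_of_lt_of_le ?_ this
    positivity
  · rw [reducedSymbol_ofReal hN hs0 hs1 hξ]
    have := hardySymbol_pos hN hs0 hs1 (ξ := ξ) (l := 0) (by simpa using hξ)
    positivity

/-- The symbol `m̄`, continued through its removable point `(0, 0)`. -/
def mbarExt (N : ℕ) (s ξ : ℝ) (l : ℕ) : ℝ :=
  if l = 0 then Real.sqrt (reducedSymbol N s ξ).re else mbar N s ξ l

theorem mbarExt_eq (hN : 3 ≤ N) (hs0 : 0 < s) (hs1 : s < 1) {ξ : ℝ} {l : ℕ}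
    (h : (ξ, l) ≠ (0, 0)) : mbarExt N s ξ l = mbar N s ξ l := by
  by_cases hl : l = 0
  · subst hl
    have hξ : ξ ≠ 0 := by rintro rfl; exact h rfl
    simp [mbarExt, mbar, reducedSymbol_ofReal hN hs0 hs1 hξ, eigval]
  · simp [mbarExt, hl]

theorem contDiff_mbarExt (hN : 3 ≤ N) (hs0 : 0 < s) (hs1 : s < 1) (l : ℕ) :
    ContDiff ℝ ((⊤ : ℕ∞) : WithTop ℕ∞) fun ξ => mbarExt N s ξ l := by
  by_cases hl : l = 0
  · subst hl
    simp only [mbarExt, if_true]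
    exact (contDiff_re_of_differentiableOn isOpen_strip
      (differentiableOn_reducedSymbol hN hs0 hs1) ofReal_mem_strip).sqrt
      fun ξ => (reducedSymbol_pos hN hs0 hs1 ξ).ne'
  · simp only [mbarExt, hl, if_false, mbar]
    have hμ := eigval_pos (N := N) (by omega) hl
    refine ContDiff.sqrt ((contDiff_hardySymbol hN hs0 hs1 l).div (by fun_prop) fun ξ => ?_)
      fun ξ => ?_
    · positivity
    · have := hardySymbol_pos hN hs0 hs1 (ξ := ξ) (l := l) (by simp [hl])
      positivity

/-- For large `1 + |ξ| + ℓ` the bound is Cauchy's estimate on the polydisc of proportional radius.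
The remaining region has finitely many `ℓ` and bounded `ξ`, so continuity suffices there. -/
theorem isSymbol_mbarExt (hN : 3 ≤ N) (hs0 : 0 < s) (hs1 : s < 1) :
    IsSymbol (s - 1) (mbarExt N s) := by
  refine ⟨contDiff_mbarExt hN hs0 hs1, fun j k => ?_⟩
  obtain ⟨c, hc, ρ₀, K, hext⟩ := exists_holomorphic_extension hN hs0 hs1
  -- The second entry gives `k ≤ c ρ / 4`, room for `k` unit shifts inside the polydisc.
  set ρ₁ := max ρ₀ (4 * k / c) with hρ₁
  set F : ℕ → ℝ → ℝ := fun l ξ => iteratedDeriv j (fun η => (fwdDiff 1)^[k] (mbarExt N s η) l) ξ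
    with hF
  have hsmooth : ∀ l, ContDiff ℝ ((⊤ : ℕ∞) : WithTop ℕ∞)
      fun η => (fwdDiff 1)^[k] (mbarExt N s η) l := by
    intro l
    have e : (fun η => (fwdDiff 1)^[k] (mbarExt N s η) l) = fun η => ∑ i ∈ Finset.range (k + 1),
        ((-1 : ℤ) ^ (k - i) * k.choose i) • mbarExt N s η (l + i • 1) := by
      funext η; exact fwdDiff_iter_eq_sum_shift ..
    rw [e]
    refine ContDiff.sum fun i _ => ?_
    simp only [zsmul_eq_mul]
    exact contDiff_const.mul (contDiff_mbarExt hN hs0 hs1 _)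
  have hcont : ∀ l, Continuous (F l) := fun l =>
    (hsmooth l).continuous_iteratedDeriv j (by exact_mod_cast le_top)
  have hbdd : ∀ l, ∃ B : ℝ, ∀ ξ ∈ Set.Icc (-ρ₁) ρ₁, |F l ξ| ≤ B := fun l =>
    isCompact_Icc.exists_bound_of_continuousOn (hcont l).continuousOn
  choose B hB using hbdd
  set r : ℝ := s - 1 - j - k with hr
  have hr0 : r ≤ 0 := by
    have : (0 : ℝ) ≤ j := Nat.cast_nonneg j
    have : (0 : ℝ) ≤ k := Nat.cast_nonneg k
    linarith
  set C₁ : ℝ := (∑ l ∈ Finset.range (⌈ρ₁⌉₊ + 1), |B l|) * ρ₁ ^ (-r) with hC₁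
  set C₂ : ℝ := j.factorial * |K| / ((c / (4 * (k + 1))) ^ k * (c / 2) ^ j) with hC₂
  refine ⟨max C₁ C₂, fun ξ l => ?_⟩
  have hl : (0 : ℝ) ≤ l := Nat.cast_nonneg l
  have hξ := abs_nonneg ξ
  set ρ := 1 + |ξ| + (l : ℝ) with hρ
  have hρ0 : 0 < ρ := by linarith
  have hρr : 0 ≤ ρ ^ r := by positivity
  rcases lt_or_ge ρ ρ₁ with hlt | hge
  · have h1 : |F l ξ| ≤ B l := hB l ξ (abs_le.1 (by linarith))
    have h2 : |B l| ≤ ∑ l ∈ Finset.range (⌈ρ₁⌉₊ + 1), |B l| := by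
      refine Finset.single_le_sum (f := fun l => |B l|) (fun i _ => abs_nonneg _) ?_
      rw [Finset.mem_range]
      have : (l : ℝ) ≤ ⌈ρ₁⌉₊ := le_trans (by linarith) (Nat.le_ceil ρ₁)
      have : l ≤ ⌈ρ₁⌉₊ := by exact_mod_cast this
      omega
    have h3 : 1 ≤ ρ₁ ^ (-r) * ρ ^ r := by
      have : ρ₁ ^ r ≤ ρ ^ r := Real.rpow_le_rpow_of_nonpos hρ0 hlt.le hr0
      have h4 : 0 < ρ₁ := by linarith
      calc 1 = ρ₁ ^ (-r) * ρ₁ ^ r := by rw [← Real.rpow_add h4]; simp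
        _ ≤ _ := by gcongr
    calc |F l ξ| ≤ ∑ l ∈ Finset.range (⌈ρ₁⌉₊ + 1), |B l| := h1.trans ((le_abs_self _).trans h2)
      _ ≤ (∑ l ∈ Finset.range (⌈ρ₁⌉₊ + 1), |B l|) * (ρ₁ ^ (-r) * ρ ^ r) :=
        le_mul_of_one_le_right (by positivity) h3
      _ = C₁ * ρ ^ r := by rw [hC₁]; ring
      _ ≤ _ := by gcongr; exact le_max_left _ _
  · obtain ⟨f, f1, f2, f3, f4⟩ := hext ξ l ((le_max_left _ _).trans hge)
    have hk : (k : ℝ) ≤ c * ρ / 4 := by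
      have : 4 * k / c ≤ ρ := (le_max_right _ _).trans hge
      rw [div_le_iff₀ hc] at this
      linarith
    have := abs_iteratedDeriv_fwdDiff_le (a := mbarExt N s) (j := j) (by positivity) hk f1 f2 f3
      fun η hη n hn => by
        rw [(f4 η hη n hn).2, mbarExt_eq hN hs0 hs1 (f4 η hη n hn).1]
    refine this.trans ?_
    calc _ ≤ (j.factorial : ℝ) * (|K| * ρ ^ (s - 1) / (c * ρ / (4 * (k + 1))) ^ k) /
          (c * ρ / 2) ^ j := by
          gcongr
          exact le_abs_self K
      _ = C₂ * ρ ^ r := by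
          rw [hC₂, hr, Real.rpow_sub hρ0 (s - 1 - j), Real.rpow_sub hρ0 (s - 1),
            Real.rpow_natCast, Real.rpow_natCast, show c * ρ / (4 * (k + 1)) =
            c / (4 * (k + 1)) * ρ by ring, show c * ρ / 2 = c / 2 * ρ by ring, mul_pow, mul_pow]
          field_simp
      _ ≤ _ := by gcongr; exact le_max_right _ _

/-- The decay of `m̄`. -/
theorem exists_mbar_le (hN : 3 ≤ N) (hs0 : 0 < s) (hs1 : s < 1) :
    ∃ C > 0, ∀ (ξ : ℝ) (l : ℕ), mbar N s ξ l ≤ C * (1 + |ξ| + l) ^ (s - 1) := by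
  obtain ⟨C, hC⟩ := (isSymbol_mbarExt hN hs0 hs1).2 0 0
  refine ⟨max C 1, by positivity, fun ξ l => ?_⟩
  have h0 : 0 ≤ (1 + |ξ| + (l : ℝ)) ^ (s - 1) := by positivity
  -- At the origin the denominator is zero, so `mbar` takes the default value `0`.
  by_cases h : (ξ, l) = (0, 0)
  · rw [Prod.mk.injEq] at h
    obtain ⟨rfl, rfl⟩ := h
    simp [mbar, eigval]
  · have := hC ξ l
    simp only [iteratedDeriv_zero, Function.iterate_zero, id_eq, Nat.cast_zero, sub_zero] at this
    rw [← mbarExt_eq hN hs0 hs1 h]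
    refine (le_abs_self _).trans (this.trans ?_)
    gcongr
    exact le_max_left _ _

theorem mbar_nonneg (ξ : ℝ) (l : ℕ) : 0 ≤ mbar N s ξ l := Real.sqrt_nonneg _

theorem measurable_mbar (hN : 3 ≤ N) (hs0 : 0 < s) (hs1 : s < 1) (l : ℕ) :
    Measurable fun ξ => mbar N s ξ l :=
  ((contDiff_hardySymbol hN hs0 hs1 l).continuous.measurable.div (by fun_prop)).sqrt

theorem exists_mbar_le_const (hN : 3 ≤ N) (hs0 : 0 < s) (hs1 : s < 1) :
    ∃ C > 0, ∀ (ξ : ℝ) (l : ℕ), mbar N s ξ l ≤ C := by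
  obtain ⟨C, hC, h⟩ := exists_mbar_le hN hs0 hs1
  refine ⟨C, hC, fun ξ l => (h ξ l).trans ?_⟩
  have hl : (0 : ℝ) ≤ l := Nat.cast_nonneg l
  have : (1 + |ξ| + (l : ℝ)) ^ (s - 1) ≤ 1 :=
    Real.rpow_le_one_of_one_le_of_nonpos (by linarith [abs_nonneg ξ]) (by linarith)
  nlinarith

theorem memLp_mbar (hN : 3 ≤ N) (hs0 : 0 < s) (hs1 : s < 1) :
    MemLp (fun p : ℝ × ℕ => mbar N s p.1 p.2) ∞ ((volume : Measure ℝ).prod Measure.count) := by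
  obtain ⟨C, hC, h⟩ := exists_mbar_le_const hN hs0 hs1
  refine memLp_top_of_bound ?_ C (Eventually.of_forall fun p => ?_)
  · exact (measurable_from_prod_countable_left
      (fun l => measurable_mbar hN hs0 hs1 l)).aestronglyMeasurable
  · rw [Real.norm_of_nonneg (mbar_nonneg _ _)]
    exact h _ _

end

/-! ### Asymptotic equivalence for the multiplier -/

theorem norm_gammaArg_sq (N : ℕ) (ξ : ℝ) (l : ℕ) :
    ‖gammaArg N ξ l‖ ^ 2 = ((l + N / 2) ^ 2 + ξ ^ 2) / 4 := by
  rw [Complex.sq_norm, Complex.normSq_apply, gammaArg_re, gammaArg_im]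
  ring

/-- With `q = ξ² + ℓ²` and `q' = 4|z|²`, the Gamma term is `q'^s e^{-2 Re R}`. Both `q'` and the
denominator differ from `q` by `O(ℓ + 1) = o(q)`, and the Hardy constant is negligible against
`q^s`. -/
theorem isEquivalent_mbar {N : ℕ} {s : ℝ} (hN : 3 ≤ N) (hs0 : 0 < s) (hs1 : s < 1) :
    Asymptotics.IsEquivalent
      (comap (fun p : ℝ × ℕ => p.1 ^ 2 + (p.2 : ℝ) ^ 2) atTop)
      (fun p : ℝ × ℕ => mbar N s p.1 p.2)
      (fun p : ℝ × ℕ => (p.1 ^ 2 + (p.2 : ℝ) ^ 2) ^ ((s - 1) / 2)) := by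
  set L : Filter (ℝ × ℕ) := comap (fun p : ℝ × ℕ => p.1 ^ 2 + (p.2 : ℝ) ^ 2) atTop with hL
  set q : ℝ × ℕ → ℝ := fun p => p.1 ^ 2 + (p.2 : ℝ) ^ 2 with hq
  have tq : Tendsto q L atTop := tendsto_comap
  have hpos : ∀ᶠ p in L, 1 ≤ q p := tq.eventually_ge_atTop 1
  have tinv : Tendsto (fun p => (q p)⁻¹) L (𝓝 0) := tendsto_inv_atTop_zero.comp tq
  have tl : Tendsto (fun p : ℝ × ℕ => (p.2 : ℝ) * (q p)⁻¹) L (𝓝 0) := by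
    have t1 : Tendsto (fun p => (Real.sqrt (q p))⁻¹) L (𝓝 0) :=
      tendsto_inv_atTop_zero.comp (Real.tendsto_sqrt_atTop.comp tq)
    refine tendsto_of_tendsto_of_tendsto_of_le_of_le' tendsto_const_nhds t1 ?_ ?_
    · filter_upwards [hpos] with p hp
      have : 0 < q p := by linarith
      positivity
    · filter_upwards [hpos] with p hp
      have h0 : 0 < q p := by linarith
      have h1 : (p.2 : ℝ) ≤ Real.sqrt (q p) :=
        Real.le_sqrt_of_sq_le (by simp only [hq]; nlinarith [sq_nonneg p.1])
      have h2 : Real.sqrt (q p) * Real.sqrt (q p) = q p := Real.mul_self_sqrt h0.le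
      have h3 : 0 < Real.sqrt (q p) := Real.sqrt_pos.2 h0
      rw [← div_eq_mul_inv, div_le_iff₀ h0]
      calc (p.2 : ℝ) ≤ Real.sqrt (q p) := h1
        _ = (Real.sqrt (q p))⁻¹ * q p := by
          rw [← h2, Real.sqrt_mul_self h3.le]; field_simp
  set q' : ℝ × ℕ → ℝ := fun p => ((p.2 : ℝ) + N / 2) ^ 2 + p.1 ^ 2 with hq'
  set d : ℝ × ℕ → ℝ := fun p => p.1 ^ 2 + eigval N p.2 with hd
  have tq' : Tendsto (fun p => q' p / q p) L (𝓝 1) := by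
    have : Tendsto (fun p : ℝ × ℕ => 1 + N * ((p.2 : ℝ) * (q p)⁻¹) + (N : ℝ) ^ 2 / 4 * (q p)⁻¹) L
        (𝓝 (1 + N * 0 + (N : ℝ) ^ 2 / 4 * 0)) :=
      ((tl.const_mul _).const_add _).add (tinv.const_mul _)
    simp only [mul_zero, add_zero] at this
    refine this.congr' ?_
    filter_upwards [hpos] with p hp
    have h0 : q p ≠ 0 := by linarith
    field_simp
    simp only [hq, hq']
    ring
  have td : Tendsto (fun p => d p / q p) L (𝓝 1) := by
    have : Tendsto (fun p : ℝ × ℕ => 1 + (N - 2) * ((p.2 : ℝ) * (q p)⁻¹)) L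
        (𝓝 (1 + ((N : ℝ) - 2) * 0)) := (tl.const_mul _).const_add _
    simp only [mul_zero, add_zero] at this
    refine this.congr' ?_
    filter_upwards [hpos] with p hp
    have h0 : q p ≠ 0 := by linarith
    field_simp
    simp only [hq, hd, eigval]
    ring
  have tz : Tendsto (fun p : ℝ × ℕ => ‖gammaArg N p.1 p.2‖) L atTop := by
    have : Tendsto (fun p => Real.sqrt (q p / 4)) L atTop :=
      Real.tendsto_sqrt_atTop.comp (tq.atTop_div_const (by norm_num))
    refine tendsto_atTop_mono (fun p => ?_) this
    refine Real.sqrt_le_iff.2 ⟨norm_nonneg _, ?_⟩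
    rw [norm_gammaArg_sq]
    have h1 : (0 : ℝ) ≤ N := Nat.cast_nonneg N
    have h2 : (0 : ℝ) ≤ p.2 := Nat.cast_nonneg p.2
    simp only [hq]
    nlinarith [mul_nonneg h1 h2]
  have hsec : ∀ p : ℝ × ℕ, gammaArg N p.1 p.2 ∈ sector := fun p => by
    have h1 := (gammaArg_bounds hN p.1 p.2).1
    change -‖gammaArg N p.1 p.2‖ / 2 < (gammaArg N p.1 p.2).re
    linarith [norm_nonneg (gammaArg N p.1 p.2)]
  have trem : Tendsto (fun p : ℝ × ℕ => (logRem (s / 2) (gammaArg N p.1 p.2)).re) L (𝓝 0) := by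
    have t1 : Tendsto (fun p : ℝ × ℕ => remConst * ‖gammaArg N p.1 p.2‖ ^ (-(1 / 2) : ℝ)) L
        (𝓝 0) := by
      simpa using ((tendsto_rpow_neg_atTop (show (0 : ℝ) < 1 / 2 by norm_num)).comp tz).const_mul
        remConst
    refine squeeze_zero_norm' ?_ t1
    filter_upwards [tz.eventually_ge_atTop 4] with p hp
    exact (Complex.abs_re_le_norm _).trans
      (norm_logRem_le (by linarith) (by linarith) (hsec p) hp)
  have tqs : Tendsto (fun p => hardyConst N s * (q p) ^ (-s)) L (𝓝 0) := by
    simpa using ((tendsto_rpow_neg_atTop hs0).comp tq).const_mul (hardyConst N s)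
  have tmain : Tendsto (fun p : ℝ × ℕ => Real.sqrt (((q' p / q p) ^ s *
      Real.exp (-(logRem (s / 2) (gammaArg N p.1 p.2)).re) ^ 2 - hardyConst N s * (q p) ^ (-s)) /
      (d p / q p))) L (𝓝 1) := by
    have t2 := ((((tq'.rpow_const (p := s) (Or.inl one_ne_zero)).mul
      ((trem.neg.rexp).pow 2)).sub tqs).div td one_ne_zero).sqrt
    simpa using t2
  refine Asymptotics.isEquivalent_of_tendsto_one ?_
  refine tmain.congr' ?_
  filter_upwards [hpos, tz.eventually_ge_atTop 4] with p hp hz4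
  have h0 : 0 < q p := by linarith
  have hq'0 : 0 ≤ q' p := by simp only [hq']; positivity
  simp only [Pi.div_apply]
  change _ = mbar N s p.1 p.2 / q p ^ ((s - 1) / 2)
  have e1 : hardySymbol N s p.1 p.2 = q' p ^ s *
      Real.exp (-(logRem (s / 2) (gammaArg N p.1 p.2)).re) ^ 2 - hardyConst N s := by
    rw [hardySymbol_eq, norm_gammaRatio_eq (by linarith) (by linarith) (hsec p) hz4, mul_pow,
      ← mul_assoc]
    congr 2
    rw [show (2 : ℝ) * (s / 2) = s by ring, ← Real.rpow_natCast (_ ^ s), ← Real.rpow_mul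
      (norm_nonneg _), mul_comm s, Real.rpow_mul (norm_nonneg _), Real.rpow_mul (by norm_num),
      ← Real.mul_rpow (by positivity) (by positivity), Real.rpow_natCast, norm_gammaArg_sq]
    congr 1
    simp only [hq', Real.rpow_two]
    ring
  have e2 : q p ^ ((s - 1) / 2) = Real.sqrt (q p ^ (s - 1)) := by
    rw [Real.sqrt_eq_rpow, ← Real.rpow_mul h0.le]
    ring_nf
  rw [mbar, e2, ← Real.sqrt_div' _ (by positivity), e1, Real.div_rpow hq'0 h0.le,
    Real.rpow_sub_one h0.ne', Real.rpow_neg h0.le]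
  congr 1
  have h1 : q p ^ s ≠ 0 := by positivity
  change _ = _ / d p / _
  by_cases hd0 : d p = 0
  · simp [hd0]
  · field_simp

/-! ### Algebra of harmonic polynomials -/

open MvPolynomial in
theorem polyLaplacian_apply (N : ℕ) (p : MvPolynomial (Fin N) ℂ) :
    polyLaplacian N p = ∑ i, pderiv i (pderiv i p) := by
  simp [polyLaplacian, LinearMap.sum_apply]

/-- The polynomial `|x|²`. -/
def normSqPoly (N : ℕ) : MvPolynomial (Fin N) ℂ := ∑ i, MvPolynomial.X i ^ 2

section

open MvPolynomial

variable {N : ℕ}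

theorem normSqPoly_isHomogeneous : (normSqPoly N).IsHomogeneous 2 := by
  refine IsHomogeneous.sum _ _ _ fun i _ => ?_
  simpa using (isHomogeneous_X ℂ i).pow 2

theorem pderiv_normSqPoly (i : Fin N) : pderiv i (normSqPoly N) = 2 * X i := by
  classical
  simp [normSqPoly, pderiv_X, Pi.single_apply, Derivation.leibniz_pow, mul_comm]

theorem polyLaplacian_mul (p q : MvPolynomial (Fin N) ℂ) :
    polyLaplacian N (p * q) =
      p * polyLaplacian N q + q * polyLaplacian N p + 2 * ∑ i, pderiv i p * pderiv i q := by
  simp only [polyLaplacian_apply, Derivation.leibniz, smul_eq_mul, map_add, Finset.mul_sum,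
    ← Finset.sum_add_distrib]
  exact Finset.sum_congr rfl fun i _ => by ring

theorem polyLaplacian_normSqPoly : polyLaplacian N (normSqPoly N) = 2 * N := by
  have h (i : Fin N) : pderiv i (2 : MvPolynomial (Fin N) ℂ) = 0 := by
    have : (2 : MvPolynomial (Fin N) ℂ) = C 2 := (map_ofNat C 2).symm
    rw [this, pderiv_C]
  simp [polyLaplacian_apply, pderiv_normSqPoly, Derivation.leibniz, h, mul_comm]

/-- The cross term of the product rule is `4 x·∇p`, which is `4d p` by Euler's identity. -/
theorem polyLaplacian_normSqPoly_mul {p : MvPolynomial (Fin N) ℂ} {d : ℕ}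
    (hp : p.IsHomogeneous d) :
    polyLaplacian N (normSqPoly N * p) =
      ((2 * N + 4 * d : ℕ) : MvPolynomial (Fin N) ℂ) * p + normSqPoly N * polyLaplacian N p := by
  have h := hp.sum_X_mul_pderiv
  have h2 : ∑ i, 2 * X i * pderiv i p = 2 * (d • p) := by
    rw [← h, Finset.mul_sum]
    exact Finset.sum_congr rfl fun i _ => by ring
  rw [polyLaplacian_mul, polyLaplacian_normSqPoly]
  simp only [pderiv_normSqPoly]
  rw [h2, nsmul_eq_mul]
  push_cast
  ring

theorem exists_polyLaplacian_normSqPoly_pow (hN : 0 < N) {h : MvPolynomial (Fin N) ℂ} {e : ℕ}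
    (hh : h ∈ harmonicPoly N e) (j : ℕ) :
    ∃ c : ℕ, 0 < c ∧ polyLaplacian N (normSqPoly N ^ (j + 1) * h) =
      (c : MvPolynomial (Fin N) ℂ) * (normSqPoly N ^ j * h) := by
  have hh1 : h.IsHomogeneous e := hh.1
  have hh2 : polyLaplacian N h = 0 := hh.2
  induction j with
  | zero =>
    refine ⟨2 * N + 4 * e, by omega, ?_⟩
    rw [zero_add, pow_one, polyLaplacian_normSqPoly_mul hh1, hh2]
    simp
  | succ j ih =>
    obtain ⟨c, hc, ihc⟩ := ih
    refine ⟨2 * N + 4 * (2 * (j + 1) + e) + c, by omega, ?_⟩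
    have hom : (normSqPoly N ^ (j + 1) * h).IsHomogeneous (2 * (j + 1) + e) :=
      (normSqPoly_isHomogeneous.pow (j + 1)).mul hh1
    rw [pow_succ', mul_assoc, polyLaplacian_normSqPoly_mul hom, ihc]
    push_cast
    ring

/-- The span of the products of powers of `|x|²` and harmonic polynomials, in degree `d`. -/
def harmonicSpan (N d : ℕ) : Submodule ℂ (MvPolynomial (Fin N) ℂ) :=
  Submodule.span ℂ {p | ∃ j e, e + 2 * j = d ∧ ∃ h ∈ harmonicPoly N e, p = normSqPoly N ^ j * h}

/-- On each generator the Laplacian only lowers the power of `|x|²` and multiplies by a positive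
integer, which can be inverted. -/
theorem exists_polyLaplacian_eq (hN : 0 < N) {d : ℕ} {r : MvPolynomial (Fin N) ℂ}
    (hr : r ∈ harmonicSpan N d) :
    ∃ r' ∈ harmonicSpan N (d + 2) ⊓ homogeneousSubmodule (Fin N) ℂ (d + 2),
      polyLaplacian N r' = r := by
  induction hr using Submodule.span_induction with
  | mem x hx =>
    obtain ⟨j, e, he, h, hh, rfl⟩ := hx
    obtain ⟨c, hc, hlap⟩ := exists_polyLaplacian_normSqPoly_pow hN hh j
    have hc' : (c : ℂ) ≠ 0 := by exact_mod_cast hc.ne'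
    refine ⟨(c : ℂ)⁻¹ • (normSqPoly N ^ (j + 1) * h), Submodule.smul_mem _ _ ⟨?_, ?_⟩, ?_⟩
    · exact Submodule.subset_span ⟨j + 1, e, by omega, h, hh, rfl⟩
    · have := (normSqPoly_isHomogeneous.pow (j + 1)).mul hh.1
      rwa [show 2 * (j + 1) + e = d + 2 by omega] at this
    · rw [map_smul, hlap, ← nsmul_eq_mul, ← Nat.cast_smul_eq_nsmul ℂ, smul_smul,
        inv_mul_cancel₀ hc', one_smul]
  | zero => exact ⟨0, Submodule.zero_mem _, map_zero _⟩
  | add x y _ _ hx hy =>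
    obtain ⟨x', hx', rfl⟩ := hx
    obtain ⟨y', hy', rfl⟩ := hy
    exact ⟨x' + y', Submodule.add_mem _ hx' hy', map_add _ _ _⟩
  | smul a x _ hx =>
    obtain ⟨x', hx', rfl⟩ := hx
    exact ⟨a • x', Submodule.smul_mem _ _ hx', map_smul _ _ _⟩

theorem isHomogeneous_polyLaplacian {p : MvPolynomial (Fin N) ℂ} {d : ℕ}
    (hp : p.IsHomogeneous (d + 2)) : (polyLaplacian N p).IsHomogeneous d := by
  rw [polyLaplacian_apply]
  exact IsHomogeneous.sum _ _ _ fun i _ => (hp.pderiv (i := i)).pderiv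

theorem polyLaplacian_eq_zero_of_lt {p : MvPolynomial (Fin N) ℂ} {d : ℕ}
    (hp : p.IsHomogeneous d) (hd : d < 2) : polyLaplacian N p = 0 := by
  rw [polyLaplacian_apply]
  refine Finset.sum_eq_zero fun i _ => ?_
  have h1 : (pderiv i p).IsHomogeneous 0 := by
    have := hp.pderiv (i := i)
    rwa [show d - 1 = 0 by omega] at this
  have h2 := totalDegree_eq_zero_iff_eq_C.1 ((totalDegree_zero_iff_isHomogeneous _).2 h1)
  rw [h2, pderiv_C]

/-- Every homogeneous polynomial is a combination of products of powers of `|x|²` and harmonic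
polynomials. -/
theorem homogeneousSubmodule_le_harmonicSpan (hN : 0 < N) (d : ℕ) :
    homogeneousSubmodule (Fin N) ℂ d ≤ harmonicSpan N d := by
  induction d using Nat.strong_induction_on with
  | _ d ih =>
    have hharm : harmonicPoly N d ≤ harmonicSpan N d := fun h hh =>
      Submodule.subset_span ⟨0, d, by omega, h, hh, by simp⟩
    intro p hp
    rcases lt_or_ge d 2 with hd | hd
    · exact hharm ⟨hp, polyLaplacian_eq_zero_of_lt hp hd⟩
    · obtain ⟨d, rfl⟩ := Nat.exists_eq_add_of_le' hd
      -- Subtracting a preimage of the Laplacian of `p` that already lies in the span leaves a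
      -- harmonic polynomial.
      obtain ⟨r', ⟨hr1, hr2⟩, hr3⟩ := exists_polyLaplacian_eq hN
        (ih d (by omega) (isHomogeneous_polyLaplacian hp))
      have : p - r' ∈ harmonicPoly N (d + 2) :=
        ⟨Submodule.sub_mem _ hp hr2, by simp [hr3]⟩
      simpa using Submodule.add_mem _ (hharm this) hr1

/-! ### Rotation generators and Green's identity -/

/-- The generator of the rotations in the `(i, j)` plane. -/
def rotGen (i j : Fin N) : MvPolynomial (Fin N) ℂ →ₗ[ℂ] MvPolynomial (Fin N) ℂ :=
  LinearMap.mulLeft ℂ (X i) ∘ₗ (pderiv j).toLinearMap -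
    LinearMap.mulLeft ℂ (X j) ∘ₗ (pderiv i).toLinearMap

theorem rotGen_apply (i j : Fin N) (p : MvPolynomial (Fin N) ℂ) :
    rotGen i j p = X i * pderiv j p - X j * pderiv i p := rfl

theorem rotGen_X_mul (i j : Fin N) (f : MvPolynomial (Fin N) ℂ) :
    rotGen i j (X i * f) = (if i = j then X i * f else 0) + X i ^ 2 * pderiv j f - X j * f -
      X j * (X i * pderiv i f) := by
  classical
  simp only [rotGen_apply, Derivation.leibniz, smul_eq_mul, pderiv_X, Pi.single_apply]
  split_ifs <;> ring

/-- A polynomial form of the divergence theorem on the sphere: modulo images of rotation generators,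
`|x|² div f` equals `(N + d - 1) x·f`. -/
theorem sum_rotGen {f : Fin N → MvPolynomial (Fin N) ℂ} {d : ℕ} (hf : ∀ j, (f j).IsHomogeneous d) :
    ∑ i, ∑ j, rotGen i j (X i * f j) =
      normSqPoly N * ∑ j, pderiv j (f j) -
        ((N : MvPolynomial (Fin N) ℂ) + d - 1) * ∑ j, X j * f j := by
  have e : ∀ j, ∑ i, X j * (X i * pderiv i (f j)) = (d : MvPolynomial (Fin N) ℂ) * (X j * f j) := by
    intro j
    rw [← Finset.mul_sum, (hf j).sum_X_mul_pderiv, nsmul_eq_mul]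
    ring
  simp only [rotGen_X_mul, Finset.sum_sub_distrib, Finset.sum_add_distrib]
  have e1 : ∑ i, ∑ j, (if i = j then X i * f j else 0) = ∑ j, X j * f j := by
    simp
  have e2 : ∑ i, ∑ j, X i ^ 2 * pderiv j (f j) = normSqPoly N * ∑ j, pderiv j (f j) := by
    rw [normSqPoly, Finset.sum_mul_sum]
  have e3 : ∑ _i : Fin N, ∑ j, X j * f j = (N : MvPolynomial (Fin N) ℂ) * ∑ j, X j * f j := by
    simp
  have e4 : ∑ i, ∑ j, X j * (X i * pderiv i (f j)) =
      (d : MvPolynomial (Fin N) ℂ) * ∑ j, X j * f j := by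
    rw [Finset.sum_comm, Finset.mul_sum]
    exact Finset.sum_congr rfl fun j _ => e j
  rw [e1, e2, e3, e4]
  ring

/-- Green's field `q ∇p - p ∇q` has zero divergence by harmonicity and radial part `(k - l) p q` by
Euler's identity. -/
theorem sum_rotGen_harmonic {k l : ℕ} {p q : MvPolynomial (Fin N) ℂ} (hp : p ∈ harmonicPoly N k)
    (hq : q ∈ harmonicPoly N l) (hkl : k ≠ l) :
    ∑ i, ∑ j, rotGen i j (X i * (q * pderiv j p - p * pderiv j q)) =
      C (-((N : ℂ) + (k + l) - 2) * (k - l)) * (p * q) := by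
  have hp1 : p.IsHomogeneous k := hp.1
  have hq1 : q.IsHomogeneous l := hq.1
  have hp2 : polyLaplacian N p = 0 := hp.2
  have hq2 : polyLaplacian N q = 0 := hq.2
  have hpos : 1 ≤ k + l := by omega
  have hhom : ∀ j, (q * pderiv j p - p * pderiv j q).IsHomogeneous (k + l - 1) := by
    intro j
    refine IsHomogeneous.sub ?_ ?_
    -- In degree zero the truncated `k - 1` is the wrong degree, but the derivative vanishes.
    · rcases Nat.eq_zero_or_pos k with rfl | hk
      · have : pderiv j p = 0 := by
          rw [totalDegree_eq_zero_iff_eq_C.1 ((totalDegree_zero_iff_isHomogeneous _).2 hp1),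
            pderiv_C]
        rw [this, mul_zero]
        exact isHomogeneous_zero _ _ _
      · have := hq1.mul (hp1.pderiv (i := j))
        rwa [show l + (k - 1) = k + l - 1 by omega] at this
    · rcases Nat.eq_zero_or_pos l with rfl | hl
      · have : pderiv j q = 0 := by
          rw [totalDegree_eq_zero_iff_eq_C.1 ((totalDegree_zero_iff_isHomogeneous _).2 hq1),
            pderiv_C]
        rw [this, mul_zero]
        exact isHomogeneous_zero _ _ _
      · have := hp1.mul (hq1.pderiv (i := j))
        rwa [show k + (l - 1) = k + l - 1 by omega] at this
  rw [sum_rotGen hhom]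
  have e1 : ∑ j, pderiv j (q * pderiv j p - p * pderiv j q) = 0 := by
    have : ∑ j, pderiv j (q * pderiv j p - p * pderiv j q) =
        q * polyLaplacian N p - p * polyLaplacian N q := by
      simp only [polyLaplacian_apply, Finset.mul_sum, ← Finset.sum_sub_distrib, map_sub,
        Derivation.leibniz, smul_eq_mul]
      exact Finset.sum_congr rfl fun i _ => by ring
    rw [this, hp2, hq2]
    simp
  have e2 : ∑ j, X j * (q * pderiv j p - p * pderiv j q) =
      ((k : MvPolynomial (Fin N) ℂ) - l) * (p * q) := by
    have : ∑ j, X j * (q * pderiv j p - p * pderiv j q) =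
        q * ∑ j, X j * pderiv j p - p * ∑ j, X j * pderiv j q := by
      simp only [Finset.mul_sum, ← Finset.sum_sub_distrib]
      exact Finset.sum_congr rfl fun i _ => by ring
    rw [this, hp1.sum_X_mul_pderiv, hq1.sum_X_mul_pderiv, nsmul_eq_mul, nsmul_eq_mul]
    ring
  rw [e1, e2]
  have e3 : ((k + l - 1 : ℕ) : MvPolynomial (Fin N) ℂ) = k + l - 1 := by
    rw [Nat.cast_sub hpos]; push_cast; ring
  rw [e3]
  simp only [map_mul, map_neg, map_sub, map_add, map_natCast, map_ofNat]
  ring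

end

/-! ### Spherical harmonics: orthogonality and completeness -/

section

variable {N : ℕ}

theorem polyRestrict_apply (p : MvPolynomial (Fin N) ℂ) (w : Sph N) :
    polyRestrict N p w = MvPolynomial.eval (fun i => (((w : Eu N) i : ℝ) : ℂ)) p := by
  induction p using MvPolynomial.induction_on with
  | C a => simp [polyRestrict]
  | add p q hp hq => simp [hp, hq]
  | mul_X p i hp =>
    rw [map_mul, ContinuousMap.mul_apply, hp, map_mul]
    simp [polyRestrict]

/-- The map of the sphere induced by a linear isometry. -/
def sphMap (R : Eu N ≃ₗᵢ[ℝ] Eu N) (w : Sph N) : Sph N :=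
  ⟨R w, by simp⟩

theorem continuous_sphMap (R : Eu N ≃ₗᵢ[ℝ] Eu N) : Continuous (sphMap R) :=
  (R.continuous.comp continuous_subtype_val).subtype_mk _

-- Surface measure is defined through volumes of cones over subsets of the sphere; an isometry maps
-- cones to cones and preserves volume.
open scoped Pointwise in
theorem measurePreserving_sphMap (R : Eu N ≃ₗᵢ[ℝ] Eu N) :
    MeasurePreserving (sphMap R) (surf N) (surf N) := by
  refine ⟨(continuous_sphMap R).measurable, ?_⟩
  ext A hA
  rw [Measure.map_apply (continuous_sphMap R).measurable hA, surf,
    Measure.toSphere_apply' _ hA,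
    Measure.toSphere_apply' _ ((continuous_sphMap R).measurable hA)]
  congr 1
  have h : (R ⁻¹' (Set.Ioo (0 : ℝ) 1 • ((fun w : Sph N => (w : Eu N)) '' A))) =
      Set.Ioo (0 : ℝ) 1 • ((fun w : Sph N => (w : Eu N)) '' (sphMap R ⁻¹' A)) := by
    ext x
    simp only [Set.mem_preimage, Set.mem_smul, Set.mem_image]
    constructor
    · rintro ⟨r, hr, _, ⟨w, hw, rfl⟩, hx⟩
      refine ⟨r, hr, _, ⟨sphMap R.symm w, ?_, rfl⟩, ?_⟩
      · have : sphMap R (sphMap R.symm w) = w := by ext1; simp [sphMap]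
        rwa [this]
      · have : R (r • (sphMap R.symm w : Eu N)) = R x := by simp [sphMap, hx]
        exact R.injective this
    · rintro ⟨r, hr, _, ⟨w, hw, rfl⟩, rfl⟩
      exact ⟨r, hr, _, ⟨sphMap R w, hw, rfl⟩, by simp [sphMap]⟩
  have hR := R.measurePreserving
  have := hR.measure_preimage_equiv (f := R.toHomeomorph.toMeasurableEquiv)
    (Set.Ioo (0 : ℝ) 1 • ((fun w : Sph N => (w : Eu N)) '' A))
  rw [← this]
  exact (congrArg volume h).symm

/-- The coordinates of a rotation in the `(i, j)` plane. -/
def rotCoord (i j : Fin N) (θ : ℝ) (v : Eu N) (k : Fin N) : ℝ :=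
  if k = i then Real.cos θ * v i - Real.sin θ * v j
  else if k = j then Real.sin θ * v i + Real.cos θ * v j else v k

theorem sum_rotCoord_sq {i j : Fin N} (hij : i ≠ j) (θ : ℝ) (v : Eu N) :
    ∑ k, rotCoord i j θ v k ^ 2 = ∑ k, v k ^ 2 := by
  rw [← sub_eq_zero, ← Finset.sum_sub_distrib]
  have h : ∀ k, rotCoord i j θ v k ^ 2 - v k ^ 2 =
      (if k = i then (Real.cos θ * v i - Real.sin θ * v j) ^ 2 - v i ^ 2 else 0) +
        (if k = j then (Real.sin θ * v i + Real.cos θ * v j) ^ 2 - v j ^ 2 else 0) := by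
    intro k
    unfold rotCoord
    by_cases h1 : k = i
    · subst h1; simp [hij]
    · by_cases h2 : k = j
      · subst h2; simp [h1]
      · simp [h1, h2]
  rw [Finset.sum_congr rfl fun k _ => h k, Finset.sum_add_distrib]
  simp only [Finset.sum_ite_eq', Finset.mem_univ, if_true]
  have := Real.sin_sq_add_cos_sq θ
  linear_combination (v i ^ 2 + v j ^ 2) * this

/-- The rotation by the angle `θ` in the `(i, j)` plane. -/
def rot {i j : Fin N} (hij : i ≠ j) (θ : ℝ) : Eu N ≃ₗᵢ[ℝ] Eu N :=
  LinearIsometry.toLinearIsometryEquiv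
    { toFun := fun v => WithLp.toLp 2 (rotCoord i j θ v)
      map_add' := fun v w => by
        ext k
        simp only [rotCoord, PiLp.add_apply]
        split_ifs <;> ring
      map_smul' := fun c v => by
        ext k
        simp only [rotCoord, PiLp.smul_apply, smul_eq_mul, RingHom.id_apply]
        split_ifs <;> ring
      norm_map' := fun v => by
        have := sum_rotCoord_sq hij θ v
        simp [EuclideanSpace.norm_eq, this] } rfl

theorem rot_apply {i j : Fin N} (hij : i ≠ j) (θ : ℝ) (v : Eu N) (k : Fin N) :
    rot hij θ v k = rotCoord i j θ v k := rfl

/-- Differentiation in `θ` and `rotGen` both obey the Leibniz rule, so only coordinates need to be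
checked. -/
theorem hasDerivAt_eval_rot {i j : Fin N} (hij : i ≠ j) (v : Eu N) (p : MvPolynomial (Fin N) ℂ)
    (θ : ℝ) :
    HasDerivAt (fun θ => MvPolynomial.eval (fun k => ((rot hij θ v k : ℝ) : ℂ)) p)
      (MvPolynomial.eval (fun k => ((rot hij θ v k : ℝ) : ℂ)) (rotGen i j p)) θ := by
  classical
  induction p using MvPolynomial.induction_on with
  | C a => simpa [rotGen_apply] using hasDerivAt_const θ a
  | add p q hp hq => simpa only [map_add] using hp.fun_add hq
  | mul_X p k hp =>
    have hk : HasDerivAt (fun θ => ((rot hij θ v k : ℝ) : ℂ))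
        (MvPolynomial.eval (fun k => ((rot hij θ v k : ℝ) : ℂ)) (rotGen i j (MvPolynomial.X k)))
        θ := by
      have hr : HasDerivAt (fun θ => rotCoord i j θ v k)
          (if k = i then -rotCoord i j θ v j else if k = j then rotCoord i j θ v i else 0) θ := by
        by_cases h1 : k = i
        · subst h1
          simp only [rotCoord, if_true, hij.symm, if_false]
          convert! ((Real.hasDerivAt_cos θ).mul_const (v k)).sub
            ((Real.hasDerivAt_sin θ).mul_const (v j)) using 1
          ring
        · by_cases h2 : k = j
          · subst h2
            simp only [rotCoord, h1, if_true, if_false]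
            convert! ((Real.hasDerivAt_sin θ).mul_const (v i)).add
              ((Real.hasDerivAt_cos θ).mul_const (v k)) using 1
            ring
          · simp only [rotCoord, h1, h2, if_false]
            exact hasDerivAt_const _ _
      have hr' := hr.ofReal_comp
      convert! hr' using 1
      simp only [rotGen_apply, MvPolynomial.pderiv_X, Pi.single_apply, map_sub, map_mul,
        MvPolynomial.eval_X, rot_apply]
      by_cases h1 : k = i
      · subst h1; simp [hij]
      · by_cases h2 : k = j
        · subst h2; simp [h1]
        · simp [h1, h2]
    have := hp.mul hk
    simp only [map_mul, MvPolynomial.eval_X] at this ⊢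
    convert! this using 1
    simp only [rotGen_apply, Derivation.leibniz, smul_eq_mul, map_sub, map_mul, map_add,
      MvPolynomial.eval_X]
    ring

theorem integrable_continuousMap (f : C(Sph N, ℂ)) : Integrable f (surf N) :=
  f.continuous.integrable_of_hasCompactSupport (HasCompactSupport.of_compactSpace _)

/-- Rotation generators integrate to zero over the sphere. -/
theorem integral_rotGen (i j : Fin N) (p : MvPolynomial (Fin N) ℂ) :
    ∫ w, polyRestrict N (rotGen i j p) w ∂(surf N) = 0 := by
  by_cases hij : i = j
  · subst hij
    simp [rotGen_apply]
  have hinv : ∀ θ, ∫ w, polyRestrict N p (sphMap (rot hij θ) w) ∂(surf N) =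
      ∫ w, polyRestrict N p w ∂(surf N) := fun θ => by
    have hmp := measurePreserving_sphMap (rot hij θ)
    have := integral_map (μ := surf N) (φ := sphMap (rot hij θ)) hmp.measurable.aemeasurable
      (f := polyRestrict N p) (polyRestrict N p).continuous.aestronglyMeasurable
    rw [hmp.map_eq] at this
    exact this.symm
  have hval : ∀ (q : MvPolynomial (Fin N) ℂ) θ (w : Sph N), polyRestrict N q (sphMap (rot hij θ) w)
      = MvPolynomial.eval (fun k => ((rot hij θ (w : Eu N) k : ℝ) : ℂ)) q :=
    fun q θ w => polyRestrict_apply q _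
  have hcont : ∀ (q : MvPolynomial (Fin N) ℂ) θ,
      Continuous fun w => polyRestrict N q (sphMap (rot hij θ) w) := fun q θ =>
    (polyRestrict N q).continuous.comp (continuous_sphMap _)
  -- By invariance the integral is constant in `θ`, while its derivative at `θ = 0` is the integral
  -- of the generator.
  have hder := hasDerivAt_integral_of_dominated_loc_of_deriv_le (μ := surf N)
    (F := fun θ w => polyRestrict N p (sphMap (rot hij θ) w))
    (F' := fun θ w => polyRestrict N (rotGen i j p) (sphMap (rot hij θ) w)) (x₀ := (0 : ℝ))
    (s := Set.univ) (bound := fun _ => ‖polyRestrict N (rotGen i j p)‖) Filter.univ_mem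
    (Eventually.of_forall fun θ => (hcont p θ).aestronglyMeasurable)
    ((hcont p 0).integrable_of_hasCompactSupport (HasCompactSupport.of_compactSpace _))
    (hcont _ 0).aestronglyMeasurable
    (Eventually.of_forall fun w θ _ => ContinuousMap.norm_coe_le_norm _ _)
    (integrable_const _)
    (Eventually.of_forall fun w θ _ => by
      simp only [hval]
      exact hasDerivAt_eval_rot hij _ _ _)
  simp only [hinv] at hder
  have h0 := hder.2.unique (hasDerivAt_const (0 : ℝ) (∫ w, polyRestrict N p w ∂(surf N)))
  have hid : ∀ w, sphMap (rot hij 0) w = w := by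
    intro w
    ext k
    change rotCoord i j 0 w k = _
    unfold rotCoord
    split_ifs with h1 h2
    · simp [h1]
    · simp [h2]
    · rfl
  simpa only [hid] using h0

/-- Integrating `sum_rotGen_harmonic` kills the generators; the remaining factor `(N + k + l - 2)(k
- l)` is nonzero. -/
theorem integral_harmonic_mul_harmonic (hN : 3 ≤ N) {k l : ℕ} {p q : MvPolynomial (Fin N) ℂ}
    (hp : p ∈ harmonicPoly N k) (hq : q ∈ harmonicPoly N l) (hkl : k ≠ l) :
    ∫ w, polyRestrict N p w * polyRestrict N q w ∂(surf N) = 0 := by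
  have h := congrArg (fun r => ∫ w, polyRestrict N r w ∂(surf N)) (sum_rotGen_harmonic hp hq hkl)
  simp only [map_sum, ContinuousMap.coe_sum, Finset.sum_apply] at h
  rw [integral_finsetSum _ fun i _ => integrable_finsetSum _ fun j _ => integrable_continuousMap _]
    at h
  have h0 : ∀ i, ∫ w, ∑ j, polyRestrict N (rotGen i j (MvPolynomial.X i *
      (q * MvPolynomial.pderiv j p - p * MvPolynomial.pderiv j q))) w ∂(surf N) = 0 := by
    intro i
    rw [integral_finsetSum _ fun j _ => integrable_continuousMap _]
    exact Finset.sum_eq_zero fun j _ => integral_rotGen i j _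
  rw [Finset.sum_eq_zero fun i _ => h0 i] at h
  simp only [map_mul, ContinuousMap.mul_apply] at h
  have hC : ∀ (c : ℂ) (w : Sph N), polyRestrict N (MvPolynomial.C c) w = c := fun c w => by
    rw [polyRestrict_apply, MvPolynomial.eval_C]
  simp only [hC] at h
  rw [integral_const_mul] at h
  refine (mul_eq_zero.1 h.symm).resolve_left ?_
  refine mul_ne_zero (neg_ne_zero.2 ?_) (sub_ne_zero.2 (by exact_mod_cast hkl))
  have h2 : ((N + (k + l) : ℕ) : ℂ) - (2 : ℕ) ≠ 0 :=
    sub_ne_zero.2 (by norm_cast; omega)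
  push_cast at h2
  exact h2

theorem polyRestrict_map_conj (p : MvPolynomial (Fin N) ℂ) :
    polyRestrict N (MvPolynomial.map (starRingEnd ℂ) p) = star (polyRestrict N p) := by
  ext w
  rw [ContinuousMap.star_apply, polyRestrict_apply, polyRestrict_apply]
  induction p using MvPolynomial.induction_on with
  | C a => simp
  | add p q hp hq => simp [hp, hq]
  | mul_X p i hp => simp [hp]

theorem map_conj_mem_harmonicPoly {p : MvPolynomial (Fin N) ℂ} {k : ℕ}
    (hp : p ∈ harmonicPoly N k) :
    MvPolynomial.map (starRingEnd ℂ) p ∈ harmonicPoly N k := by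
  refine ⟨MvPolynomial.IsHomogeneous.map hp.1 _, ?_⟩
  have h2 : polyLaplacian N p = 0 := hp.2
  change polyLaplacian N _ = 0
  rw [polyLaplacian_apply]
  simp only [MvPolynomial.pderiv_map]
  rw [← map_sum, ← polyLaplacian_apply, h2, map_zero]

theorem inner_sphHarm_eq_zero (hN : 3 ≤ N) {k l : ℕ} (hkl : k ≠ l) {f g : L2Sph N}
    (hf : f ∈ sphHarm N k) (hg : g ∈ sphHarm N l) : inner ℂ f g = 0 := by
  obtain ⟨p, hp, rfl⟩ := hf
  obtain ⟨q, hq, rfl⟩ := hg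
  have h := integral_harmonic_mul_harmonic hN hq (map_conj_mem_harmonicPoly hp) hkl.symm
  simp only [polyRestrict_map_conj, ContinuousMap.star_apply] at h
  simp only [LinearMap.comp_apply, AlgHom.toLinearMap_apply, ContinuousLinearMap.coe_coe]
  rw [ContinuousMap.inner_toLp]
  exact h

/-- On the sphere `|x|² = 1`, so the radial powers in the harmonic decomposition disappear. -/
theorem toLp_polyRestrict_mem (hN : 0 < N) (p : MvPolynomial (Fin N) ℂ) :
    (ContinuousMap.toLp 2 (surf N) ℂ (polyRestrict N p) : L2Sph N) ∈ ⨆ l, sphHarm N l := by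
  set Λ : MvPolynomial (Fin N) ℂ →ₗ[ℂ] L2Sph N :=
    (ContinuousMap.toLp 2 (surf N) ℂ : C(Sph N, ℂ) →L[ℂ] L2Sph N).toLinearMap ∘ₗ
      (polyRestrict N).toLinearMap with hΛ
  change Λ p ∈ _
  have hr : polyRestrict N (normSqPoly N) = 1 := by
    ext w
    rw [polyRestrict_apply, normSqPoly]
    have hw : ‖(w : Eu N)‖ = 1 := by simp
    have h2 : ∑ i, (w : Eu N) i ^ 2 = 1 := by
      have := EuclideanSpace.norm_sq_eq (w : Eu N)
      rw [hw] at this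
      simpa using this.symm
    simp only [map_sum, map_pow, MvPolynomial.eval_X, ContinuousMap.one_apply]
    exact_mod_cast h2
  rw [← MvPolynomial.sum_homogeneousComponent p, map_sum]
  refine Submodule.sum_mem _ fun d _ => ?_
  have hd := homogeneousSubmodule_le_harmonicSpan hN d
    (MvPolynomial.homogeneousComponent_isHomogeneous d p)
  generalize MvPolynomial.homogeneousComponent d p = r at hd
  induction hd using Submodule.span_induction with
  | mem x hx =>
    obtain ⟨j, e, _, h, hh, rfl⟩ := hx
    have : Λ (normSqPoly N ^ j * h) = Λ h := by
      simp [hΛ, hr]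
    rw [this]
    exact Submodule.mem_iSup_of_mem e (Submodule.mem_map_of_mem hh)
  | zero => rw [map_zero]; exact Submodule.zero_mem _
  | add x y _ _ hx hy => rw [map_add]; exact Submodule.add_mem _ hx hy
  | smul a x _ hx => rw [map_smul]; exact Submodule.smul_mem _ _ hx

/-- The `*`-algebra of polynomial functions on the sphere. -/
def polyStarSubalgebra (N : ℕ) : StarSubalgebra ℂ C(Sph N, ℂ) where
  toSubalgebra := (polyRestrict N).range
  star_mem' := by
    rintro _ ⟨p, rfl⟩
    exact ⟨_, polyRestrict_map_conj p⟩

theorem polyStarSubalgebra_topologicalClosure :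
    (polyStarSubalgebra N).topologicalClosure = ⊤ := by
  refine ContinuousMap.starSubalgebra_topologicalClosure_eq_top_of_separatesPoints _ ?_
  intro v w hvw
  have : ∃ i, (v : Eu N) i ≠ (w : Eu N) i := by
    by_contra! h
    exact hvw (Subtype.ext (by ext i; exact h i))
  obtain ⟨i, hi⟩ := this
  refine ⟨_, ⟨polyRestrict N (MvPolynomial.X i), ⟨MvPolynomial.X i, rfl⟩, rfl⟩, ?_⟩
  change polyRestrict N (MvPolynomial.X i) v ≠ polyRestrict N (MvPolynomial.X i) w
  rw [polyRestrict_apply, polyRestrict_apply, MvPolynomial.eval_X, MvPolynomial.eval_X]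
  exact_mod_cast hi

/-- Completeness of the spherical harmonics. -/
theorem eq_zero_of_inner_sphHarm (hN : 0 < N) {v : L2Sph N}
    (hv : ∀ l, ∀ f ∈ sphHarm N l, inner ℂ f v = 0) : v = 0 := by
  have h1 : ∀ f ∈ ⨆ l, sphHarm N l, inner ℂ f v = 0 := by
    intro f hf
    induction hf using Submodule.iSup_induction' with
    | mem l f hf => exact hv l f hf
    | zero => simp
    | add f g _ _ hf hg => rw [inner_add_left, hf, hg, add_zero]
  have h2 : ∀ f : C(Sph N, ℂ), inner ℂ (ContinuousMap.toLp 2 (surf N) ℂ f : L2Sph N) v = 0 := by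
    intro f
    have hf : f ∈ (polyStarSubalgebra N).topologicalClosure := by
      rw [polyStarSubalgebra_topologicalClosure]; trivial
    have hcl : IsClosed {f : C(Sph N, ℂ) |
        inner ℂ (ContinuousMap.toLp 2 (surf N) ℂ f : L2Sph N) v = 0} :=
      isClosed_eq (by fun_prop) continuous_const
    refine closure_minimal ?_ hcl hf
    rintro _ ⟨p, rfl⟩
    exact h1 _ (toLp_polyRestrict_mem hN p)
  have h3 : ∀ f : L2Sph N, inner ℂ f v = 0 := by
    intro f
    refine DenseRange.induction_on (p := fun f : L2Sph N => inner ℂ f v = 0)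
      (ContinuousMap.toLp_denseRange (p := 2) ℂ (surf N) ℂ ENNReal.ofNat_ne_top) f
      (isClosed_eq (by fun_prop) continuous_const) h2
  exact inner_self_eq_zero.1 (h3 v)

end

/-! ### Products of `L²` spaces -/

section ProductL2

variable {α β : Type*} [MeasurableSpace α] [MeasurableSpace β] {μ : Measure α} {ν : Measure β}

theorem memLp_tensor {f : α → ℂ} {g : β → ℂ} (hf : MemLp f 2 μ) (hg : MemLp g 2 ν) :
    MemLp (fun p : α × β => f p.1 * g p.2) 2 (μ.prod ν) := by
  have hm : AEStronglyMeasurable (fun p : α × β => f p.1 * g p.2) (μ.prod ν) :=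
    hf.1.comp_fst.mul hg.1.comp_snd
  rw [memLp_two_iff_integrable_sq_norm hm]
  have := ((memLp_two_iff_integrable_sq_norm hf.1).1 hf).mul_prod
    ((memLp_two_iff_integrable_sq_norm hg.1).1 hg)
  simpa only [norm_mul, mul_pow] using this

theorem integral_mul_star_eq_inner {h g : β → ℂ} (hh : MemLp h 2 ν) (hg : MemLp g 2 ν) :
    ∫ w, h w * star (g w) ∂ν = inner ℂ (hg.toLp g) (hh.toLp h) := by
  rw [L2.inner_def]
  refine integral_congr_ae ?_
  filter_upwards [hg.coeFn_toLp, hh.coeFn_toLp] with w h1 h2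
  rw [h1, h2]
  rfl

theorem norm_sq_eq_integral (f : Lp ℂ 2 ν) : ‖f‖ ^ 2 = ∫ w, ‖f w‖ ^ 2 ∂ν := by
  have h3 := L2.inner_def (𝕜 := ℂ) f f
  have h4 : ∫ w, inner ℂ (f w) (f w) ∂ν = ((∫ w, ‖f w‖ ^ 2 ∂ν : ℝ) : ℂ) := by
    rw [← integral_complex_ofReal]
    refine integral_congr_ae (Eventually.of_forall fun w => ?_)
    simp [inner_self_eq_norm_sq_to_K]
  rw [h4, inner_self_eq_norm_sq_to_K] at h3
  refine Complex.ofReal_injective (Eq.trans ?_ h3)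
  push_cast
  rfl

/-- The tensor product of two `L²` functions. -/
def tensor (f : Lp ℂ 2 μ) (g : Lp ℂ 2 ν) : Lp ℂ 2 (μ.prod ν) :=
  (memLp_tensor (Lp.memLp f) (Lp.memLp g)).toLp _

theorem coeFn_tensor (f : Lp ℂ 2 μ) (g : Lp ℂ 2 ν) :
    tensor f g =ᵐ[μ.prod ν] fun p => f p.1 * g p.2 :=
  MemLp.coeFn_toLp _

variable [SFinite ν]

/-- The partial inner product `t ↦ ∫ v(t, w) conj (g w) dw`. -/
def partialInner (ν : Measure β) (v : α × β → ℂ) (g : β → ℂ) : α → ℂ :=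
  fun t => ∫ w, v (t, w) * star (g w) ∂ν

theorem partialInner_congr {v v' : α × β → ℂ} (h : v =ᵐ[μ.prod ν] v') (g : β → ℂ) :
    partialInner ν v g =ᵐ[μ] partialInner ν v' g := by
  filter_upwards [Measure.ae_ae_of_ae_prod h] with t ht
  refine integral_congr_ae ?_
  filter_upwards [ht] with w hw
  rw [hw]

variable [SFinite μ]

theorem ae_memLp_slice {v : α × β → ℂ} (hv : MemLp v 2 (μ.prod ν)) :
    ∀ᵐ t ∂μ, MemLp (fun w => v (t, w)) 2 ν := by
  have h1 := ((memLp_two_iff_integrable_sq_norm hv.1).1 hv).prod_right_ae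
  filter_upwards [h1, hv.1.prodMk_left] with t ht1 ht2
  exact (memLp_two_iff_integrable_sq_norm ht2).2 ht1

/-- Cauchy–Schwarz on almost every slice, then Fubini. -/
theorem memLp_partialInner {v : α × β → ℂ} (hv : MemLp v 2 (μ.prod ν)) {g : β → ℂ}
    (hg : MemLp g 2 ν) : MemLp (partialInner ν v g) 2 μ := by
  have hm : AEStronglyMeasurable (partialInner ν v g) μ :=
    AEStronglyMeasurable.integral_prod_right' (f := fun p : α × β => v p * star (g p.2))
      (hv.1.mul (continuous_star.comp_aestronglyMeasurable hg.1.comp_snd))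
  rw [memLp_two_iff_integrable_sq_norm hm]
  have h1 := ((memLp_two_iff_integrable_sq_norm hv.1).1 hv).integral_prod_left
  refine (h1.const_mul (‖hg.toLp g‖ ^ 2)).mono' (hm.norm.pow 2) ?_
  filter_upwards [ae_memLp_slice hv] with t ht
  have h2 : ∫ w, ‖v (t, w)‖ ^ 2 ∂ν = ‖ht.toLp _‖ ^ 2 := by
    rw [norm_sq_eq_integral]
    refine integral_congr_ae ?_
    filter_upwards [ht.coeFn_toLp] with w hw
    rw [hw]
  rw [h2, Real.norm_of_nonneg (by positivity), ← mul_pow]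
  gcongr
  unfold partialInner
  rw [integral_mul_star_eq_inner ht hg]
  exact norm_inner_le_norm _ _

/-- Partial integration against `g` is adjoint to tensoring with `g`. This yields linearity of the
tensor product and identifies abstract Hilbert sum coordinates with concrete coefficients. -/
theorem inner_tensor_left (f : Lp ℂ 2 μ) (g : Lp ℂ 2 ν) (v : Lp ℂ 2 (μ.prod ν)) :
    inner ℂ (tensor f g) v =
      inner ℂ f ((memLp_partialInner (Lp.memLp v) (Lp.memLp g)).toLp (partialInner ν v g)) := by
  have hint := L2.integrable_inner (𝕜 := ℂ) (tensor f g) v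
  have e : (fun p => inner ℂ (tensor f g p) (v p)) =ᵐ[μ.prod ν]
      fun p : α × β => v p * star (f p.1 * g p.2) := by
    filter_upwards [coeFn_tensor f g] with p hp
    rw [hp]
    rfl
  rw [L2.inner_def, L2.inner_def, integral_congr_ae e, integral_prod _ (hint.congr e)]
  refine integral_congr_ae ?_
  filter_upwards [(memLp_partialInner (Lp.memLp v) (Lp.memLp g)).coeFn_toLp] with t ht
  rw [ht]
  change _ = partialInner ν v g t * star (f t)
  unfold partialInner
  rw [← integral_mul_const]
  refine integral_congr_ae (Eventually.of_forall fun w => ?_)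
  simp only [star_mul']
  ring

theorem inner_tensor_tensor (f f' : Lp ℂ 2 μ) (g g' : Lp ℂ 2 ν) :
    inner ℂ (tensor f g) (tensor f' g') = inner ℂ f f' * inner ℂ g g' := by
  have e : (fun p => inner ℂ (tensor f g p) (tensor f' g' p)) =ᵐ[μ.prod ν]
      fun p : α × β => inner ℂ (f p.1) (f' p.1) * inner ℂ (g p.2) (g' p.2) := by
    filter_upwards [coeFn_tensor f g, coeFn_tensor f' g'] with p hp hp'
    rw [hp, hp']
    change (f' p.1 * g' p.2) * star (f p.1 * g p.2) =
      (f' p.1 * star (f p.1)) * (g' p.2 * star (g p.2))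
    rw [star_mul']
    ring
  rw [L2.inner_def, integral_congr_ae e,
    integral_prod_mul (fun a => inner ℂ (f a) (f' a)) (fun b => inner ℂ (g b) (g' b)),
    ← L2.inner_def, ← L2.inner_def]

theorem tensor_add_left (f f' : Lp ℂ 2 μ) (g : Lp ℂ 2 ν) :
    tensor (f + f') g = tensor f g + tensor f' g := by
  refine ext_inner_right ℂ fun v => ?_
  rw [inner_add_left, inner_tensor_left, inner_tensor_left, inner_tensor_left, inner_add_left]

theorem tensor_smul_left (c : ℂ) (f : Lp ℂ 2 μ) (g : Lp ℂ 2 ν) :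
    tensor (c • f) g = c • tensor f g := by
  refine ext_inner_right ℂ fun v => ?_
  rw [inner_smul_left, inner_tensor_left, inner_tensor_left, inner_smul_left]

theorem norm_tensor (f : Lp ℂ 2 μ) (g : Lp ℂ 2 ν) : ‖tensor f g‖ = ‖f‖ * ‖g‖ := by
  have h := inner_tensor_tensor f f g g
  simp only [inner_self_eq_norm_sq_to_K] at h
  have h2 : ‖tensor f g‖ ^ 2 = (‖f‖ * ‖g‖) ^ 2 := by
    rw [mul_pow]
    exact_mod_cast h
  exact (sq_eq_sq₀ (norm_nonneg _) (by positivity)).1 h2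

/-- Tensoring with a unit vector, as a linear isometry. -/
def tensorIsometry (μ : Measure α) [SFinite μ] {g : Lp ℂ 2 ν} (hg : ‖g‖ = 1) :
    Lp ℂ 2 μ →ₗᵢ[ℂ] Lp ℂ 2 (μ.prod ν) where
  toFun f := tensor f g
  map_add' f f' := tensor_add_left f f' g
  map_smul' c f := tensor_smul_left c f g
  norm_map' f := by
    change ‖tensor f g‖ = _
    rw [norm_tensor, hg, mul_one]

end ProductL2

/-! ### Expansion in spherical harmonics on the cylinder -/

section Cylinder

variable {N : ℕ}

/-- Indices of the spherical harmonics. -/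
abbrev HarmIdx (N : ℕ) : Type := Σ l : ℕ, Fin (mult N l)

/-- The spherical harmonic of index `i`. -/
def harm (i : HarmIdx N) : L2Sph N := (sphBasis N i.1 i.2 : sphHarm N i.1)

theorem orthonormal_harm (hN : 3 ≤ N) : Orthonormal ℂ (harm (N := N)) := by
  classical
  rw [orthonormal_iff_ite]
  rintro ⟨k, m⟩ ⟨l, n⟩
  by_cases hkl : k = l
  · subst hkl
    have h := orthonormal_iff_ite.1 (sphBasis N k).orthonormal m n
    rw [Submodule.coe_inner] at h
    refine h.trans ?_
    simp [Sigma.mk.injEq]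
  · have h1 : (⟨k, m⟩ : HarmIdx N) ≠ ⟨l, n⟩ := fun h => hkl (congrArg Sigma.fst h)
    rw [if_neg h1]
    exact inner_sphHarm_eq_zero hN hkl (Subtype.mem _) (Subtype.mem _)

theorem eq_zero_of_inner_harm (hN : 0 < N) {v : L2Sph N} (hv : ∀ i, inner ℂ (harm i) v = 0) :
    v = 0 := by
  refine eq_zero_of_inner_sphHarm hN fun l f hf => ?_
  have h := (sphBasis N l).sum_repr ⟨f, hf⟩
  have h2 : f = ∑ m, (sphBasis N l).repr ⟨f, hf⟩ m • harm ⟨l, m⟩ := by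
    refine (congrArg Subtype.val h).symm.trans ?_
    simp [harm]
  rw [h2, sum_inner]
  refine Finset.sum_eq_zero fun m _ => ?_
  rw [inner_smul_left, hv, mul_zero]

theorem memLp_sphCoef (v : L2Cyl N) (i : HarmIdx N) : MemLp (sphCoef v i.1 i.2) 2 volume :=
  memLp_partialInner (μ := volume) (ν := surf N) (Lp.memLp v) (Lp.memLp (harm i))

theorem toL2_of_memLp {X : Type} [MeasurableSpace X] {μ : Measure X} {f : X → ℂ}
    (hf : MemLp f 2 μ) : toL2 μ f = hf.toLp f := dif_pos hf

theorem inner_tensor_harm (v : L2Cyl N) (i : HarmIdx N) (f : Lp ℂ 2 (volume : Measure ℝ)) :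
    inner ℂ (tensor f (harm i) : L2Cyl N) v = inner ℂ f (toL2 volume (sphCoef v i.1 i.2)) := by
  rw [toL2_of_memLp (memLp_sphCoef v i)]
  exact inner_tensor_left f (harm i) v

/-- The isometric embedding `f ↦ f ⊗ Y_i`. -/
def harmEmbedding (hN : 3 ≤ N) (i : HarmIdx N) : Lp ℂ 2 (volume : Measure ℝ) →ₗᵢ[ℂ] L2Cyl N :=
  tensorIsometry volume ((orthonormal_harm hN).1 i)

theorem harmEmbedding_apply (hN : 3 ≤ N) (i : HarmIdx N) (f : Lp ℂ 2 (volume : Measure ℝ)) :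
    harmEmbedding hN i f = tensor f (harm i) := rfl

theorem orthogonalFamily_harmEmbedding (hN : 3 ≤ N) :
    OrthogonalFamily ℂ (fun _ : HarmIdx N => Lp ℂ 2 (volume : Measure ℝ)) (harmEmbedding hN) := by
  intro i j hij f g
  rw [harmEmbedding_apply, harmEmbedding_apply]
  refine (inner_tensor_tensor f g (harm i) (harm j)).trans ?_
  rw [(orthonormal_harm hN).2 hij, mul_zero]

/-- There are countably many indices, so for almost every `t` all coefficients of the slice vanish
at once, and completeness on the sphere applies. -/
theorem eq_zero_of_sphCoef (hN : 3 ≤ N) {v : L2Cyl N}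
    (h : ∀ i : HarmIdx N, sphCoef v i.1 i.2 =ᵐ[volume] 0) : v = 0 := by
  have hv := Lp.memLp v
  have h1 : ∀ᵐ t : ℝ, ∀ i : HarmIdx N, sphCoef v i.1 i.2 t = 0 := ae_all_iff.2 h
  have h2 : ∀ᵐ t : ℝ, ∀ᵐ w ∂(surf N), v (t, w) = 0 := by
    filter_upwards [h1, ae_memLp_slice (μ := volume) (ν := surf N) hv] with t ht1 ht2
    have h3 : ht2.toLp _ = 0 := by
      refine eq_zero_of_inner_harm (by omega) fun i => ?_
      have h4 := integral_mul_star_eq_inner ht2 (Lp.memLp (harm i))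
      rw [Lp.toLp_coeFn] at h4
      rw [← h4]
      exact ht1 i
    have h5 := ht2.coeFn_toLp
    rw [h3] at h5
    filter_upwards [h5, Lp.coeFn_zero ℂ 2 (surf N)] with w hw1 hw2
    rw [← hw1, hw2]
    rfl
  rw [Lp.eq_zero_iff_ae_eq_zero]
  have hm : MeasurableSet {p : ℝ × Sph N | v p = 0} :=
    (Lp.stronglyMeasurable v).measurable (measurableSet_singleton 0)
  exact (Measure.ae_prod_iff_ae_ae hm).2 h2

theorem isHilbertSum_harmEmbedding (hN : 3 ≤ N) :
    IsHilbertSum ℂ (fun _ : HarmIdx N => Lp ℂ 2 (volume : Measure ℝ)) (harmEmbedding hN) := by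
  refine IsHilbertSum.mk (orthogonalFamily_harmEmbedding hN) ?_
  rw [top_le_iff, Submodule.topologicalClosure_eq_top_iff, Submodule.eq_bot_iff]
  intro v hv
  refine eq_zero_of_sphCoef hN fun i => ?_
  have h1 : toL2 volume (sphCoef v i.1 i.2) = 0 := by
    refine ext_inner_left ℂ fun f => ?_
    rw [← inner_tensor_harm, inner_zero_right]
    exact (Submodule.mem_orthogonal _ _).1 hv _
      (Submodule.mem_iSup_of_mem i ⟨f, rfl⟩)
  rw [toL2_of_memLp (memLp_sphCoef v i)] at h1
  have h2 := (memLp_sphCoef v i).coeFn_toLp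
  rw [h1] at h2
  exact h2.symm.trans (Lp.coeFn_zero _ _ _)

/-- The expansion of `L²` of the cylinder in spherical harmonics. -/
def harmExpansion (hN : 3 ≤ N) :
    L2Cyl N ≃ₗᵢ[ℂ] lp (fun _ : HarmIdx N => Lp ℂ 2 (volume : Measure ℝ)) 2 :=
  (isHilbertSum_harmEmbedding hN).linearIsometryEquiv

/-- The abstract coordinate is tested against vectors supported at one index, whose preimages are
the tensors `f ⊗ Y_i`. -/
theorem harmExpansion_apply (hN : 3 ≤ N) (v : L2Cyl N) (i : HarmIdx N) :
    harmExpansion hN v i = toL2 volume (sphCoef v i.1 i.2) := by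
  classical
  refine ext_inner_left ℂ fun f => ?_
  have h1 := lp.inner_single_left (𝕜 := ℂ)
    (G := fun _ : HarmIdx N => Lp ℂ 2 (volume : Measure ℝ)) i f (harmExpansion hN v)
  have h2 : harmExpansion hN (tensor f (harm i)) = lp.single 2 i f :=
    ((LinearIsometryEquiv.symm_apply_eq (harmExpansion hN)).1
      ((isHilbertSum_harmEmbedding hN).linearIsometryEquiv_symm_apply_single f)).symm
  refine h1.symm.trans (Eq.trans ?_ (inner_tensor_harm v i f))
  rw [← h2]
  exact (harmExpansion hN).inner_map_map _ _

end Cylinder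

/-! ### The Fourier transform on the cylinder -/

theorem quasiMeasurePreserving_mul_left {a : ℝ} (ha : a ≠ 0) :
    Measure.QuasiMeasurePreserving (fun x : ℝ => a * x) volume volume := by
  refine ⟨measurable_const_mul a, ?_⟩
  rw [Real.map_volume_mul_left ha]
  exact Measure.smul_absolutelyContinuous

theorem ae_div_two_pi {p : ℝ → Prop} : (∀ᵐ ξ : ℝ, p (ξ / (2 * Real.pi))) ↔ ∀ᵐ η : ℝ, p η := by
  have hpi : (2 * Real.pi) ≠ 0 := by positivity
  constructor
  · intro h
    have := (quasiMeasurePreserving_mul_left hpi).ae h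
    filter_upwards [this] with x hx
    rwa [mul_div_cancel_left₀ _ hpi] at hx
  · intro h
    have := (quasiMeasurePreserving_mul_left (inv_ne_zero hpi)).ae h
    filter_upwards [this] with x hx
    rwa [← div_eq_inv_mul] at hx

section

variable {N : ℕ}

/-- The Fourier transform of the `i`-th coefficient, with Mathlib's normalization. -/
def fourierCoef (hN : 3 ≤ N) (v : L2Cyl N) (i : HarmIdx N) : Lp ℂ 2 (volume : Measure ℝ) :=
  𝓕 (harmExpansion hN v i : Lp ℂ 2 (volume : Measure ℝ))

theorem norm_fourierCoef (hN : 3 ≤ N) (v : L2Cyl N) (i : HarmIdx N) :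
    ‖fourierCoef hN v i‖ = ‖harmExpansion hN v i‖ :=
  Lp.norm_fourier_eq _

theorem cylFourier_eq (hN : 3 ≤ N) (v : L2Cyl N) (i : HarmIdx N) :
    cylFourier v i.1 i.2 = fun ξ => ((Real.sqrt (2 * Real.pi))⁻¹ : ℂ) *
      fourierCoef hN v i (ξ / (2 * Real.pi)) := by
  unfold fourierCoef
  rw [harmExpansion_apply]
  rfl

theorem isMultiplierImage_iff (hN : 3 ≤ N) {a : ℝ → ℕ → ℝ} {v w : L2Cyl N} :
    IsMultiplierImage a v w ↔ ∀ i : HarmIdx N, fourierCoef hN w i =ᵐ[volume]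
      fun η => (a (2 * Real.pi * η) i.1 : ℂ) * fourierCoef hN v i η := by
  have hpi : (2 * Real.pi) ≠ 0 := by positivity
  have hc : ((Real.sqrt (2 * Real.pi))⁻¹ : ℂ) ≠ 0 :=
    inv_ne_zero (by exact_mod_cast (Real.sqrt_pos.2 (by positivity)).ne')
  have key : ∀ i : HarmIdx N, (cylFourier w i.1 i.2 =ᵐ[volume] fun ξ =>
      (a ξ i.1 : ℂ) * cylFourier v i.1 i.2 ξ) ↔ fourierCoef hN w i =ᵐ[volume]
      fun η => (a (2 * Real.pi * η) i.1 : ℂ) * fourierCoef hN v i η := by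
    intro i
    rw [cylFourier_eq hN, cylFourier_eq hN]
    refine Iff.trans (eventually_congr (Eventually.of_forall fun ξ => ?_))
      (ae_div_two_pi (p := fun η => fourierCoef hN w i η =
        (a (2 * Real.pi * η) i.1 : ℂ) * fourierCoef hN v i η))
    dsimp only
    rw [mul_div_cancel₀ _ hpi]
    generalize (fourierCoef hN w i) (ξ / (2 * Real.pi)) = x
    generalize (fourierCoef hN v i) (ξ / (2 * Real.pi)) = y
    constructor
    · intro h
      refine mul_left_cancel₀ hc (h.trans ?_)
      ring
    · intro h
      rw [h]
      ring
  exact ⟨fun h i => (key i).1 (h i.1 i.2), fun h l m => (key ⟨l, m⟩).2 (h ⟨l, m⟩)⟩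

theorem fourierCoef_injective (hN : 3 ≤ N) {v w : L2Cyl N}
    (h : ∀ i, fourierCoef hN v i = fourierCoef hN w i) : v = w := by
  refine (harmExpansion hN).injective (lp.ext (funext fun i => ?_))
  exact (Lp.fourierTransformₗᵢ ℝ ℂ).injective (h i)

theorem fourierCoef_add (hN : 3 ≤ N) (v w : L2Cyl N) (i : HarmIdx N) :
    fourierCoef hN (v + w) i = fourierCoef hN v i + fourierCoef hN w i := by
  unfold fourierCoef
  rw [map_add]
  exact (Lp.fourierTransformₗᵢ ℝ ℂ).map_add _ _

theorem fourierCoef_smul (hN : 3 ≤ N) (c : ℂ) (v : L2Cyl N) (i : HarmIdx N) :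
    fourierCoef hN (c • v) i = c • fourierCoef hN v i := by
  unfold fourierCoef
  rw [map_smul]
  exact (Lp.fourierTransformₗᵢ ℝ ℂ).map_smul _ _

theorem hasSum_norm_fourierCoef (hN : 3 ≤ N) (v : L2Cyl N) :
    HasSum (fun i => ‖fourierCoef hN v i‖ ^ 2) (‖v‖ ^ 2) := by
  have h := lp.hasSum_norm (p := 2) (by simp) (harmExpansion hN v)
  rw [LinearIsometryEquiv.norm_map] at h
  simp only [norm_fourierCoef]
  simpa using h

theorem exists_fourierCoef (hN : 3 ≤ N) (F : HarmIdx N → Lp ℂ 2 (volume : Measure ℝ))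
    (hF : Summable fun i => ‖F i‖ ^ 2) : ∃ v : L2Cyl N, ∀ i, fourierCoef hN v i = F i := by
  have hmem : Memℓp (fun i => (Lp.fourierTransformₗᵢ ℝ ℂ).symm (F i)) 2 := by
    refine memℓp_gen ?_
    simpa using hF
  refine ⟨(harmExpansion hN).symm ⟨_, hmem⟩, fun i => ?_⟩
  unfold fourierCoef
  rw [LinearIsometryEquiv.apply_symm_apply]
  exact (Lp.fourierTransformₗᵢ ℝ ℂ).apply_symm_apply _

theorem exists_isMultiplierImage (hN : 3 ≤ N) {a : ℝ → ℕ → ℝ}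
    (ha : ∀ l, Measurable fun ξ => a ξ l) {C : ℝ} (hC : ∀ ξ l, |a ξ l| ≤ C) (v : L2Cyl N) :
    ∃ w, IsMultiplierImage a v w := by
  have hb : ∀ (i : HarmIdx N) (η : ℝ), ‖(a (2 * Real.pi * η) i.1 : ℂ) * fourierCoef hN v i η‖ ≤
      C * ‖fourierCoef hN v i η‖ := by
    intro i η
    rw [norm_mul, Complex.norm_real, Real.norm_eq_abs]
    gcongr
    exact hC _ _
  have hC0 : 0 ≤ C := (abs_nonneg _).trans (hC 0 0)
  have hmem : ∀ i : HarmIdx N,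
      MemLp (fun η => (a (2 * Real.pi * η) i.1 : ℂ) * fourierCoef hN v i η) 2 volume := by
    intro i
    refine MemLp.of_le_mul (c := C) (Lp.memLp (fourierCoef hN v i)) ?_
      (Eventually.of_forall (hb i))
    refine AEStronglyMeasurable.mul ?_ (Lp.aestronglyMeasurable _)
    exact (Complex.measurable_ofReal.comp ((ha i.1).comp
      (measurable_const_mul _))).aestronglyMeasurable
  obtain ⟨w, hw⟩ := exists_fourierCoef hN (fun i => (hmem i).toLp _) (by
    refine Summable.of_nonneg_of_le (fun i => by positivity) (fun i => ?_)
      ((hasSum_norm_fourierCoef hN v).summable.mul_left (C ^ 2))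
    rw [← mul_pow]
    gcongr
    refine Lp.norm_le_mul_norm_of_ae_le_mul ?_
    filter_upwards [(hmem i).coeFn_toLp] with η hη
    rw [hη]
    exact hb i η)
  refine ⟨w, (isMultiplierImage_iff hN).2 fun i => ?_⟩
  rw [hw i]
  exact (hmem i).coeFn_toLp

theorem isMultiplierImage_unique (hN : 3 ≤ N) {a : ℝ → ℕ → ℝ} {v w w' : L2Cyl N}
    (h : IsMultiplierImage a v w) (h' : IsMultiplierImage a v w') : w = w' :=
  fourierCoef_injective hN fun i => Lp.ext
    (((isMultiplierImage_iff hN).1 h i).trans ((isMultiplierImage_iff hN).1 h' i).symm)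

theorem isMultiplierImage_add (hN : 3 ≤ N) {a : ℝ → ℕ → ℝ} {v v' w w' : L2Cyl N}
    (h : IsMultiplierImage a v w) (h' : IsMultiplierImage a v' w') :
    IsMultiplierImage a (v + v') (w + w') := by
  rw [isMultiplierImage_iff hN] at h h' ⊢
  intro i
  rw [fourierCoef_add, fourierCoef_add]
  filter_upwards [h i, h' i, Lp.coeFn_add (fourierCoef hN v i) (fourierCoef hN v' i),
    Lp.coeFn_add (fourierCoef hN w i) (fourierCoef hN w' i)] with η h1 h2 h3 h4
  rw [h3, h4, Pi.add_apply, Pi.add_apply, h1, h2]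
  ring

theorem isMultiplierImage_smul (hN : 3 ≤ N) {a : ℝ → ℕ → ℝ} {v w : L2Cyl N} (c : ℂ)
    (h : IsMultiplierImage a v w) : IsMultiplierImage a (c • v) (c • w) := by
  rw [isMultiplierImage_iff hN] at h ⊢
  intro i
  rw [fourierCoef_smul, fourierCoef_smul]
  filter_upwards [h i, Lp.coeFn_smul c (fourierCoef hN v i),
    Lp.coeFn_smul c (fourierCoef hN w i)] with η h1 h2 h3
  rw [h2, h3, Pi.smul_apply, Pi.smul_apply, h1, smul_eq_mul, smul_eq_mul]
  ring

theorem norm_le_of_isMultiplierImage (hN : 3 ≤ N) {a : ℝ → ℕ → ℝ} {C : ℝ}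
    (hC : ∀ ξ l, |a ξ l| ≤ C) {v w : L2Cyl N} (h : IsMultiplierImage a v w) : ‖w‖ ≤ C * ‖v‖ := by
  have hC0 : 0 ≤ C := (abs_nonneg _).trans (hC 0 0)
  rw [isMultiplierImage_iff hN] at h
  refine (sq_le_sq₀ (norm_nonneg _) (by positivity)).1 ?_
  rw [mul_pow]
  refine hasSum_le (fun i => ?_) (hasSum_norm_fourierCoef hN w)
    ((hasSum_norm_fourierCoef hN v).mul_left (C ^ 2))
  rw [← mul_pow]
  gcongr
  refine Lp.norm_le_mul_norm_of_ae_le_mul ?_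
  filter_upwards [h i] with η hη
  rw [hη, norm_mul, Complex.norm_real, Real.norm_eq_abs]
  gcongr
  exact hC _ _

/-- The Jacobian `2π` of the frequency rescaling cancels the squared prefactor `(2π)^{-1}`. -/
theorem integral_norm_cylFourier_sq (hN : 3 ≤ N) (v : L2Cyl N) (i : HarmIdx N) :
    ∫⁻ ξ : ℝ, ENNReal.ofReal (‖cylFourier v i.1 i.2 ξ‖ ^ 2) =
      ENNReal.ofReal (‖fourierCoef hN v i‖ ^ 2) := by
  have hpi : (0 : ℝ) < 2 * Real.pi := by positivity
  have e : ∀ ξ, ‖cylFourier v i.1 i.2 ξ‖ ^ 2 =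
      (2 * Real.pi)⁻¹ * ‖fourierCoef hN v i (ξ / (2 * Real.pi))‖ ^ 2 := by
    intro ξ
    rw [cylFourier_eq hN, norm_mul, mul_pow, norm_inv, Complex.norm_real,
      Real.norm_of_nonneg (Real.sqrt_nonneg _), inv_pow, Real.sq_sqrt hpi.le]
  have hint := (memLp_two_iff_integrable_sq_norm (Lp.aestronglyMeasurable _)).1
    (Lp.memLp (fourierCoef hN v i))
  simp only [e]
  rw [← ofReal_integral_eq_lintegral_ofReal ((hint.comp_div hpi.ne').const_mul _)
    (Eventually.of_forall fun ξ => by positivity), integral_const_mul,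
    Measure.integral_comp_div (fun η => ‖fourierCoef hN v i η‖ ^ 2), norm_sq_eq_integral,
    abs_of_pos hpi, smul_eq_mul, inv_mul_cancel_left₀ hpi.ne']

theorem tsum_integral_norm_cylFourier_sq (hN : 3 ≤ N) (v : L2Cyl N) :
    ∑' l : ℕ, ∑ m : Fin (mult N l), ∫⁻ ξ : ℝ, ENNReal.ofReal (‖cylFourier v l m ξ‖ ^ 2) =
      ENNReal.ofReal (‖v‖ ^ 2) := by
  rw [← (hasSum_norm_fourierCoef hN v).tsum_eq, ENNReal.ofReal_tsum_of_nonneg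
    (fun i => by positivity) (hasSum_norm_fourierCoef hN v).summable, ENNReal.tsum_sigma']
  refine tsum_congr fun l => ?_
  rw [tsum_fintype]
  exact Finset.sum_congr rfl fun m _ => integral_norm_cylFourier_sq hN v ⟨l, m⟩

/-! ### Translations -/

/-- Translation along the real line in `L²(ℝ)`. -/
def translate (h : ℝ) : Lp ℂ 2 (volume : Measure ℝ) → Lp ℂ 2 (volume : Measure ℝ) :=
  Lp.compMeasurePreserving (fun t => t + h) (measurePreserving_add_right volume h)

theorem coeFn_translate (h : ℝ) (f : Lp ℂ 2 (volume : Measure ℝ)) :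
    translate h f =ᵐ[volume] fun t => f (t + h) :=
  Lp.coeFn_compMeasurePreserving f (measurePreserving_add_right volume h)

theorem continuous_translate (h : ℝ) : Continuous (translate h) :=
  (Lp.isometry_compMeasurePreserving (measurePreserving_add_right volume h)).continuous

theorem norm_translate_char (h η : ℝ) : ‖Complex.exp (2 * Real.pi * (h * η) * Complex.I)‖ = 1 := by
  have := Complex.norm_exp_ofReal_mul_I (2 * Real.pi * (h * η))
  push_cast at this
  exact this

theorem memLp_char_mul (h : ℝ) (f : Lp ℂ 2 (volume : Measure ℝ)) :
    MemLp (fun η : ℝ => Complex.exp (2 * Real.pi * (h * η) * Complex.I) * f η) 2 volume := by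
  refine MemLp.of_le (Lp.memLp f) ?_ (Eventually.of_forall fun η => ?_)
  · refine AEStronglyMeasurable.mul (Continuous.aestronglyMeasurable (by fun_prop))
      (Lp.aestronglyMeasurable _)
  · rw [norm_mul, norm_translate_char, one_mul]

/-- Multiplication by a character. -/
def charMul (h : ℝ) (f : Lp ℂ 2 (volume : Measure ℝ)) : Lp ℂ 2 (volume : Measure ℝ) :=
  (memLp_char_mul h f).toLp _

theorem coeFn_charMul (h : ℝ) (f : Lp ℂ 2 (volume : Measure ℝ)) :
    charMul h f =ᵐ[volume] fun η => Complex.exp (2 * Real.pi * (h * η) * Complex.I) * f η :=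
  MemLp.coeFn_toLp _

theorem continuous_charMul (h : ℝ) : Continuous (charMul h) := by
  refine LipschitzWith.continuous (K := 1) (LipschitzWith.of_dist_le_mul fun f g => ?_)
  rw [dist_eq_norm, dist_eq_norm, NNReal.coe_one]
  refine Lp.norm_le_mul_norm_of_ae_le_mul ?_
  filter_upwards [coeFn_charMul h f, coeFn_charMul h g, Lp.coeFn_sub f g,
    Lp.coeFn_sub (charMul h f) (charMul h g)] with η h1 h2 h3 h4
  rw [h4, h3, Pi.sub_apply, Pi.sub_apply, h1, h2, ← mul_sub, norm_mul, norm_translate_char]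

/-- Both sides are continuous in `f`, so the classical formula on Schwartz functions extends by
density. -/
theorem fourier_translate (h : ℝ) (f : Lp ℂ 2 (volume : Measure ℝ)) :
    𝓕 (translate h f) = charMul h (𝓕 f) := by
  have hF : Continuous fun f : Lp ℂ 2 (volume : Measure ℝ) => 𝓕 f :=
    (Lp.fourierTransformₗᵢ ℝ ℂ).continuous
  refine DenseRange.induction_on
    (p := fun f : Lp ℂ 2 (volume : Measure ℝ) => 𝓕 (translate h f) = charMul h (𝓕 f))
    (SchwartzMap.denseRange_toLpCLM (p := 2) ENNReal.ofNat_ne_top) f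
    (isClosed_eq (hF.comp (continuous_translate h)) ((continuous_charMul h).comp hF)) ?_
  intro φ
  change 𝓕 (translate h (φ.toLp 2)) = charMul h (𝓕 (φ.toLp 2))
  have h1 : translate h (φ.toLp 2) = (φ.compSubConstCLM ℂ (-h)).toLp 2 := by
    refine Lp.ext ?_
    have h2 := (measurePreserving_add_right volume h).quasiMeasurePreserving.ae_eq_comp
      (φ.coeFn_toLp 2)
    filter_upwards [coeFn_translate h (φ.toLp 2), h2,
      (φ.compSubConstCLM ℂ (-h)).coeFn_toLp 2] with t a1 a2 a3
    rw [a1, a3, SchwartzMap.compSubConstCLM_apply, sub_neg_eq_add]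
    exact a2
  rw [h1, SchwartzMap.toLp_fourier_eq, SchwartzMap.toLp_fourier_eq]
  refine Lp.ext ?_
  filter_upwards [coeFn_charMul h ((𝓕 φ).toLp 2), (𝓕 φ).coeFn_toLp 2,
    (𝓕 (φ.compSubConstCLM ℂ (-h))).coeFn_toLp 2] with η a1 a2 a3
  rw [a1, a2, a3]
  have h3 : ((φ.compSubConstCLM ℂ (-h) : 𝓢(ℝ, ℂ)) : ℝ → ℂ) = (φ : ℝ → ℂ) ∘ fun v => v + h := by
    funext t
    simp [SchwartzMap.compSubConstCLM_apply]
  have h4 := congrFun (Fourier.fourierIntegral_comp_add_right Real.fourierChar volume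
    (φ : ℝ → ℂ) h) η
  rw [SchwartzMap.fourier_coe, SchwartzMap.fourier_coe, h3]
  have h5 : ∀ g : ℝ → ℂ, 𝓕 g η = Fourier.fourierIntegral Real.fourierChar volume g η := fun g => by
    rw [Real.fourier_real_eq]
    rfl
  rw [h5, h5, h4]
  rw [Circle.smul_def, Real.fourierChar_apply, smul_eq_mul]
  push_cast
  rw [mul_assoc (2 : ℂ)]

/-- Translation along the axis of the cylinder. -/
def cylTranslate (h : ℝ) : L2Cyl N → L2Cyl N :=
  Lp.compMeasurePreserving (Prod.map (fun t => t + h) id)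
    ((measurePreserving_add_right volume h).prod (MeasurePreserving.id (surf N)))

theorem coeFn_cylTranslate (h : ℝ) (v : L2Cyl N) :
    cylTranslate h v =ᵐ[cylMeas N] fun p => v (p.1 + h, p.2) :=
  Lp.coeFn_compMeasurePreserving v
    ((measurePreserving_add_right volume h).prod (MeasurePreserving.id (surf N)))

theorem sphCoef_cylTranslate (h : ℝ) (v : L2Cyl N) (i : HarmIdx N) :
    sphCoef (cylTranslate h v) i.1 i.2 =ᵐ[volume] fun t => sphCoef v i.1 i.2 (t + h) :=
  partialInner_congr (μ := volume) (ν := surf N) (coeFn_cylTranslate h v) (harm i)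

theorem fourierCoef_cylTranslate (hN : 3 ≤ N) (h : ℝ) (v : L2Cyl N) (i : HarmIdx N) :
    fourierCoef hN (cylTranslate h v) i = charMul h (fourierCoef hN v i) := by
  unfold fourierCoef
  rw [← fourier_translate]
  congr 1
  rw [harmExpansion_apply, harmExpansion_apply, toL2_of_memLp (memLp_sphCoef _ _),
    toL2_of_memLp (memLp_sphCoef _ _)]
  refine Lp.ext ?_
  have h2 := (measurePreserving_add_right volume h).quasiMeasurePreserving.ae_eq_comp
    (memLp_sphCoef v i).coeFn_toLp
  filter_upwards [(memLp_sphCoef (cylTranslate h v) i).coeFn_toLp, sphCoef_cylTranslate h v i,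
    coeFn_translate h ((memLp_sphCoef v i).toLp _), h2] with t a1 a2 a3 a4
  rw [a1, a2, a3]
  exact a4.symm

theorem isMultiplierImage_cylTranslate (hN : 3 ≤ N) {a : ℝ → ℕ → ℝ} {v w : L2Cyl N} (h : ℝ)
    (hvw : IsMultiplierImage a v w) :
    IsMultiplierImage a (cylTranslate h v) (cylTranslate h w) := by
  rw [isMultiplierImage_iff hN] at hvw ⊢
  intro i
  rw [fourierCoef_cylTranslate, fourierCoef_cylTranslate]
  filter_upwards [hvw i, coeFn_charMul h (fourierCoef hN v i),
    coeFn_charMul h (fourierCoef hN w i)] with η h1 h2 h3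
  rw [h2, h3, h1]
  ring

end

section

variable {N : ℕ} {s : ℝ}

/-! ### The operator `M_s` -/

theorem isMultiplierImage_Ms (hN : 3 ≤ N) (hs0 : 0 < s) (hs1 : s < 1) (v : L2Cyl N) :
    IsMultiplierImage (mbar N s) v (Ms N s v) := by
  obtain ⟨C, -, hC⟩ := exists_mbar_le_const hN hs0 hs1
  have h : ∃ w : L2Cyl N, IsMultiplierImage (mbar N s) v w :=
    exists_isMultiplierImage hN (measurable_mbar hN hs0 hs1) (C := C)
      (fun ξ l => by rw [abs_of_nonneg (mbar_nonneg ξ l)]; exact hC ξ l) v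
  rw [Ms, dif_pos h]
  exact h.choose_spec

theorem eq_Ms_of_isMultiplierImage (hN : 3 ≤ N) (hs0 : 0 < s) (hs1 : s < 1) {v w : L2Cyl N}
    (h : IsMultiplierImage (mbar N s) v w) : w = Ms N s v :=
  isMultiplierImage_unique hN h (isMultiplierImage_Ms hN hs0 hs1 v)

theorem exists_norm_Ms_le (hN : 3 ≤ N) (hs0 : 0 < s) (hs1 : s < 1) :
    ∃ C, ∀ v : L2Cyl N, ‖Ms N s v‖ ≤ C * ‖v‖ := by
  obtain ⟨C, -, hC⟩ := exists_mbar_le_const hN hs0 hs1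
  exact ⟨C, fun v => norm_le_of_isMultiplierImage hN
    (fun ξ l => by rw [abs_of_nonneg (mbar_nonneg ξ l)]; exact hC ξ l)
    (isMultiplierImage_Ms hN hs0 hs1 v)⟩

/-- The operator `M_s` as a bounded linear map. -/
def MsCLM (hN : 3 ≤ N) (hs0 : 0 < s) (hs1 : s < 1) : L2Cyl N →L[ℂ] L2Cyl N :=
  LinearMap.mkContinuousOfExistsBound
    { toFun := Ms N s
      map_add' := fun v w => (eq_Ms_of_isMultiplierImage hN hs0 hs1 (isMultiplierImage_add hN
        (isMultiplierImage_Ms hN hs0 hs1 v) (isMultiplierImage_Ms hN hs0 hs1 w))).symm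
      map_smul' := fun c v => (eq_Ms_of_isMultiplierImage hN hs0 hs1 (isMultiplierImage_smul hN c
        (isMultiplierImage_Ms hN hs0 hs1 v))).symm }
    (exists_norm_Ms_le hN hs0 hs1)

theorem MsCLM_apply (hN : 3 ≤ N) (hs0 : 0 < s) (hs1 : s < 1) (v : L2Cyl N) :
    MsCLM hN hs0 hs1 v = Ms N s v := rfl

theorem mbar_pos (hN : 3 ≤ N) (hs0 : 0 < s) (hs1 : s < 1) {ξ : ℝ} {l : ℕ}
    (h : (ξ, l) ≠ (0, 0)) : 0 < mbar N s ξ l := by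
  refine Real.sqrt_pos.2 (div_pos (hardySymbol_pos hN hs0 hs1 h) ?_)
  by_cases hl : l = 0
  · subst hl
    have hξ : ξ ≠ 0 := by rintro rfl; exact h rfl
    have := eigval_nonneg (N := N) (by omega) 0
    positivity
  · have := eigval_pos (N := N) (by omega) hl
    positivity

/-- The multiplier is positive off `(0, 0)`, and a single frequency is a null set. -/
theorem Ms_injective (hN : 3 ≤ N) (hs0 : 0 < s) (hs1 : s < 1) :
    Function.Injective (Ms N s) := by
  intro v w hvw
  have hpi : (2 * Real.pi) ≠ 0 := by positivity
  have hv := (isMultiplierImage_iff hN).1 (isMultiplierImage_Ms hN hs0 hs1 v)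
  have hw := (isMultiplierImage_iff hN).1 (isMultiplierImage_Ms hN hs0 hs1 w)
  rw [hvw] at hv
  refine fourierCoef_injective hN fun i => Lp.ext ?_
  have h0 : ∀ᵐ η : ℝ, η ≠ 0 := by simp [ae_iff]
  filter_upwards [hv i, hw i, h0] with η h1 h2 h3
  have hne : (2 * Real.pi * η, i.1) ≠ (0, 0) := by
    intro h
    exact mul_ne_zero hpi h3 (congrArg Prod.fst h)
  have hpos := mbar_pos hN hs0 hs1 hne
  exact mul_left_cancel₀ (by exact_mod_cast hpos.ne') (h1.symm.trans h2)

theorem Ms_cylTranslate (hN : 3 ≤ N) (hs0 : 0 < s) (hs1 : s < 1) (h : ℝ) (v : L2Cyl N) :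
    Ms N s (cylTranslate h v) = cylTranslate h (Ms N s v) :=
  (eq_Ms_of_isMultiplierImage hN hs0 hs1 (isMultiplierImage_cylTranslate hN h
    (isMultiplierImage_Ms hN hs0 hs1 v))).symm

theorem isPseudoDiff_Ms (hN : 3 ≤ N) (hs0 : 0 < s) (hs1 : s < 1) :
    IsPseudoDiff (s - 1) (mbarExt N s) (Ms N s) := by
  refine ⟨isSymbol_mbarExt hN hs0 hs1, fun v l m => ?_⟩
  have h0 : ∀ᵐ ξ : ℝ, ξ ≠ 0 := by simp [ae_iff]
  filter_upwards [isMultiplierImage_Ms hN hs0 hs1 v l m, h0] with ξ h1 h2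
  rw [h1, mbarExt_eq hN hs0 hs1 fun h => h2 (congrArg Prod.fst h)]

theorem one_add_sq_add_eigval_le (hN : 3 ≤ N) (ξ : ℝ) (l : ℕ) :
    1 + ξ ^ 2 + eigval N l ≤ N * (1 + |ξ| + l) ^ 2 := by
  have hN' : (3 : ℝ) ≤ N := by exact_mod_cast hN
  have hl : (0 : ℝ) ≤ l := Nat.cast_nonneg l
  have hx := abs_nonneg ξ
  rw [← sq_abs ξ, eigval]
  have e : (N : ℝ) * (1 + |ξ| + l) ^ 2 - (1 + |ξ| ^ 2 + l * (l + N - 2)) =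
      (N - 1) * (1 + |ξ| ^ 2 + l ^ 2) + N * (2 * |ξ| + 2 * |ξ| * l + l) + 2 * l := by ring
  have : 0 ≤ (N - 1 : ℝ) * (1 + |ξ| ^ 2 + l ^ 2) + N * (2 * |ξ| + 2 * |ξ| * l + l) + 2 * l := by
    have : (0 : ℝ) ≤ N - 1 := by linarith
    positivity
  linarith

/-- The Sobolev weight is at most a constant times `ρ^{2(1-s)}`, with `ρ = 1 + |ξ| + ℓ`, and `m̄²`
at most a constant times `ρ^{2(s-1)}`; Plancherel concludes. -/
theorem exists_sobolevNorm_Ms_le (hN : 3 ≤ N) (hs0 : 0 < s) (hs1 : s < 1) :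
    ∃ C : ℝ, 0 < C ∧ ∀ v : L2Cyl N,
      sobolevNorm (1 - s) (Ms N s v) ≤ ENNReal.ofReal (C * ‖v‖) := by
  obtain ⟨C, hC0, hC⟩ := exists_mbar_le hN hs0 hs1
  have hNpos : (0 : ℝ) < N := by exact_mod_cast (by omega : 0 < N)
  set K : ℝ := (N : ℝ) ^ (1 - s) * C ^ 2 with hK
  have hK0 : 0 < K := by positivity
  have hw : ∀ (ξ : ℝ) (l : ℕ), (1 + ξ ^ 2 + eigval N l) ^ (1 - s) * mbar N s ξ l ^ 2 ≤ K := by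
    intro ξ l
    have hμ := eigval_nonneg (N := N) (by omega) l
    set ρ : ℝ := 1 + |ξ| + l with hρ
    have hρ0 : 0 < ρ := by positivity
    calc (1 + ξ ^ 2 + eigval N l) ^ (1 - s) * mbar N s ξ l ^ 2
        ≤ (N * ρ ^ 2) ^ (1 - s) * (C * ρ ^ (s - 1)) ^ 2 := by
          have := mbar_nonneg (N := N) (s := s) ξ l
          have h1 := one_add_sq_add_eigval_le hN ξ l
          gcongr
          exact hC ξ l
      _ = K * ((ρ ^ 2) ^ (1 - s) * (ρ ^ (s - 1)) ^ 2) := by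
          rw [Real.mul_rpow hNpos.le (by positivity), hK]
          ring
      _ = K := by
          rw [← Real.rpow_natCast ρ 2, ← Real.rpow_natCast _ 2, ← Real.rpow_mul hρ0.le,
            ← Real.rpow_mul hρ0.le, ← Real.rpow_add hρ0]
          norm_num
          rw [show 2 * (1 - s) + (s - 1) * 2 = 0 by ring, Real.rpow_zero, mul_one]
  refine ⟨Real.sqrt K, Real.sqrt_pos.2 hK0, fun v => ?_⟩
  have hsum : ∑' l : ℕ, ∑ m : Fin (mult N l), ∫⁻ ξ : ℝ, ENNReal.ofReal
      ((1 + ξ ^ 2 + eigval N l) ^ (1 - s) * ‖cylFourier (Ms N s v) l m ξ‖ ^ 2) ≤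
      ENNReal.ofReal (K * ‖v‖ ^ 2) := by
    rw [ENNReal.ofReal_mul hK0.le, ← tsum_integral_norm_cylFourier_sq hN v,
      ← ENNReal.tsum_mul_left]
    refine ENNReal.tsum_le_tsum fun l => ?_
    rw [Finset.mul_sum]
    refine Finset.sum_le_sum fun m _ => ?_
    rw [← lintegral_const_mul' _ _ ENNReal.ofReal_ne_top]
    refine lintegral_mono_ae ?_
    filter_upwards [isMultiplierImage_Ms hN hs0 hs1 v l m] with ξ hξ
    rw [← ENNReal.ofReal_mul hK0.le, hξ, norm_mul, mul_pow, ← mul_assoc, Complex.norm_real,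
      Real.norm_of_nonneg (mbar_nonneg ξ l)]
    gcongr
    exact hw ξ l
  calc sobolevNorm (1 - s) (Ms N s v) ≤ ENNReal.ofReal (K * ‖v‖ ^ 2) ^ (1 / 2 : ℝ) :=
        ENNReal.rpow_le_rpow hsum (by norm_num)
    _ = ENNReal.ofReal (Real.sqrt K * ‖v‖) := by
        rw [ENNReal.ofReal_rpow_of_nonneg (by positivity) (by norm_num), ← Real.sqrt_eq_rpow,
          Real.sqrt_mul hK0.le, Real.sqrt_sq (norm_nonneg _)]

end

section

variable {N : ℕ}

/-! ### Logarithmic polar coordinates -/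

/-- The logarithmic polar coordinates `(t, w) ↦ e^t w`. -/
def logPolar (p : ℝ × Sph N) : Eu N := Real.exp p.1 • (p.2 : Eu N)

theorem norm_logPolar (p : ℝ × Sph N) : ‖logPolar p‖ = Real.exp p.1 := by
  rw [logPolar, norm_smul, Real.norm_of_nonneg (Real.exp_pos _).le, norm_eq_of_mem_sphere, mul_one]

theorem logPolar_ne_zero (p : ℝ × Sph N) : logPolar p ≠ 0 := by
  rw [← norm_ne_zero_iff, norm_logPolar]
  exact (Real.exp_pos _).ne'

theorem fromCyl_logPolar (g : ℝ × Sph N → ℂ) (p : ℝ × Sph N) : fromCyl g (logPolar p) = g p := by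
  rw [fromCyl, dif_neg (logPolar_ne_zero p)]
  congr 1
  refine Prod.ext ?_ (Subtype.ext ?_)
  · simp only [norm_logPolar, Real.log_exp]
  · simp only [norm_logPolar]
    rw [logPolar, smul_smul, inv_mul_cancel₀ (Real.exp_pos _).ne', one_smul]

theorem logPolar_injective : Function.Injective (logPolar (N := N)) := by
  intro p q h
  have h1 : p.1 = q.1 := by
    have := congrArg norm h
    rwa [norm_logPolar, norm_logPolar, Real.exp_eq_exp] at this
  refine Prod.ext h1 (Subtype.ext ?_)
  rw [logPolar, logPolar, h1] at h
  exact smul_right_injective _ (Real.exp_pos _).ne' h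

theorem continuous_logPolar : Continuous (logPolar (N := N)) :=
  (Real.continuous_exp.comp continuous_fst).smul (continuous_subtype_val.comp continuous_snd)

theorem measurableEmbedding_logPolar : MeasurableEmbedding (logPolar (N := N)) :=
  continuous_logPolar.measurableEmbedding logPolar_injective

/-- Polar coordinates followed by `r = e^t`, under which `r^{N-1} dr` becomes `e^{Nt} dt`. -/
theorem lintegral_logPolar (hN : 0 < N) {F : Eu N → ℝ≥0∞} (hF : Measurable F) :
    ∫⁻ x, F x = ∫⁻ p, ENNReal.ofReal (Real.exp (N * p.1)) * F (logPolar p) ∂(cylMeas N) := by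
  have : Nonempty (Fin N) := ⟨⟨0, hN⟩⟩
  have hd : Module.finrank ℝ (Eu N) = N := finrank_euclideanSpace_fin
  have hsm : Measurable fun q : Sph N × Set.Ioi (0 : ℝ) => F ((q.2 : ℝ) • (q.1 : Eu N)) :=
    hF.comp (Continuous.measurable (by fun_prop))
  have hfiber : ∀ w : Sph N, ∫⁻ r : Set.Ioi (0 : ℝ), F ((r : ℝ) • (w : Eu N))
      ∂(Measure.volumeIoiPow (Module.finrank ℝ (Eu N) - 1)) =
      ∫⁻ t : ℝ, ENNReal.ofReal (Real.exp (N * t)) * F (Real.exp t • (w : Eu N)) := by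
    intro w
    have hFw : Measurable fun r : ℝ => F (r • (w : Eu N)) :=
      hF.comp (Continuous.measurable (by fun_prop))
    rw [Measure.volumeIoiPow, lintegral_withDensity_eq_lintegral_mul
      (g := fun r : Set.Ioi (0 : ℝ) => F ((r : ℝ) • (w : Eu N)))
      _ (Measurable.ennreal_ofReal (by fun_prop)) (hFw.comp measurable_subtype_coe)]
    have e1 := lintegral_subtype_comap (μ := volume) (measurableSet_Ioi (a := (0 : ℝ)))
      (fun r : ℝ => ENNReal.ofReal (r ^ (Module.finrank ℝ (Eu N) - 1)) * F (r • (w : Eu N)))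
    refine e1.trans ?_
    rw [← Real.range_exp, ← Set.image_univ, lintegral_image_eq_lintegral_abs_deriv_mul
      MeasurableSet.univ (fun x _ => (Real.hasDerivAt_exp x).hasDerivWithinAt)
      Real.exp_injective.injOn, Measure.restrict_univ]
    refine lintegral_congr fun t => ?_
    rw [← mul_assoc, ← ENNReal.ofReal_mul (abs_nonneg _), abs_of_pos (Real.exp_pos t), hd,
      ← pow_succ', Nat.sub_add_cancel hN, ← Real.exp_nat_mul]
  calc ∫⁻ x, F x = ∫⁻ x in ({0}ᶜ : Set (Eu N)), F x := by rw [restrict_compl_singleton]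
    _ = ∫⁻ x : ({0}ᶜ : Set (Eu N)), F x ∂(volume.comap Subtype.val) :=
        (lintegral_subtype_comap (measurableSet_singleton _).compl _).symm
    _ = ∫⁻ q, F ((q.2 : ℝ) • (q.1 : Eu N)) ∂((surf N).prod
          (Measure.volumeIoiPow (Module.finrank ℝ (Eu N) - 1))) := by
        have hmp := (volume : Measure (Eu N)).measurePreserving_homeomorphUnitSphereProd
        rw [surf, ← hmp.lintegral_comp hsm]
        refine lintegral_congr fun x => ?_
        rw [← homeomorphUnitSphereProd_symm_apply_coe, Homeomorph.symm_apply_apply]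
    _ = ∫⁻ w : Sph N, ∫⁻ t : ℝ, ENNReal.ofReal (Real.exp (N * t)) * F (Real.exp t • (w : Eu N))
          ∂volume ∂(surf N) := by
        rw [lintegral_prod _ hsm.aemeasurable]
        exact lintegral_congr hfiber
    _ = _ := by
        rw [cylMeas, lintegral_prod_symm _ (Measurable.aemeasurable ?_)]
        · rfl
        · exact (Measurable.ennreal_ofReal (by fun_prop)).mul
            (hF.comp continuous_logPolar.measurable)

theorem wMeas_eq_map (hN : 0 < N) (α : ℝ) : wMeas N α = ((cylMeas N).withDensity fun p =>
    ENNReal.ofReal (Real.exp ((N - 2 * α) * p.1))).map logPolar := by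
  ext s hs
  have hm : Measurable fun x : Eu N => ENNReal.ofReal (‖x‖ ^ (-2 * α)) := by fun_prop
  rw [wMeas, withDensity_apply _ hs, ← lintegral_indicator hs,
    lintegral_logPolar hN (hm.indicator hs), measurableEmbedding_logPolar.map_apply,
    withDensity_apply _ (continuous_logPolar.measurable hs),
    ← lintegral_indicator (continuous_logPolar.measurable hs)]
  refine lintegral_congr fun p => ?_
  by_cases hp : logPolar p ∈ s
  · rw [Set.indicator_of_mem hp, Set.indicator_of_mem (by exact hp), norm_logPolar,
      ← ENNReal.ofReal_mul (Real.exp_pos _).le, ← Real.exp_mul, ← Real.exp_add]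
    congr 2
    ring
  · rw [Set.indicator_of_notMem hp, Set.indicator_of_notMem (by exact hp), mul_zero]

theorem wMeas_zero : wMeas N 0 = volume := by
  simp [wMeas]

theorem measurable_cylDensity (β : ℝ) :
    Measurable fun p : ℝ × Sph N => ENNReal.ofReal (Real.exp (β * p.1)) :=
  Measurable.ennreal_ofReal (by fun_prop)

theorem ae_cylDensity (β : ℝ) :
    ae ((cylMeas N).withDensity fun p => ENNReal.ofReal (Real.exp (β * p.1))) =
      ae (cylMeas N) := by
  refine le_antisymm (withDensity_absolutelyContinuous _ _).ae_le ?_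
  refine (withDensity_absolutelyContinuous' (measurable_cylDensity β).aemeasurable
    (Eventually.of_forall fun p => ?_)).ae_le
  simp [Real.exp_pos]

theorem ae_wMeas_iff (hN : 0 < N) (α : ℝ) {P : Eu N → Prop} :
    (∀ᵐ x ∂(wMeas N α), P x) ↔ ∀ᵐ p ∂(cylMeas N), P (logPolar p) := by
  rw [wMeas_eq_map hN, measurableEmbedding_logPolar.ae_map_iff, ae_cylDensity]

/-- On the cylinder the densities are positive, so all weights share the same null sets and
functions from different weighted spaces can be compared almost everywhere. -/
theorem ae_wMeas (hN : 0 < N) (α : ℝ) : ae (wMeas N α) = ae (volume : Measure (Eu N)) := by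
  ext s
  rw [← wMeas_zero]
  exact (ae_wMeas_iff hN α (P := (· ∈ s))).trans (ae_wMeas_iff hN 0 (P := (· ∈ s))).symm

theorem ae_volume_iff (hN : 0 < N) {P : Eu N → Prop} :
    (∀ᵐ x, P x) ↔ ∀ᵐ p ∂(cylMeas N), P (logPolar p) := by
  rw [← ae_wMeas_iff hN 0, wMeas_zero]

/-! ### The conformal transforms -/

theorem lift_apply (α : ℝ) (u : Eu N → ℂ) (p : ℝ × Sph N) :
    lift α u p = (Real.exp (((N : ℝ) - 2 * α) / 2 * p.1) : ℂ) * u (logPolar p) := rfl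

theorem lift_congr (hN : 0 < N) (α β : ℝ) {u u' : Eu N → ℂ} (h : u =ᵐ[wMeas N β] u') :
    lift α u =ᵐ[cylMeas N] lift α u' := by
  filter_upwards [(ae_wMeas_iff hN β).1 h] with p hp
  rw [lift_apply, lift_apply, hp]

theorem aestronglyMeasurable_lift_iff (hN : 0 < N) (α : ℝ) {u : Eu N → ℂ} :
    AEStronglyMeasurable (lift α u) (cylMeas N) ↔ AEStronglyMeasurable u (wMeas N α) := by
  have hexp : Continuous fun p : ℝ × Sph N =>
      (Real.exp (((N : ℝ) - 2 * α) / 2 * p.1) : ℂ) := by fun_prop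
  have hexp' : Continuous fun p : ℝ × Sph N =>
      (Real.exp (-(((N : ℝ) - 2 * α) / 2 * p.1)) : ℂ) := by fun_prop
  have hac : ∀ g : ℝ × Sph N → ℂ, AEStronglyMeasurable g (cylMeas N) ↔
      AEStronglyMeasurable g ((cylMeas N).withDensity fun p =>
        ENNReal.ofReal (Real.exp ((N - 2 * α) * p.1))) := fun g =>
    ⟨fun h => h.mono_ac (withDensity_absolutelyContinuous _ _),
      fun h => h.mono_ac (Measure.ae_le_iff_absolutelyContinuous.1 (ae_cylDensity _).ge)⟩
  rw [wMeas_eq_map hN, measurableEmbedding_logPolar.aestronglyMeasurable_map_iff, ← hac]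
  constructor
  · intro h
    refine (hexp'.aestronglyMeasurable.mul h).congr (Eventually.of_forall fun p => ?_)
    simp only [Pi.mul_apply, Function.comp_apply, lift_apply]
    rw [← mul_assoc, ← Complex.ofReal_mul, ← Real.exp_add, neg_add_cancel, Real.exp_zero,
      Complex.ofReal_one, one_mul]
  · exact fun h => hexp.aestronglyMeasurable.mul h

/-- The transported density `e^{(N-2α)t}` is the square of the conformal factor. -/
theorem eLpNorm_lift (hN : 0 < N) (α : ℝ) (u : Eu N → ℂ) :
    eLpNorm (lift α u) 2 (cylMeas N) = eLpNorm u 2 (wMeas N α) := by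
  rw [wMeas_eq_map hN, measurableEmbedding_logPolar.eLpNorm_map_measure,
    eLpNorm_eq_lintegral_rpow_enorm_toReal two_ne_zero ENNReal.ofNat_ne_top,
    eLpNorm_eq_lintegral_rpow_enorm_toReal two_ne_zero ENNReal.ofNat_ne_top,
    lintegral_withDensity_eq_lintegral_mul_non_measurable _ (measurable_cylDensity _)
      (Eventually.of_forall fun p => ENNReal.ofReal_lt_top)]
  congr 1
  refine lintegral_congr fun p => ?_
  rw [Pi.mul_apply, lift_apply, enorm_mul, ENNReal.mul_rpow_of_nonneg _ _ (by simp),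
    Function.comp_apply]
  congr 1
  rw [← ofReal_norm, Complex.norm_real, Real.norm_of_nonneg (Real.exp_pos _).le,
    ENNReal.ofReal_rpow_of_pos (Real.exp_pos _), ← Real.exp_mul]
  congr 2
  simp
  ring

theorem memLp_lift_iff (hN : 0 < N) (α : ℝ) {u : Eu N → ℂ} :
    MemLp (lift α u) 2 (cylMeas N) ↔ MemLp u 2 (wMeas N α) := by
  rw [MemLp, MemLp, aestronglyMeasurable_lift_iff hN, eLpNorm_lift hN]

/-- The inverse of the conformal transform, `x ↦ |x|^{-(N-2α)/2} v(ln |x|, x / |x|)`. -/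
def unlift (α : ℝ) (v : ℝ × Sph N → ℂ) : Eu N → ℂ :=
  fun x => ((‖x‖ ^ (-(((N : ℝ) - 2 * α) / 2)) : ℝ) : ℂ) * fromCyl v x

theorem lift_unlift (α : ℝ) (v : ℝ × Sph N → ℂ) : lift α (unlift α v) = v := by
  funext p
  rw [lift_apply, unlift, fromCyl_logPolar, norm_logPolar, ← Real.exp_mul, ← mul_assoc,
    ← Complex.ofReal_mul, ← Real.exp_add]
  convert one_mul _
  rw [show ((N : ℝ) - 2 * α) / 2 * p.1 + p.1 * -(((N : ℝ) - 2 * α) / 2) = 0 by ring,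
    Real.exp_zero, Complex.ofReal_one]

theorem unlift_congr (hN : 0 < N) (α : ℝ) {v v' : ℝ × Sph N → ℂ} (h : v =ᵐ[cylMeas N] v') :
    unlift α v =ᵐ[volume] unlift α v' := by
  refine (ae_volume_iff hN).2 ?_
  filter_upwards [h] with p hp
  rw [unlift, unlift, fromCyl_logPolar, fromCyl_logPolar, hp]

/-- Unlike `lift_unlift` this holds only almost everywhere: the origin is not covered by the
coordinates. -/
theorem unlift_lift (hN : 0 < N) (α : ℝ) (u : Eu N → ℂ) : unlift α (lift α u) =ᵐ[volume] u := by
  refine (ae_volume_iff hN).2 (Eventually.of_forall fun p => ?_)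
  have h := congrFun (lift_unlift α (lift α u)) p
  rw [lift_apply, lift_apply] at h
  exact mul_left_cancel₀ (by exact_mod_cast (Real.exp_pos _).ne') h

theorem memLp_unlift (hN : 0 < N) (α : ℝ) {v : ℝ × Sph N → ℂ} (hv : MemLp v 2 (cylMeas N)) :
    MemLp (unlift α v) 2 (wMeas N α) := by
  rwa [← memLp_lift_iff hN, lift_unlift]

/-- The conformal transform `Φ_α`, an isometric isomorphism. -/
def conformal (hN : 0 < N) (α : ℝ) : L2w N α ≃ₗᵢ[ℂ] L2Cyl N :=
  LinearIsometryEquiv.ofSurjective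
    { toFun := fun f => ((memLp_lift_iff hN α).2 (Lp.memLp f)).toLp _
      map_add' := fun f g => by
        refine Lp.ext ?_
        filter_upwards [((memLp_lift_iff hN α).2 (Lp.memLp (f + g))).coeFn_toLp,
          ((memLp_lift_iff hN α).2 (Lp.memLp f)).coeFn_toLp,
          ((memLp_lift_iff hN α).2 (Lp.memLp g)).coeFn_toLp,
          Lp.coeFn_add (((memLp_lift_iff hN α).2 (Lp.memLp f)).toLp _)
            (((memLp_lift_iff hN α).2 (Lp.memLp g)).toLp _),
          lift_congr hN α α (Lp.coeFn_add f g)] with p h1 h2 h3 h4 h5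
        rw [h1, h4, Pi.add_apply, h2, h3, h5, lift_apply, lift_apply, lift_apply, Pi.add_apply,
          mul_add]
      map_smul' := fun c f => by
        refine Lp.ext ?_
        filter_upwards [((memLp_lift_iff hN α).2 (Lp.memLp (c • f))).coeFn_toLp,
          ((memLp_lift_iff hN α).2 (Lp.memLp f)).coeFn_toLp,
          Lp.coeFn_smul c (((memLp_lift_iff hN α).2 (Lp.memLp f)).toLp _),
          lift_congr hN α α (Lp.coeFn_smul c f)] with p h1 h2 h3 h4
        rw [h1, RingHom.id_apply, h3, Pi.smul_apply, h2, h4, lift_apply, lift_apply, Pi.smul_apply,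
          smul_eq_mul, smul_eq_mul]
        ring
      norm_map' := fun f => by
        change ‖((memLp_lift_iff hN α).2 (Lp.memLp f)).toLp _‖ = _
        rw [Lp.norm_toLp, eLpNorm_lift hN, Lp.norm_def] }
    (fun v => by
      refine ⟨(memLp_unlift hN α (Lp.memLp v)).toLp _, Lp.ext ?_⟩
      refine (((memLp_lift_iff hN α).2 (Lp.memLp _)).coeFn_toLp).trans ?_
      refine (lift_congr hN α α (memLp_unlift hN α (Lp.memLp v)).coeFn_toLp).trans ?_
      rw [lift_unlift])

theorem coeFn_conformal (hN : 0 < N) (α : ℝ) (f : L2w N α) :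
    conformal hN α f =ᵐ[cylMeas N] lift α f :=
  ((memLp_lift_iff hN α).2 (Lp.memLp f)).coeFn_toLp

theorem conformal_toLp (hN : 0 < N) (α : ℝ) {f : Eu N → ℂ} (hf : MemLp f 2 (wMeas N α)) :
    conformal hN α (hf.toLp f) = ((memLp_lift_iff hN α).2 hf).toLp _ :=
  Lp.ext <| (coeFn_conformal hN α _).trans <|
    (lift_congr hN α α hf.coeFn_toLp).trans (MemLp.coeFn_toLp _).symm

theorem coeFn_conformal_symm (hN : 0 < N) (α : ℝ) (v : L2Cyl N) :
    (conformal hN α).symm v =ᵐ[volume] unlift α v := by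
  have h := coeFn_conformal hN α ((conformal hN α).symm v)
  rw [LinearIsometryEquiv.apply_symm_apply] at h
  exact (unlift_lift hN α _).symm.trans (unlift_congr hN α h.symm)

/-! ### Schwartz functions in the weighted space -/

/-- In radial form the integrand is `r^{N-1-2α} (1 + r)^{-(N+1)}`: integrable at `0` since `2α < N`,
and dominated by `r^{-2-2α}` at infinity. -/
theorem integrable_one_add_norm_wMeas (hN : 0 < N) {α : ℝ} (h0 : 0 ≤ α) (hα : 2 * α < N) :
    Integrable (fun x : Eu N => (1 + ‖x‖) ^ (-((N + 1 : ℕ) : ℝ))) (wMeas N α) := by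
  have : Nonempty (Fin N) := ⟨⟨0, hN⟩⟩
  have hd : Module.finrank ℝ (Eu N) = N := finrank_euclideanSpace_fin
  have hm : Measurable fun r : ℝ => r ^ (-2 * α) * (1 + r) ^ (-((N + 1 : ℕ) : ℝ)) := by fun_prop
  have e : ∀ r : ℝ, 0 < r → r ^ (N - 1) • (r ^ (-2 * α) * (1 + r) ^ (-((N + 1 : ℕ) : ℝ))) =
      r ^ ((N : ℝ) - 1 - 2 * α) * (1 + r) ^ (-((N + 1 : ℕ) : ℝ)) := by
    intro r hr
    rw [smul_eq_mul, ← mul_assoc, ← Real.rpow_natCast, Nat.cast_sub hN, ← Real.rpow_add hr,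
      Nat.cast_one]
    congr 2
    ring
  rw [wMeas, integrable_withDensity_iff_integrable_smul' (by fun_prop)
    (Eventually.of_forall fun x => ENNReal.ofReal_lt_top)]
  have h1 : Integrable (fun x : Eu N =>
      (fun r : ℝ => r ^ (-2 * α) * (1 + r) ^ (-((N + 1 : ℕ) : ℝ))) ‖x‖) volume := by
    refine (integrable_fun_norm_addHaar volume
      (f := fun r : ℝ => r ^ (-2 * α) * (1 + r) ^ (-((N + 1 : ℕ) : ℝ)))).2 ?_
    rw [hd, ← Set.Ioc_union_Ioi_eq_Ioi zero_le_one, integrableOn_union]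
    constructor
    · have i1 : IntegrableOn (fun r : ℝ => r ^ ((N : ℝ) - 1 - 2 * α)) (Set.Ioc 0 1) := by
        rw [← intervalIntegrable_iff_integrableOn_Ioc_of_le zero_le_one]
        exact intervalIntegral.intervalIntegrable_rpow' (by linarith)
      refine i1.mono' ((measurable_id.pow_const _).smul hm).aestronglyMeasurable ?_
      filter_upwards [ae_restrict_mem measurableSet_Ioc] with r hr
      have hr0 := hr.1
      refine le_of_eq_of_le (congrArg norm (e r hr0)) ?_
      rw [Real.norm_of_nonneg (by positivity)]
      exact mul_le_of_le_one_right (by positivity)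
        (Real.rpow_le_one_of_one_le_of_nonpos (by linarith) (neg_nonpos.2 (Nat.cast_nonneg _)))
    · have i2 : IntegrableOn (fun r : ℝ => r ^ (-2 - 2 * α)) (Set.Ioi 1) :=
        integrableOn_Ioi_rpow_of_lt (by linarith) zero_lt_one
      refine i2.mono' ((measurable_id.pow_const _).smul hm).aestronglyMeasurable ?_
      filter_upwards [ae_restrict_mem measurableSet_Ioi] with r hr
      have hr0 : 0 < r := zero_lt_one.trans hr
      refine le_of_eq_of_le (congrArg norm (e r hr0)) ?_
      rw [Real.norm_of_nonneg (by positivity)]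
      calc r ^ ((N : ℝ) - 1 - 2 * α) * (1 + r) ^ (-((N + 1 : ℕ) : ℝ))
          ≤ r ^ ((N : ℝ) - 1 - 2 * α) * r ^ (-((N + 1 : ℕ) : ℝ)) := by
            refine mul_le_mul_of_nonneg_left ?_ (by positivity)
            exact Real.rpow_le_rpow_of_nonpos hr0 (by linarith) (neg_nonpos.2 (Nat.cast_nonneg _))
        _ = r ^ (-2 - 2 * α) := by
            rw [← Real.rpow_add hr0]
            congr 1
            push_cast
            ring
  refine h1.congr (Eventually.of_forall fun x => ?_)
  simp only [smul_eq_mul]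
  rw [ENNReal.toReal_ofReal (by positivity)]

theorem hasTemperateGrowth_wMeas (hN : 0 < N) {α : ℝ} (h0 : 0 ≤ α) (hα : 2 * α < N) :
    (wMeas N α).HasTemperateGrowth :=
  ⟨⟨N + 1, integrable_one_add_norm_wMeas hN h0 hα⟩⟩

theorem isFiniteMeasureOnCompacts_wMeas (hN : 0 < N) {α : ℝ} (h0 : 0 ≤ α) (hα : 2 * α < N) :
    IsFiniteMeasureOnCompacts (wMeas N α) := by
  refine ⟨fun K hK => ?_⟩
  obtain ⟨R, hR0, hR⟩ := hK.isBounded.exists_pos_norm_le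
  have h := (integrable_one_add_norm_wMeas hN h0 hα).measure_norm_ge_lt_top
    (ε := (1 + R) ^ (-((N + 1 : ℕ) : ℝ))) (by positivity)
  refine (measure_mono fun x hx => ?_).trans_lt h
  rw [Set.mem_ofPred_eq, Real.norm_of_nonneg (by positivity)]
  exact Real.rpow_le_rpow_of_nonpos (by positivity) (by linarith [hR x hx])
    (neg_nonpos.2 (Nat.cast_nonneg _))

end

section

variable {N : ℕ} {s : ℝ}

/-! ### The transformation `T` -/

theorem toCyl_eq_lift (u : Eu N → ℂ) :
    (toCyl fun y => ((‖y‖ ^ (((N : ℝ) - 2 * s) / 2) : ℝ) : ℂ) * u y) = lift s u := by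
  funext p
  change ((‖logPolar p‖ ^ (((N : ℝ) - 2 * s) / 2) : ℝ) : ℂ) * u (logPolar p) = _
  rw [lift_apply, norm_logPolar, ← Real.exp_mul, mul_comm p.1]

theorem T_eq_unlift (u : Eu N → ℂ) :
    T s u = unlift 1 (Ms N s (toL2 (cylMeas N) (lift s u))) := by
  funext x
  rw [T, toCyl_eq_lift, unlift, mul_one]

theorem T_eq_of_memLp (hN : 0 < N) {f : Eu N → ℂ} (hf : MemLp f 2 (wMeas N s)) :
    T s f = unlift 1 (Ms N s (conformal hN s (hf.toLp f))) := by
  rw [T_eq_unlift, toL2_of_memLp ((memLp_lift_iff hN s).2 hf), conformal_toLp]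

theorem T_ae_eq (hN : 0 < N) {f : Eu N → ℂ} (hf : MemLp f 2 (wMeas N s)) :
    T s f =ᵐ[volume] (conformal hN 1).symm (Ms N s (conformal hN s (hf.toLp f))) := by
  rw [T_eq_of_memLp hN hf]
  exact (coeFn_conformal_symm hN 1 _).symm

/-- The transformation `T` as a bounded linear map between the weighted spaces. -/
def TCLM (hN : 3 ≤ N) (hs0 : 0 < s) (hs1 : s < 1) : L2w N s →L[ℂ] L2w N 1 :=
  ((conformal (Nat.zero_lt_of_lt hN) 1).symm.toContinuousLinearEquiv : L2Cyl N →L[ℂ] L2w N 1) ∘L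
    MsCLM hN hs0 hs1 ∘L
      ((conformal (Nat.zero_lt_of_lt hN) s).toContinuousLinearEquiv : L2w N s →L[ℂ] L2Cyl N)

theorem TCLM_injective (hN : 3 ≤ N) (hs0 : 0 < s) (hs1 : s < 1) :
    Function.Injective (TCLM hN hs0 hs1) :=
  (conformal (Nat.zero_lt_of_lt hN) 1).symm.injective.comp
    ((Ms_injective hN hs0 hs1).comp (conformal (Nat.zero_lt_of_lt hN) s).injective)

/-- The weighted measure has temperate growth and is finite on compact sets, so Schwartz functions
are dense in its `L²`. -/
theorem ext_of_schwartz (hN : 0 < N) (hs0 : 0 ≤ s) (hs : 2 * s < N)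
    {F : Type*} [NormedAddCommGroup F] [NormedSpace ℂ F] {A B : L2w N s →L[ℂ] F}
    (h : ∀ (u : 𝓢(Eu N, ℂ)) (hu : MemLp u 2 (wMeas N s)), A (hu.toLp u) = B (hu.toLp u)) :
    A = B := by
  have := hasTemperateGrowth_wMeas hN hs0 hs
  have := isFiniteMeasureOnCompacts_wMeas hN hs0 hs
  refine ContinuousLinearMap.coeFn_injective
    ((SchwartzMap.denseRange_toLpCLM (F := ℂ) (p := 2) (μ := wMeas N s)
      ENNReal.ofNat_ne_top).equalizer A.continuous B.continuous ?_)
  funext u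
  exact h u (u.memLp 2 (wMeas N s))

/-! ### Dilations -/

/-- Dilating by `λ` shifts `t` by `ln λ`; the scalar corrects the conformal factor for the shift. -/
theorem lift_dilate {lam : ℝ} (hlam : 0 < lam) (α : ℝ) (u : Eu N → ℂ) (p : ℝ × Sph N) :
    lift α (dilate lam u) p = ((lam ^ (-(((N : ℝ) - 2 * α) / 2)) : ℝ) : ℂ) *
      lift α u (p.1 + Real.log lam, p.2) := by
  have h : logPolar (p.1 + Real.log lam, p.2) = lam • logPolar p := by
    rw [logPolar, logPolar, smul_smul, Real.exp_add, Real.exp_log hlam, mul_comm lam]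
  rw [lift_apply, lift_apply, h, dilate, ← mul_assoc, ← Complex.ofReal_mul,
    Real.rpow_def_of_pos hlam, ← Real.exp_add]
  congr 3
  ring

theorem measurePreserving_cylShift (h : ℝ) :
    MeasurePreserving (fun p : ℝ × Sph N => (p.1 + h, p.2)) (cylMeas N) (cylMeas N) :=
  (measurePreserving_add_right volume h).prod (MeasurePreserving.id (surf N))

theorem memLp_dilate (hN : 0 < N) {lam : ℝ} (hlam : 0 < lam) {α : ℝ} {f : Eu N → ℂ}
    (hf : MemLp f 2 (wMeas N α)) : MemLp (dilate lam f) 2 (wMeas N α) := by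
  rw [← memLp_lift_iff hN] at hf ⊢
  rw [show lift α (dilate lam f) = fun p => _ from funext (lift_dilate hlam α f)]
  exact (hf.comp_measurePreserving (measurePreserving_cylShift _)).const_mul _

theorem conformal_dilate (hN : 0 < N) {lam : ℝ} (hlam : 0 < lam) {α : ℝ} {f : Eu N → ℂ}
    (hf : MemLp f 2 (wMeas N α)) :
    conformal hN α ((memLp_dilate hN hlam hf).toLp _) =
      ((lam ^ (-(((N : ℝ) - 2 * α) / 2)) : ℝ) : ℂ) •
        cylTranslate (Real.log lam) (conformal hN α (hf.toLp f)) := by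
  refine Lp.ext ?_
  rw [conformal_toLp, conformal_toLp]
  have h1 := (measurePreserving_cylShift (Real.log lam)).quasiMeasurePreserving.ae_eq_comp
    ((memLp_lift_iff hN α).2 hf).coeFn_toLp
  filter_upwards [((memLp_lift_iff hN α).2 (memLp_dilate hN hlam hf)).coeFn_toLp, h1,
    Lp.coeFn_smul ((lam ^ (-(((N : ℝ) - 2 * α) / 2)) : ℝ) : ℂ)
      (cylTranslate (Real.log lam) (((memLp_lift_iff hN α).2 hf).toLp _)),
    coeFn_cylTranslate (Real.log lam) (((memLp_lift_iff hN α).2 hf).toLp _)] with p a1 a2 a3 a4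
  rw [a1, lift_dilate hlam, a3, Pi.smul_apply, a4, smul_eq_mul]
  exact congrArg _ a2.symm

/-- The exponent is the mismatch of the conformal factors on the two sides: `-(N - 2s)/2 + (N - 2)/2
= s - 1`. -/
theorem T_dilate (hN : 3 ≤ N) (hs0 : 0 < s) (hs1 : s < 1) {lam : ℝ} (hlam : 0 < lam)
    {f : Eu N → ℂ} (hf : MemLp f 2 (wMeas N s)) :
    T s (dilate lam f) =ᵐ[volume]
      fun x => ((lam ^ (s - 1) : ℝ) : ℂ) * dilate lam (T s f) x := by
  have hN0 : 0 < N := by omega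
  set v := Ms N s (conformal hN0 s (hf.toLp f)) with hv
  have h1 : Ms N s (conformal hN0 s ((memLp_dilate hN0 hlam hf).toLp _)) =
      ((lam ^ (-(((N : ℝ) - 2 * s) / 2)) : ℝ) : ℂ) • cylTranslate (Real.log lam) v := by
    rw [conformal_dilate hN0 hlam, ← MsCLM_apply hN hs0 hs1, map_smul, MsCLM_apply,
      Ms_cylTranslate hN hs0 hs1]
  rw [T_eq_of_memLp hN0 (memLp_dilate hN0 hlam hf), h1, T_eq_of_memLp hN0 hf, ← hv]
  refine (ae_volume_iff hN0).2 ?_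
  filter_upwards [Lp.coeFn_smul ((lam ^ (-(((N : ℝ) - 2 * s) / 2)) : ℝ) : ℂ)
    (cylTranslate (Real.log lam) v), coeFn_cylTranslate (Real.log lam) v] with p a1 a2
  have h : lam • logPolar p = logPolar (p.1 + Real.log lam, p.2) := by
    rw [logPolar, logPolar, smul_smul, Real.exp_add, Real.exp_log hlam, mul_comm lam]
  rw [dilate, h, unlift, unlift, fromCyl_logPolar, fromCyl_logPolar, a1, Pi.smul_apply, a2,
    smul_eq_mul, ← mul_assoc, ← mul_assoc, norm_logPolar, norm_logPolar, ← Complex.ofReal_mul,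
    ← Complex.ofReal_mul, Real.exp_add, Real.exp_log hlam,
    Real.mul_rpow (Real.exp_pos _).le hlam.le, mul_left_comm (lam ^ (s - 1)), ← Real.rpow_add hlam]
  congr 4
  ring

end

end HardyTransport

end

/-! ### The main theorem -/

open HardyTransport in
theorem theorem7 (N : ℕ) (hN : 3 ≤ N) (s : ℝ) (hs0 : 0 < s) (hs1 : s < 1) :
    -- the multiplier and the operator `M_s` are well defined on all of `L²`
    (∀ (ξ : ℝ) (ℓ : ℕ), 0 ≤ hardySymbol N s ξ ℓ) ∧
    (∀ v : L2Cyl N, IsMultiplierImage (mbar N s) v (Ms N s v) ∧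
      ∀ w : L2Cyl N, IsMultiplierImage (mbar N s) v w → w = Ms N s v) ∧
    -- Schwartz functions belong to the weighted space
    (∀ u : 𝓢(Eu N, ℂ), MemLp u 2 (wMeas N s)) ∧
    -- (ii) symbol behaviour and smoothing order
    (MemLp (fun p : ℝ × ℕ => mbar N s p.1 p.2) ∞ ((volume : Measure ℝ).prod Measure.count) ∧
      Asymptotics.IsEquivalent
        (comap (fun p : ℝ × ℕ => p.1 ^ 2 + (p.2 : ℝ) ^ 2) atTop)
        (fun p : ℝ × ℕ => mbar N s p.1 p.2)
        (fun p : ℝ × ℕ => (p.1 ^ 2 + (p.2 : ℝ) ^ 2) ^ ((s - 1) / 2)) ∧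
      -- the symbol is `m̄`, continued through its removable point `(0, 0)`
      ∃ a : ℝ → ℕ → ℝ, (∀ (ξ : ℝ) (ℓ : ℕ), (ξ, ℓ) ≠ (0, 0) → a ξ ℓ = mbar N s ξ ℓ) ∧
        IsPseudoDiff (s - 1) a (Ms N s)) ∧
    ∃ (Φ : ∀ α : ℝ, L2w N α ≃ₗᵢ[ℂ] L2Cyl N) (Tbar : L2w N s →L[ℂ] L2w N 1),
      -- (i) the conformal transforms are isometric isomorphisms, and `T = Φ₁⁻¹ M_s Φ_s`
      (∀ (α : ℝ) (f : Eu N → ℂ) (hf : MemLp f 2 (wMeas N α)),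
        Φ α (hf.toLp f) =ᵐ[cylMeas N] lift α f) ∧
      (∀ (f : Eu N → ℂ) (hf : MemLp f 2 (wMeas N s)),
        T s f =ᵐ[volume] (Φ 1).symm (Ms N s (Φ s (hf.toLp f)))) ∧
      -- (iii) `T` extends uniquely from Schwartz functions to a bounded injective linear map,
      -- and the extension is given by the same formula
      (∀ (f : Eu N → ℂ) (hf : MemLp f 2 (wMeas N s)), Tbar (hf.toLp f) =ᵐ[volume] T s f) ∧
      (∀ T' : L2w N s →L[ℂ] L2w N 1,
        (∀ (u : 𝓢(Eu N, ℂ)) (hu : MemLp u 2 (wMeas N s)),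
          T' (hu.toLp u) =ᵐ[volume] T s u) → T' = Tbar) ∧
      Function.Injective Tbar ∧
      -- (iv) scale invariance
      (∀ lam : ℝ, 0 < lam → ∀ f : Eu N → ℂ, MemLp f 2 (wMeas N s) →
        MemLp (dilate lam f) 2 (wMeas N s) ∧
        T s (dilate lam f) =ᵐ[volume]
          fun x => ((lam ^ (s - 1) : ℝ) : ℂ) * dilate lam (T s f) x) ∧
      -- (v) Sobolev regularization on the cylinder
      (∃ C : ℝ, 0 < C ∧ ∀ v : L2Cyl N,
        sobolevNorm (1 - s) (Ms N s v) ≤ ENNReal.ofReal (C * ‖v‖)) ∧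
      Set.range Tbar ⊆ (Φ 1).symm '' sobolevCyl N (1 - s) := by
  have hN0 : 0 < N := by omega
  have h2s : 2 * s < N := by
    have : (3 : ℝ) ≤ N := by exact_mod_cast hN
    linarith
  have htg := hasTemperateGrowth_wMeas hN0 hs0.le h2s
  refine ⟨fun ξ l => hardySymbol_nonneg hN hs0 hs1 ξ l,
    fun v => ⟨isMultiplierImage_Ms hN hs0 hs1 v, fun w hw =>
      eq_Ms_of_isMultiplierImage hN hs0 hs1 hw⟩,
    fun u => u.memLp 2 (wMeas N s),
    ⟨memLp_mbar hN hs0 hs1, isEquivalent_mbar hN hs0 hs1, mbarExt N s,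
      fun ξ l h => mbarExt_eq hN hs0 hs1 h, isPseudoDiff_Ms hN hs0 hs1⟩,
    conformal hN0, TCLM hN hs0 hs1, fun α f hf => ?_, fun f hf => T_ae_eq hN0 hf,
    fun f hf => (T_ae_eq hN0 hf).symm, fun T' hT' => ?_, TCLM_injective hN hs0 hs1,
    fun lam hlam f hf => ⟨memLp_dilate hN0 hlam hf, T_dilate hN hs0 hs1 hlam hf⟩,
    exists_sobolevNorm_Ms_le hN hs0 hs1, ?_⟩
  · rw [conformal_toLp]
    exact MemLp.coeFn_toLp _
  · refine ext_of_schwartz hN0 hs0.le h2s fun u hu => Lp.ext ?_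
    rw [ae_wMeas hN0]
    exact (hT' u hu).trans (T_ae_eq hN0 hu)
  · rintro _ ⟨f, rfl⟩
    obtain ⟨C, -, hC⟩ := exists_sobolevNorm_Ms_le hN hs0 hs1
    exact ⟨_, (hC (conformal hN0 s f)).trans_lt ENNReal.ofReal_lt_top, rfl⟩
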